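/- Let $\beta\in\mathbb R$, $\gamma>0$, $T>0$, $s>\tfrac32$ and $\Omega=[0,2\pi]^3$. For functions that are $2\pi$-periodic in each variable let $H^s_p(\Omega)$ be the periodic Sobolev space with norm $\|f\|_s^2=\sum_{k\in\mathbb Z^3}(1+|k|^2)^s|\hat f_k|^2$, where $\hat f_k=(2\pi)^{-3}\int_\Omega f(x)e^{-ik\cdot x}\,dx$. Let $u$ be a $2\pi$-periodic solution on $[0,T]$ of $$ i u_t+\Delta u+\beta e^{-2\gamma t}|u|^2u=0 $$ such that $u\in C^3([0,T];H^s_p(\Omega))$ (each $u(t,\cdot)$ being its continuous representative), and put $\psi(t,x)=e^{-\gamma t}u(t,x)$, a solution of the damped equation $i\psi_t+\Delta\psi+\beta|\psi|^2\psi+i\gamma\psi=0$. For an integer $M\ge1$ and an even integer $N\ge2$ let $\tau=T/M$, $t_n=n\tau$, $h=2\pi/N$, $x_l=lh$ for $0\le l\le N-1$, $J_h=\{0,\dots,N-1\}^3$ and $x_{j}=(x_{j_1},x_{j_2},x_{j_3})$ for $j\in J_h$. Put $\|U\|_h=\bigl(h^3\sum_{j\in J_h}|U_j|^2\bigr)^{1/2}$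 for $U\in\mathbb C^{J_h}$. Let $g_l(x)=\frac1N\sum_{p=-N/2}^{N/2}\frac1{a_p}e^{ip(x-x_l)}$ with $a_p=1$ for $|p|<N/2$ and $a_{\pm N/2}=2$, let $D_2=(g_l''(x_m))_{0\le m,l\le N-1}$, and let $\Delta_h=I\otimes I\otimes D_2+I\otimes D_2\otimes I+D_2\otimes I\otimes I$, that is, the sum of the actions of $D_2$ on each of the three indices. The linearly implicit conservative Fourier pseudo-spectral (LI-CFP) scheme determines $U^0,\dots,U^M\in\mathbb C^{J_h}$ by $U^0_j=u(0,x_j)$, the first step $$ i\,\frac{U^1-U^0}{\tau}+\Delta_h\frac{U^1+U^0}{2}+\beta e^{-\gamma\tau}\bigl|U^{(1/2)}\bigr|^2\,\frac{U^1+U^0}{2}=0, $$ $$ U^{(1/2)}_j=u(0,x_j)+\frac{\tau}{2}\,i\,\bigl(\Delta u(0,x_j)+\beta|u(0,x_j)|^2u(0,x_j)\bigr), $$ and, for $1\le n\le M-1$, $$ i\,\frac{U^{n+1}-U^{n-1}}{2\tau}+\Delta_h\frac{U^{n+1}+U^{n-1}}{2}+\beta e^{-2\gamma t_n}|U^n|^2\,\frac{U^{n+1}+U^{n-1}}{2}=0,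 $$ all products of grid functions being componentwise. Put $\Psi^n=e^{-\gamma t_n}U^n$, and write $u^n_j=u(t_n,x_j)$, $\psi^n_j=\psi(t_n,x_j)$. Then there are constants $s_0>0$ and $C_0>0$, independent of $M$, $N$ and $n$ (that is, of $n,\tau,h$), such that whenever $0<\tau\le s_0$ and $0<h\le s_0$, with no restriction on the ratio of $\tau$ and $h$, $$ \|u^n-U^n\|_h\le C_0\,(N^{-s}+\tau^2)\qquad\text{and}\qquad \|\psi^n-\Psi^n\|_h\le C_0\,e^{-\gamma t_n}(N^{-s}+\tau^2),\qquad 1\le n\le M. $$ -/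

import Mathlib

noncomputable section

namespace LICFP

/-! ### Periodic Sobolev spaces on the torus `[0, 2π]³` -/

/-- Functions of period `2π` in each of the three coordinates. -/
def IsPeriodic (f : EuclideanSpace ℝ (Fin 3) → ℂ) : Prop :=
  ∀ (x : EuclideanSpace ℝ (Fin 3)) (r : Fin 3),
    f (x + EuclideanSpace.single r (2 * Real.pi)) = f x

/-- The `k`-th Fourier coefficient `(2π)⁻³ ∫_{[0,2π]³} f(x) e^{-i k·x} dx`. -/
def torusCoeff (f : EuclideanSpace ℝ (Fin 3) → ℂ) (k : Fin 3 → ℤ) : ℂ :=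
  (1 / (2 * Real.pi) ^ 3 : ℝ) *
    ∫ x in Set.Icc (0 : Fin 3 → ℝ) (fun _ => 2 * Real.pi),
      f (WithLp.toLp 2 x) * Complex.exp (-Complex.I * ∑ r, (k r : ℂ) * (x r : ℂ))

/-- The weighted Fourier coefficients `(1 + |k|²)^{s/2} f̂(k)`. By definition `f` is in `H_p^s`
iff they are square summable, and their `ℓ²` norm is the norm of `f` in `H_p^s`. -/
def sobolevCoeff (s : ℝ) (f : EuclideanSpace ℝ (Fin 3) → ℂ) (k : Fin 3 → ℤ) : ℂ :=
  ((1 + ∑ r, (k r : ℝ) ^ 2) ^ (s / 2) : ℝ) * torusCoeff f k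

/-- `u ∈ C^m([0,T]; H_p^s)`, for `s > 3/2`, so that every `u(t,·)` is represented by its
continuous periodic representative. The map sending `f` to its weighted Fourier coefficients is a
linear isometry of `H_p^s` onto `ℓ²(ℤ³)`, so `u` is a `C^m` curve in `H_p^s` exactly when the
curve `t ↦ sobolevCoeff s (u t)` takes values in `ℓ²(ℤ³)` and is `C^m` there (with one-sided
derivatives at the endpoints). -/
structure IsSobolevCurve (m : ℕ) (s T : ℝ) (u : ℝ → EuclideanSpace ℝ (Fin 3) → ℂ) : Prop where
  continuous : ∀ t ∈ Set.Icc 0 T, Continuous (u t)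
  periodic : ∀ t ∈ Set.Icc 0 T, IsPeriodic (u t)
  contDiffOn : ∃ w : ℝ → lp (fun _ : Fin 3 → ℤ => ℂ) 2,
    ContDiffOn ℝ m w (Set.Icc 0 T) ∧
      ∀ t ∈ Set.Icc 0 T, ∀ k : Fin 3 → ℤ, w t k = sobolevCoeff s (u t) k

/-! ### The equation -/

/-- `u` is a solution on `[0,T]` of `i u_t + Δu + β e^{-2γt} |u|² u = 0`. -/
def IsSolution (β γ T : ℝ) (u : ℝ → EuclideanSpace ℝ (Fin 3) → ℂ) : Prop :=
  ∀ t ∈ Set.Icc 0 T, ContDiff ℝ 2 (u t) ∧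
    ∀ x : EuclideanSpace ℝ (Fin 3), ∃ v : ℂ,
      HasDerivWithinAt (fun r => u r x) v (Set.Icc 0 T) t ∧
      Complex.I * v + Laplacian.laplacian (u t) x
        + (β * Real.exp (-2 * γ * t) : ℝ) * ((‖u t x‖ ^ 2 : ℝ) : ℂ) * u t x = 0

/-! ### The grid and the Fourier pseudo-spectral Laplacian -/

/-- Complex grid functions on the `N × N × N` periodic grid. -/
abbrev GridFun (N : ℕ) : Type := (Fin 3 → Fin N) → ℂ

/-- The mesh size `h = 2π/N`. -/
def meshSize (N : ℕ) : ℝ := 2 * Real.pi / N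

/-- The one-dimensional collocation point `x_j = j h`. -/
def node (N : ℕ) (j : Fin N) : ℝ := (j : ℕ) * meshSize N

/-- The grid point `(x_{j₁}, x_{j₂}, x_{j₃})`. -/
def gridPoint (N : ℕ) (j : Fin 3 → Fin N) : EuclideanSpace ℝ (Fin 3) :=
  WithLp.toLp 2 (fun r => node N (j r))

/-- The trigonometric interpolation basis
`g_l(x) = N⁻¹ ∑_{p=-N/2}^{N/2} a_p⁻¹ e^{i p (x - x_l)}`, with `a_p = 2` for `|p| = N/2` and
`a_p = 1` otherwise (`N` even). -/
def interpBasis (N : ℕ) (l : Fin N) (x : ℝ) : ℂ :=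
  (1 / (N : ℂ)) * ∑ p ∈ Finset.Icc (-((N / 2 : ℕ) : ℤ)) ((N / 2 : ℕ) : ℤ),
    (1 / (if |p| = ((N / 2 : ℕ) : ℤ) then (2 : ℂ) else 1)) *
      Complex.exp (Complex.I * (p : ℂ) * ((x - node N l : ℝ) : ℂ))

/-- The spectral differentiation matrix `(D₂)_{j,l} = g_l''(x_j)`. -/
def diffMatrix (N : ℕ) : Matrix (Fin N) (Fin N) ℂ :=
  fun j l => iteratedDeriv 2 (interpBasis N l) (node N j)

/-- The pseudo-spectral Laplacian `Δ_h = I⊗I⊗D₂ + I⊗D₂⊗I + D₂⊗I⊗I`: in each of the three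
directions `D₂` acts on the corresponding index. -/
def discreteLaplacian (N : ℕ) (U : GridFun N) : GridFun N :=
  fun j => ∑ r : Fin 3, ∑ l : Fin N, diffMatrix N (j r) l * U (Function.update j r l)

/-- The discrete `L²` norm `‖U‖_h = (h³ ∑_j |U_j|²)^{1/2}`. -/
def gridNorm (N : ℕ) (U : GridFun N) : ℝ :=
  Real.sqrt (meshSize N ^ 3 * ∑ j, ‖U j‖ ^ 2)

/-! ### The scheme -/

/-- The extrapolated value `U^{(1/2)}` used in the first step:
`u(0,x_j) + (τ/2) i (Δu(0,x_j) + β |u(0,x_j)|² u(0,x_j))`. -/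
def startValue (β τ : ℝ) (N : ℕ) (u₀ : EuclideanSpace ℝ (Fin 3) → ℂ) : GridFun N :=
  fun j => u₀ (gridPoint N j) + (τ / 2 : ℝ) * Complex.I *
    (Laplacian.laplacian u₀ (gridPoint N j)
      + (β : ℂ) * ((‖u₀ (gridPoint N j)‖ ^ 2 : ℝ) : ℂ) * u₀ (gridPoint N j))

/-- `U⁰, …, U^M` is the solution of the linearly implicit conservative Fourier pseudo-spectral
scheme with time step `τ = T/M`, `N` collocation points per direction and initial datum `u₀`. -/
structure IsLICFP (β γ T : ℝ) (u₀ : EuclideanSpace ℝ (Fin 3) → ℂ) (M N : ℕ)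
    (U : ℕ → GridFun N) : Prop where
  /-- the initial value is the grid restriction of the initial datum -/
  init : ∀ j, U 0 j = u₀ (gridPoint N j)
  /-- the modified Crank-Nicolson step for `U¹`; here `t_{1/2} = τ/2` -/
  first : ∀ j,
    Complex.I * ((U 1 j - U 0 j) / ((T / M : ℝ) : ℂ))
      + discreteLaplacian N (fun i => (U 1 i + U 0 i) / 2) j
      + (β * Real.exp (-2 * γ * (T / M / 2)) : ℝ)
        * ((‖startValue β (T / M) N u₀ j‖ ^ 2 : ℝ) : ℂ) * ((U 1 j + U 0 j) / 2) = 0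
  /-- the three-level scheme for `1 ≤ n ≤ M - 1`; here `t_n = n τ` -/
  step : ∀ n : ℕ, 1 ≤ n → n + 1 ≤ M → ∀ j,
    Complex.I * ((U (n + 1) j - U (n - 1) j) / ((2 * (T / M) : ℝ) : ℂ))
      + discreteLaplacian N (fun i => (U (n + 1) i + U (n - 1) i) / 2) j
      + (β * Real.exp (-2 * γ * (n * (T / M))) : ℝ)
        * ((‖U n j‖ ^ 2 : ℝ) : ℂ) * ((U (n + 1) j + U (n - 1) j) / 2) = 0

end LICFP

end

noncomputable section

namespace LICFP

/-! ### Discrete Fourier analysis on the grid -/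

section Grid

variable {N : ℕ} [NeZero N]

/-! The proof is a consistency-plus-stability argument carried out in two norms: the discrete $L^2$
norm and the discrete Wiener norm, the sum of the moduli of the discrete Fourier coefficients. Both
are module norms over the discrete Wiener algebra and both are monotone in the moduli of the Fourier
coefficients (`IsWienerModuleNorm`).

Stability. The discrete characters diagonalize $\Delta_h$ with real eigenvalues. On each mode the
Crank-Nicolson step multiplies by a quotient $(i+x)/(i-x)$ with $x$ real, of modulus one, so it is
stable in either norm (`IsWienerModuleNorm.le_of_crankNicolson`). The nonlinear difference is linear
in the errors, with coefficients bounded in the Wiener algebra (`IsWienerModuleNorm.error_step`),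
and a discrete Gronwall inequality sums the steps (`three_level_gronwall`).

Consistency. Since $H^s_p$ is an algebra, the equation itself puts $\Delta u=-iu_t-\beta e^{-2\gamma
t}|u|^2u$ in $H^s_p$, with a uniform bound (`exists_isSpectralSolution`). Hence $\Delta_h u-\Delta
u$, a pure aliasing error, is $O(N^{-s})$ in the discrete $L^2$ norm (`gridNorm_spatialError_le`).
Replacing the Laplacian at the outer time levels through the equation leaves a trapezoidal error of
$u_t$ and second differences of the nonlinear coefficient. Both are $O(\tau^2)$ in the Wiener norm
and require no time derivative of $\Delta u$.

No mesh ratio. An inverse inequality applied to the whole $L^2$ error would require $\tau^2N^{3/2}$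
to be small. Here the factor $N^{3/2}$ is paid only on the aliasing part of the residual, so the
Wiener error is $O(N^{3/2-s}+\tau^2)$. This is at most $1$ once $h$ and $\tau$ are separately small,
because $s>3/2$. The numerical solution is thus bounded in the Wiener algebra, and the same argument
in the discrete $L^2$ norm gives the full rate. The damped estimate is a multiplication by
$e^{-\gamma t_n}$. -/

lemma bijective_natCast_fin_zmod : Function.Bijective (fun l : Fin N => ((l : ℕ) : ZMod N)) := by
  rw [Fintype.bijective_iff_injective_and_card]
  refine ⟨fun a b hab => ?_, by simp [ZMod.card]⟩
  have h := (ZMod.natCast_eq_natCast_iff' _ _ _).1 hab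
  rw [Nat.mod_eq_of_lt a.2, Nat.mod_eq_of_lt b.2] at h
  exact Fin.ext h

/-- The discrete characters of the grid. -/
def gridChar (κ : Fin 3 → ZMod N) : GridFun N :=
  fun j => ∏ r, ZMod.stdAddChar (κ r * ((j r : ℕ) : ZMod N))

lemma gridChar_add (κ ν : Fin 3 → ZMod N) : gridChar (κ + ν) = gridChar κ * gridChar ν := by
  funext j
  simp only [gridChar, Pi.add_apply, Pi.mul_apply, add_mul, AddChar.map_add_eq_mul,
    Finset.prod_mul_distrib]

lemma gridChar_zero : gridChar (0 : Fin 3 → ZMod N) = 1 := by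
  funext j
  simp [gridChar]

lemma conj_stdAddChar (a : ZMod N) :
    (starRingEnd ℂ) (ZMod.stdAddChar a) = ZMod.stdAddChar (-a) := by
  rw [AddChar.map_neg_eq_conj]

lemma star_gridChar (κ : Fin 3 → ZMod N) : star (gridChar κ) = gridChar (-κ) := by
  funext j
  simp only [gridChar, Pi.star_apply, Pi.neg_apply, neg_mul]
  rw [← starRingEnd_apply, map_prod]
  simp only [conj_stdAddChar]

lemma norm_gridChar (κ : Fin 3 → ZMod N) (j : Fin 3 → Fin N) : ‖gridChar κ j‖ = 1 := by
  simp [gridChar, norm_prod]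

lemma sum_stdAddChar_mul (a : ZMod N) :
    ∑ l : Fin N, (ZMod.stdAddChar (a * ((l : ℕ) : ZMod N)) : ℂ) = if a = 0 then (N : ℂ) else 0 := by
  rw [bijective_natCast_fin_zmod.sum_comp (fun x : ZMod N => (ZMod.stdAddChar (a * x) : ℂ))]
  have h := AddChar.sum_mulShift (R' := ℂ) a (ZMod.isPrimitive_stdAddChar N)
  simp only [ZMod.card] at h
  simp_rw [mul_comm a]
  rw [h]
  split_ifs <;> simp

lemma sum_stdAddChar_mul_left (a : ZMod N) :
    ∑ x : ZMod N, (ZMod.stdAddChar (x * a) : ℂ) = if a = 0 then (N : ℂ) else 0 := by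
  have h := AddChar.sum_mulShift (R' := ℂ) a (ZMod.isPrimitive_stdAddChar N)
  simp only [ZMod.card] at h
  rw [h]
  split_ifs <;> simp

lemma sum_gridChar (κ : Fin 3 → ZMod N) :
    ∑ j, gridChar κ j = if κ = 0 then (N : ℂ) ^ 3 else 0 := by
  have h := Finset.prod_univ_sum (fun _ : Fin 3 => (Finset.univ : Finset (Fin N)))
    (fun r l => (ZMod.stdAddChar (κ r * ((l : ℕ) : ZMod N)) : ℂ))
  rw [Fintype.piFinset_univ] at h
  simp only [gridChar]
  rw [← h]
  simp only [sum_stdAddChar_mul]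
  split_ifs with h0
  · simp [h0]
  · obtain ⟨r, hr⟩ := Function.ne_iff.1 h0
    exact Finset.prod_eq_zero (Finset.mem_univ r) (if_neg (by simpa using hr))

lemma sum_gridChar_mul_conj (i j : Fin 3 → Fin N) :
    ∑ κ : Fin 3 → ZMod N, gridChar κ i * gridChar (-κ) j = if i = j then (N : ℂ) ^ 3 else 0 := by
  have h := Finset.prod_univ_sum (fun _ : Fin 3 => (Finset.univ : Finset (ZMod N)))
    (fun r x => (ZMod.stdAddChar (x * (((i r : ℕ) : ZMod N) - ((j r : ℕ) : ZMod N))) : ℂ))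
  rw [Fintype.piFinset_univ] at h
  have h' : ∀ κ : Fin 3 → ZMod N, gridChar κ i * gridChar (-κ) j =
      ∏ r, (ZMod.stdAddChar (κ r * (((i r : ℕ) : ZMod N) - ((j r : ℕ) : ZMod N))) : ℂ) := by
    intro κ
    simp only [gridChar, ← Finset.prod_mul_distrib, ← AddChar.map_add_eq_mul, Pi.neg_apply]
    refine Finset.prod_congr rfl fun r _ => ?_
    congr 1
    ring
  simp only [h']
  rw [← h]
  simp only [sum_stdAddChar_mul_left]
  split_ifs with h0
  · simp [h0]
  · obtain ⟨r, hr⟩ := Function.ne_iff.1 h0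
    refine Finset.prod_eq_zero (Finset.mem_univ r) ?_
    rw [if_neg]
    intro h1
    exact hr (bijective_natCast_fin_zmod.1 (sub_eq_zero.1 h1))

/-- Discrete Fourier coefficients of a grid function. -/
def dft (κ : Fin 3 → ZMod N) : GridFun N →ₗ[ℂ] ℂ where
  toFun U := ((N : ℂ) ^ 3)⁻¹ * ∑ j, gridChar (-κ) j * U j
  map_add' U V := by simp only [Pi.add_apply, mul_add, Finset.sum_add_distrib]
  map_smul' c U := by
    simp only [Pi.smul_apply, smul_eq_mul, RingHom.id_apply, Finset.mul_sum]
    exact Finset.sum_congr rfl fun j _ => by ring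

lemma dft_apply (κ : Fin 3 → ZMod N) (U : GridFun N) :
    dft κ U = ((N : ℂ) ^ 3)⁻¹ * ∑ j, gridChar (-κ) j * U j := rfl

lemma natCast_pow_ne_zero : (N : ℂ) ^ 3 ≠ 0 :=
  pow_ne_zero _ (Nat.cast_ne_zero.2 (NeZero.ne N))

lemma dft_gridChar (κ ν : Fin 3 → ZMod N) : dft κ (gridChar ν) = if ν = κ then 1 else 0 := by
  have h : ∀ j, gridChar (-κ) j * gridChar ν j = gridChar (ν - κ) j := fun j => by
    rw [sub_eq_neg_add, gridChar_add, Pi.mul_apply]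
  simp only [dft_apply, h, sum_gridChar, sub_eq_zero]
  split_ifs <;> simp

lemma dft_gridChar_mul (κ ν : Fin 3 → ZMod N) (U : GridFun N) :
    dft κ (gridChar ν * U) = dft (κ - ν) U := by
  simp only [dft_apply, Pi.mul_apply, ← mul_assoc]
  have h : ∀ j, gridChar (-κ) j * gridChar ν j = gridChar (-(κ - ν)) j := fun j => by
    rw [neg_sub, sub_eq_neg_add, gridChar_add, Pi.mul_apply]
  simp only [h]

lemma dft_star (κ : Fin 3 → ZMod N) (U : GridFun N) : dft κ (star U) = star (dft (-κ) U) := by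
  simp only [dft_apply, star_mul', star_inv₀, star_pow, star_natCast, star_sum, Pi.star_apply,
    ← star_gridChar]
  simp

/-- Fourier inversion on the grid. -/
lemma sum_dft_smul_gridChar (U : GridFun N) : ∑ κ, dft κ U • gridChar κ = U := by
  funext i
  simp only [Finset.sum_apply, Pi.smul_apply, smul_eq_mul, dft_apply]
  have h : ∀ κ : Fin 3 → ZMod N, ((N : ℂ) ^ 3)⁻¹ * (∑ j, gridChar (-κ) j * U j) * gridChar κ i
      = ∑ j, ((N : ℂ) ^ 3)⁻¹ * U j * (gridChar κ i * gridChar (-κ) j) := by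
    intro κ
    rw [Finset.mul_sum, Finset.sum_mul]
    exact Finset.sum_congr rfl fun j _ => by ring
  simp only [h]
  rw [Finset.sum_comm]
  simp only [← Finset.mul_sum, sum_gridChar_mul_conj]
  simp only [mul_ite, mul_zero, Finset.sum_ite_eq, Finset.mem_univ, if_true]
  rw [mul_right_comm, inv_mul_cancel₀ natCast_pow_ne_zero, one_mul]

/-- Parseval's identity on the grid. -/
lemma sum_norm_sq_eq (U : GridFun N) :
    ∑ j, ‖U j‖ ^ 2 = (N : ℝ) ^ 3 * ∑ κ, ‖dft κ U‖ ^ 2 := by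
  have h : ∑ j, U j * star (U j) = (N : ℂ) ^ 3 * ∑ κ, dft κ U * star (dft κ U) := by
    have h1 : ∀ κ : Fin 3 → ZMod N, star (dft κ U) =
        ((N : ℂ) ^ 3)⁻¹ * ∑ j, gridChar κ j * star (U j) := by
      intro κ
      have := dft_star (-κ) U
      rw [neg_neg] at this
      rw [← this, dft_apply, neg_neg]
      rfl
    have h2 : ∀ j, U j * star (U j) = ∑ κ, dft κ U * (gridChar κ j * star (U j)) := by
      intro j
      conv_lhs => rw [← sum_dft_smul_gridChar U]
      simp only [Finset.sum_apply, Pi.smul_apply, smul_eq_mul, Finset.sum_mul, mul_assoc]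
      refine Finset.sum_congr rfl fun κ _ => ?_
      congr 3
      have h3 := congrFun (sum_dft_smul_gridChar U) j
      simpa using h3
    simp only [h1, h2]
    rw [Finset.sum_comm, Finset.mul_sum]
    refine Finset.sum_congr rfl fun κ _ => ?_
    rw [← Finset.mul_sum]
    rw [mul_left_comm, mul_inv_cancel_left₀ natCast_pow_ne_zero]
  have h3 : ∀ z : ℂ, z * star z = ((‖z‖ ^ 2 : ℝ) : ℂ) := fun z => by
    rw [← starRingEnd_apply, Complex.mul_conj, Complex.normSq_eq_norm_sq]
  simp only [h3] at h
  exact_mod_cast h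

lemma gridNorm_eq (U : GridFun N) :
    gridNorm N U = Real.sqrt ((2 * Real.pi) ^ 3 * ∑ κ, ‖dft κ U‖ ^ 2) := by
  have hN : (N : ℝ) ≠ 0 := Nat.cast_ne_zero.2 (NeZero.ne N)
  rw [gridNorm, sum_norm_sq_eq, meshSize]
  congr 1
  field_simp

/-! ### The discrete Wiener algebra and the discrete `L²` norm -/

/-- The norm of the discrete Wiener algebra: the sum of the moduli of the Fourier coefficients. -/
def wienerNorm (U : GridFun N) : ℝ := ∑ κ, ‖dft κ U‖

/-- Norms on grid functions that are monotone in the moduli of the Fourier coefficients and are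
module norms over the discrete Wiener algebra. -/
structure IsWienerModuleNorm (p : GridFun N → ℝ) : Prop where
  nonneg : ∀ U, 0 ≤ p U
  dom : ∀ (U V W : GridFun N) (c : ℝ), 0 ≤ c →
    (∀ κ, ‖dft κ U‖ ≤ ‖dft κ V‖ + c * ‖dft κ W‖) → p U ≤ p V + c * p W
  mul : ∀ U V, p (U * V) ≤ wienerNorm U * p V
  star : ∀ U, p (star U) = p U

namespace IsWienerModuleNorm

variable {p : GridFun N → ℝ} (hp : IsWienerModuleNorm p)
include hp

lemma zero : p 0 = 0 := by
  refine le_antisymm ?_ (hp.nonneg 0)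
  have := hp.mul 0 0
  simpa [wienerNorm] using this

lemma add_le (U V : GridFun N) : p (U + V) ≤ p U + p V := by
  have := hp.dom (U + V) U V 1 zero_le_one fun κ => by
    rw [map_add, one_mul]; exact norm_add_le _ _
  simpa using this

lemma sub_le (U V : GridFun N) : p (U - V) ≤ p U + p V := by
  have := hp.dom (U - V) U V 1 zero_le_one fun κ => by
    rw [map_sub, one_mul]; exact norm_sub_le _ _
  simpa using this

lemma smul_le (c : ℂ) (U : GridFun N) : p (c • U) ≤ ‖c‖ * p U := by
  have := hp.dom (c • U) 0 U ‖c‖ (norm_nonneg _) fun κ => by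
    simp
  simpa [hp.zero] using this

end IsWienerModuleNorm

lemma wienerNorm_nonneg (U : GridFun N) : 0 ≤ wienerNorm U :=
  Finset.sum_nonneg fun _ _ => norm_nonneg _

/-- A convex function of grid functions which is invariant under multiplication by characters
is a module norm. -/
lemma le_wienerNorm_mul {p : GridFun N → ℝ} (h0 : p 0 = 0)
    (hadd : ∀ (U V : GridFun N) (c : ℂ), p (U + c • V) ≤ p U + ‖c‖ * p V)
    (hchar : ∀ κ V, p (gridChar κ * V) = p V) (U V : GridFun N) :
    p (U * V) ≤ wienerNorm U * p V := by
  have h : ∀ s : Finset (Fin 3 → ZMod N),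
      p (∑ κ ∈ s, dft κ U • (gridChar κ * V)) ≤ (∑ κ ∈ s, ‖dft κ U‖) * p V := by
    intro s
    induction s using Finset.induction_on with
    | empty => simp [h0]
    | insert a s ha ih =>
      rw [Finset.sum_insert ha, Finset.sum_insert ha, add_comm, add_comm ‖_‖, add_mul]
      refine (hadd _ _ _).trans ?_
      rw [hchar]
      gcongr
  have h1 : U * V = ∑ κ, dft κ U • (gridChar κ * V) := by
    conv_lhs => rw [← sum_dft_smul_gridChar U, Finset.sum_mul]
    simp only [smul_mul_assoc]
  rw [h1]
  exact h Finset.univ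

lemma isWienerModuleNorm_wienerNorm : IsWienerModuleNorm (wienerNorm (N := N)) where
  nonneg := wienerNorm_nonneg
  dom U V W c _ h := by
    simp only [wienerNorm, Finset.mul_sum]
    rw [← Finset.sum_add_distrib]
    exact Finset.sum_le_sum fun κ _ => h κ
  mul := le_wienerNorm_mul (by simp [wienerNorm])
    (fun U V c => by
      simp only [wienerNorm, Finset.mul_sum, map_add, map_smul, smul_eq_mul]
      rw [← Finset.sum_add_distrib]
      refine Finset.sum_le_sum fun κ _ => ?_
      rw [← norm_mul]
      exact norm_add_le _ _)
    (fun κ V => by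
      simp only [wienerNorm, dft_gridChar_mul]
      exact Fintype.sum_equiv (Equiv.subRight κ) _ _ fun ν => rfl)
  star U := by
    simp only [wienerNorm, dft_star, norm_star]
    exact Fintype.sum_equiv (Equiv.neg (Fin 3 → ZMod N)) _ _ fun ν => rfl

lemma gridNorm_eq_norm (U : GridFun N) :
    gridNorm N U = Real.sqrt ((2 * Real.pi) ^ 3) *
      ‖WithLp.toLp 2 (fun κ : Fin 3 → ZMod N => ‖dft κ U‖)‖ := by
  rw [gridNorm_eq, Real.sqrt_mul (by positivity), EuclideanSpace.norm_eq]
  simp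

/-- By Parseval the grid norm is a multiple of the $\ell^2$ norm of the vector of moduli, so this is
the triangle inequality for those vectors. -/
lemma gridNorm_dom (U V W : GridFun N) (c : ℝ) (hc : 0 ≤ c)
    (h : ∀ κ, ‖dft κ U‖ ≤ ‖dft κ V‖ + c * ‖dft κ W‖) :
    gridNorm N U ≤ gridNorm N V + c * gridNorm N W := by
  simp only [gridNorm_eq_norm]
  rw [mul_left_comm, ← mul_add]
  gcongr
  set v := WithLp.toLp 2 (fun κ : Fin 3 → ZMod N => ‖dft κ V‖)
  set w := WithLp.toLp 2 (fun κ : Fin 3 → ZMod N => ‖dft κ W‖)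
  have h1 : ‖v + c • w‖ ≤ ‖v‖ + c * ‖w‖ := by
    refine (norm_add_le _ _).trans ?_
    rw [norm_smul, Real.norm_of_nonneg hc]
  refine le_trans ?_ h1
  rw [EuclideanSpace.norm_eq, EuclideanSpace.norm_eq]
  refine Real.sqrt_le_sqrt (Finset.sum_le_sum fun κ _ => ?_)
  simp only [v, w, Real.norm_eq_abs, sq_abs, PiLp.add_apply, PiLp.smul_apply, smul_eq_mul]
  gcongr
  exact h κ

lemma isWienerModuleNorm_gridNorm : IsWienerModuleNorm (gridNorm N) where
  nonneg U := Real.sqrt_nonneg _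
  dom := gridNorm_dom
  mul := le_wienerNorm_mul (by simp [gridNorm])
    (fun U V c => gridNorm_dom _ _ _ _ (norm_nonneg _) fun κ => by
      rw [map_add, map_smul, smul_eq_mul, ← norm_mul]
      exact norm_add_le _ _)
    (fun κ V => by simp [gridNorm, norm_gridChar])
  star U := by simp [gridNorm]

/-- The module inequality against the constant function $1$, whose grid norm is $(2\pi)^{3/2}$. -/
lemma gridNorm_le_wienerNorm (U : GridFun N) :
    gridNorm N U ≤ Real.sqrt ((2 * Real.pi) ^ 3) * wienerNorm U := by
  have h := isWienerModuleNorm_gridNorm.mul U 1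
  rw [mul_one] at h
  refine h.trans_eq ?_
  rw [mul_comm]
  congr 1
  rw [← gridChar_zero, gridNorm_eq]
  have : ∀ ν : Fin 3 → ZMod N, ‖(if 0 = ν then 1 else 0 : ℂ)‖ ^ 2 = if 0 = ν then 1 else 0 :=
    fun ν => by split_ifs <;> simp
  simp [dft_gridChar, this]

/-- Cauchy-Schwarz over the $N^3$ frequencies. This inverse inequality is the only loss in $N$, and
it is applied to spatial residuals only. -/
lemma wienerNorm_le_gridNorm (U : GridFun N) : wienerNorm U ≤ (N : ℝ) ^ (3 / 2 : ℝ) * gridNorm N U := by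
  have h1 : wienerNorm U ≤ Real.sqrt ((N : ℝ) ^ 3) * Real.sqrt (∑ κ, ‖dft κ U‖ ^ 2) := by
    have h2 := Real.sum_mul_le_sqrt_mul_sqrt (Finset.univ : Finset (Fin 3 → ZMod N)) (fun _ => (1 : ℝ))
      (fun κ => ‖dft κ U‖)
    simpa [ZMod.card, wienerNorm] using h2
  have h3 : Real.sqrt ((N : ℝ) ^ 3) = (N : ℝ) ^ (3 / 2 : ℝ) := by
    rw [Real.sqrt_eq_rpow, ← Real.rpow_natCast, ← Real.rpow_mul (by positivity)]
    norm_num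
  rw [h3] at h1
  refine h1.trans ?_
  gcongr
  rw [gridNorm_eq]
  apply Real.sqrt_le_sqrt
  refine le_mul_of_one_le_left (by positivity) ?_
  exact one_le_pow₀ (by linarith [Real.pi_gt_three])

lemma wienerNorm_gridChar (κ : Fin 3 → ZMod N) : wienerNorm (gridChar κ) = 1 := by
  have : ∀ ν, ‖dft ν (gridChar κ)‖ = if κ = ν then 1 else 0 := fun ν => by
    rw [dft_gridChar]; split_ifs <;> simp
  simp [wienerNorm, this]

/-- The character with integer frequency `k`, restricted to the grid. -/
lemma gridChar_intCast (k : Fin 3 → ℤ) (j : Fin 3 → Fin N) :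
    gridChar (fun r => ((k r : ℤ) : ZMod N)) j =
      Complex.exp (Complex.I * ∑ r, (k r : ℂ) * ((gridPoint N j r : ℝ) : ℂ)) := by
  rw [Finset.mul_sum, Complex.exp_sum]
  refine Finset.prod_congr rfl fun r _ => ?_
  have h : ((k r : ℤ) : ZMod N) * ((j r : ℕ) : ZMod N) = ((k r * (j r : ℕ) : ℤ) : ZMod N) := by
    push_cast; rfl
  rw [h, ZMod.stdAddChar_coe]
  congr 1
  simp only [gridPoint, node, meshSize]
  push_cast
  ring

end Grid

/-! ### The spectral symbol of the pseudo-spectral Laplacian -/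

lemma hasDerivAt_trig_sum (S : Finset ℤ) (a : ℤ → ℂ) (y x : ℝ) :
    HasDerivAt (fun x : ℝ => ∑ p ∈ S, a p * Complex.exp (Complex.I * (p : ℂ) * ((x - y : ℝ) : ℂ)))
      (∑ p ∈ S, a p * (Complex.I * p) *
        Complex.exp (Complex.I * (p : ℂ) * ((x - y : ℝ) : ℂ))) x := by
  refine HasDerivAt.fun_sum fun p _ => ?_
  have h1 : HasDerivAt (fun x : ℝ => ((x - y : ℝ) : ℂ)) 1 x := by
    have := ((hasDerivAt_id x).sub_const y).ofReal_comp
    simpa using this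
  have h2 := ((h1.const_mul (Complex.I * (p : ℂ))).cexp).const_mul (a p)
  exact h2.congr_deriv (by ring)

lemma discreteLaplacian_add {N : ℕ} (U V : GridFun N) :
    discreteLaplacian N (U + V) = discreteLaplacian N U + discreteLaplacian N V := by
  funext j
  simp only [discreteLaplacian, Pi.add_apply, mul_add, Finset.sum_add_distrib]

lemma discreteLaplacian_smul {N : ℕ} (c : ℂ) (U : GridFun N) :
    discreteLaplacian N (c • U) = c • discreteLaplacian N U := by
  funext j
  simp only [discreteLaplacian, Pi.smul_apply, smul_eq_mul, Finset.mul_sum]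
  exact Finset.sum_congr rfl fun r _ => Finset.sum_congr rfl fun l _ => by ring

section Grid

variable {N : ℕ} [NeZero N]

/-- The weights of the trigonometric interpolation basis. -/
def interpWeight (N : ℕ) (p : ℤ) : ℂ := 1 / (if |p| = ((N / 2 : ℕ) : ℤ) then (2 : ℂ) else 1)

lemma exp_node_sub (p : ℤ) (m l : Fin N) :
    Complex.exp (Complex.I * (p : ℂ) * ((node N m - node N l : ℝ) : ℂ)) =
      ZMod.stdAddChar (((p : ℤ) : ZMod N) * (((m : ℕ) : ZMod N) - ((l : ℕ) : ZMod N))) := by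
  have h : ((p : ℤ) : ZMod N) * (((m : ℕ) : ZMod N) - ((l : ℕ) : ZMod N)) =
      ((p * ((m : ℕ) - (l : ℕ)) : ℤ) : ZMod N) := by
    push_cast; rfl
  rw [h, ZMod.stdAddChar_coe]
  congr 1
  simp only [node, meshSize]
  push_cast
  ring

lemma diffMatrix_apply (m l : Fin N) :
    diffMatrix N m l = (1 / (N : ℂ)) *
      ∑ p ∈ Finset.Icc (-((N / 2 : ℕ) : ℤ)) ((N / 2 : ℕ) : ℤ), -(interpWeight N p * (p : ℂ) ^ 2) *
        ZMod.stdAddChar (((p : ℤ) : ZMod N) * (((m : ℕ) : ZMod N) - ((l : ℕ) : ZMod N))) := by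
  have h1 : deriv (interpBasis N l) = fun x : ℝ => (1 / (N : ℂ)) *
      ∑ p ∈ Finset.Icc (-((N / 2 : ℕ) : ℤ)) ((N / 2 : ℕ) : ℤ), interpWeight N p * (Complex.I * p) *
        Complex.exp (Complex.I * (p : ℂ) * ((x - node N l : ℝ) : ℂ)) := by
    funext x
    exact ((hasDerivAt_trig_sum _ (interpWeight N) (node N l) x).const_mul (1 / (N : ℂ))).deriv
  rw [diffMatrix, iteratedDeriv_succ, iteratedDeriv_one, h1,
    ((hasDerivAt_trig_sum _ (fun p => interpWeight N p * (Complex.I * p)) (node N l)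
      (node N m)).const_mul (1 / (N : ℂ))).deriv]
  congr 1
  refine Finset.sum_congr rfl fun p _ => ?_
  rw [exp_node_sub]
  congr 1
  linear_combination interpWeight N p * (p : ℂ) ^ 2 * Complex.I_mul_I

/-- The frequencies $\pm N/2$ coincide modulo $N$. Their two half weights add up to the weight of
the single representative $N/2$ chosen by `valMinAbs`; every other class has exactly one
representative in the range. -/
lemma sum_interpWeight (hN : Even N) (q : ZMod N) :
    ∑ p ∈ Finset.Icc (-((N / 2 : ℕ) : ℤ)) ((N / 2 : ℕ) : ℤ),
      (if ((p : ℤ) : ZMod N) = q then interpWeight N p * (p : ℂ) ^ 2 else 0)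
      = (q.valMinAbs : ℂ) ^ 2 := by
  obtain ⟨n, rfl⟩ := hN
  have hn : 0 < n := by
    rcases Nat.eq_zero_or_pos n with h | h
    · exact absurd (by simp [h]) (NeZero.ne (n + n))
    · exact h
  have hn2 : (n + n) / 2 = n := by omega
  rw [hn2]
  have hv := ZMod.valMinAbs_mem_Ioc q
  have hvq := ZMod.coe_valMinAbs q
  set v := q.valMinAbs with hvdef
  simp only [Set.mem_Ioc] at hv
  push_cast at hv
  have key : ∀ p ∈ Finset.Icc (-(n : ℤ)) n, ((p : ℤ) : ZMod (n + n)) = q →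
      p = v ∨ (p = -n ∧ v = n) := by
    intro p hp hpq
    rw [← hvq, ZMod.intCast_eq_intCast_iff_dvd_sub] at hpq
    obtain ⟨c, hc⟩ := hpq
    rw [Finset.mem_Icc] at hp
    push_cast at hc
    -- The interval for `v` is open on the left and the one for `p` is closed. So `v - p = 2nc`
    -- allows `c = 1`, the double endpoint, but not `c = -1`.
    have hc1 : -1 < c := by
      by_contra h
      have : c ≤ -1 := by omega
      nlinarith
    have hc2 : c < 2 := by
      by_contra h
      have : 2 ≤ c := by omega
      nlinarith
    interval_cases c
    · left; omega
    · right; omega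
  by_cases hvn : v = n
  · have hcast : ((-(n : ℤ) : ℤ) : ZMod (n + n)) = q := by
      rw [← hvq, hvn, ZMod.intCast_eq_intCast_iff_dvd_sub]
      exact ⟨1, by push_cast; ring⟩
    have hcast' : ((n : ℤ) : ZMod (n + n)) = q := by rw [← hvq, hvn]
    rw [← Finset.sum_subset (s₁ := {-(n : ℤ), (n : ℤ)})]
    · rw [Finset.sum_pair (by omega), if_pos hcast, if_pos hcast', hvn]
      simp only [interpWeight, hn2, abs_neg, Nat.abs_cast, if_true]
      push_cast
      ring
    · intro x hx
      simp only [Finset.mem_insert, Finset.mem_singleton] at hx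
      rw [Finset.mem_Icc]
      omega
    · intro x hx hx'
      rw [if_neg]
      intro h
      simp only [Finset.mem_insert, Finset.mem_singleton] at hx'
      rcases key x hx h with h | h <;> omega
  · rw [Finset.sum_eq_single v]
    · rw [if_pos hvq, interpWeight, hn2, if_neg, div_one, one_mul]
      intro h
      rcases abs_eq (by omega : (0 : ℤ) ≤ n) |>.1 h with h | h <;> omega
    · intro p hp hpv
      rw [if_neg]
      intro h
      rcases key p hp h with h | h <;> omega
    · intro h
      rw [Finset.mem_Icc] at h
      omega

lemma sum_diffMatrix_mul (hN : Even N) (q : ZMod N) (m : Fin N) :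
    ∑ l : Fin N, diffMatrix N m l * ZMod.stdAddChar (q * ((l : ℕ) : ZMod N)) =
      -(q.valMinAbs : ℂ) ^ 2 * ZMod.stdAddChar (q * ((m : ℕ) : ZMod N)) := by
  have hN0 : (N : ℂ) ≠ 0 := Nat.cast_ne_zero.2 (NeZero.ne N)
  have h : ∀ l : Fin N, diffMatrix N m l * ZMod.stdAddChar (q * ((l : ℕ) : ZMod N)) =
      ∑ p ∈ Finset.Icc (-((N / 2 : ℕ) : ℤ)) ((N / 2 : ℕ) : ℤ),
        -(1 / (N : ℂ)) * (interpWeight N p * (p : ℂ) ^ 2) *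
          ZMod.stdAddChar (((p : ℤ) : ZMod N) * ((m : ℕ) : ZMod N)) *
          ZMod.stdAddChar ((q - ((p : ℤ) : ZMod N)) * ((l : ℕ) : ZMod N)) := by
    intro l
    rw [diffMatrix_apply, Finset.mul_sum, Finset.sum_mul]
    refine Finset.sum_congr rfl fun p _ => ?_
    have h1 : (ZMod.stdAddChar (((p : ℤ) : ZMod N) * (((m : ℕ) : ZMod N) - ((l : ℕ) : ZMod N))) : ℂ)
        * ZMod.stdAddChar (q * ((l : ℕ) : ZMod N)) =
        ZMod.stdAddChar (((p : ℤ) : ZMod N) * ((m : ℕ) : ZMod N)) *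
          ZMod.stdAddChar ((q - ((p : ℤ) : ZMod N)) * ((l : ℕ) : ZMod N)) := by
      rw [← AddChar.map_add_eq_mul, ← AddChar.map_add_eq_mul]
      congr 1
      ring
    linear_combination (-(1 / (N : ℂ)) * (interpWeight N p * (p : ℂ) ^ 2)) * h1
  simp only [h]
  rw [Finset.sum_comm]
  simp only [← Finset.mul_sum, sum_stdAddChar_mul, sub_eq_zero]
  rw [← sum_interpWeight hN q, ← Finset.sum_neg_distrib, Finset.sum_mul]
  refine Finset.sum_congr rfl fun p _ => ?_
  by_cases hq : q = p
  · rw [if_pos hq, if_pos hq.symm, hq]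
    field_simp
  · rw [if_neg hq, if_neg (Ne.symm hq)]
    simp

/-- The symbol of `-Δ_h`. -/
def gridSymbol (κ : Fin 3 → ZMod N) : ℝ := ∑ r, ((κ r).valMinAbs : ℝ) ^ 2

lemma discreteLaplacian_gridChar (hN : Even N) (κ : Fin 3 → ZMod N) :
    discreteLaplacian N (gridChar κ) = -(gridSymbol κ : ℂ) • gridChar κ := by
  funext j
  simp only [discreteLaplacian, Pi.smul_apply, smul_eq_mul, gridSymbol]
  push_cast
  rw [← Finset.sum_neg_distrib, Finset.sum_mul]
  refine Finset.sum_congr rfl fun r _ => ?_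
  have h1 : ∀ l : Fin N, gridChar κ (Function.update j r l) =
      ZMod.stdAddChar (κ r * ((l : ℕ) : ZMod N)) *
        ∏ i ∈ Finset.univ.erase r, ZMod.stdAddChar (κ i * ((j i : ℕ) : ZMod N)) := by
    intro l
    rw [gridChar, ← Finset.mul_prod_erase Finset.univ _ (Finset.mem_univ r), Function.update_self]
    congr 1
    refine Finset.prod_congr rfl fun i hi => ?_
    rw [Function.update_of_ne (Finset.ne_of_mem_erase hi)]
  have h2 := h1 (j r)
  rw [Function.update_eq_self] at h2
  rw [h2]
  simp only [h1, ← mul_assoc]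
  rw [← Finset.sum_mul, sum_diffMatrix_mul hN]

/-- The pseudo-spectral Laplacian as a linear map. -/
def discreteLaplacianₗ (N : ℕ) [NeZero N] : GridFun N →ₗ[ℂ] GridFun N where
  toFun := discreteLaplacian N
  map_add' := discreteLaplacian_add
  map_smul' := discreteLaplacian_smul

lemma dft_discreteLaplacian (hN : Even N) (κ : Fin 3 → ZMod N) (U : GridFun N) :
    dft κ (discreteLaplacian N U) = -(gridSymbol κ : ℂ) * dft κ U := by
  have h : discreteLaplacian N U = ∑ ν, dft ν U • (-(gridSymbol ν : ℂ) • gridChar ν) := by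
    conv_lhs => rw [← sum_dft_smul_gridChar U]
    change discreteLaplacianₗ N _ = _
    rw [map_sum]
    refine Finset.sum_congr rfl fun ν _ => ?_
    rw [map_smul, ← discreteLaplacian_gridChar hN]
    rfl
  rw [h, map_sum]
  simp only [map_smul, dft_gridChar, smul_eq_mul]
  simp [mul_comm]

/-- Stability of the Crank-Nicolson step, in every norm that is monotone in the moduli of the
Fourier coefficients. -/
lemma IsWienerModuleNorm.le_of_crankNicolson {p : GridFun N → ℝ} (hp : IsWienerModuleNorm p)
    (hN : Even N) {σ : ℝ} (hσ : 0 < σ) (e₁ e₀ F : GridFun N)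
    (h : ∀ j, Complex.I * ((e₁ j - e₀ j) / (σ : ℂ))
      + discreteLaplacian N (fun i => (e₁ i + e₀ i) / 2) j + F j = 0) :
    p e₁ ≤ p e₀ + σ * p F := by
  refine hp.dom _ _ _ _ hσ.le fun κ => ?_
  have hσ' : (σ : ℂ) ≠ 0 := by exact_mod_cast hσ.ne'
  have h1 : (Complex.I * (σ : ℂ)⁻¹) • (e₁ - e₀)
      + discreteLaplacian N ((1 / 2 : ℂ) • (e₁ + e₀)) + F = 0 := by
    funext j
    have h2 : (fun i => (e₁ i + e₀ i) / 2) = (1 / 2 : ℂ) • (e₁ + e₀) := by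
      funext i
      simp only [Pi.smul_apply, Pi.add_apply, smul_eq_mul]
      ring
    have h3 := h j
    rw [h2] at h3
    simp only [Pi.add_apply, Pi.smul_apply, Pi.sub_apply, smul_eq_mul, Pi.zero_apply]
    rw [← h3]
    ring
  have h4 := congrArg (dft κ) h1
  simp only [map_add, map_smul, map_sub, map_zero, dft_discreteLaplacian hN, smul_eq_mul] at h4
  set a := dft κ e₁
  set b := dft κ e₀
  set f := dft κ F
  set x : ℝ := σ * gridSymbol κ / 2 with hx
  -- The scheme on one Fourier mode. The factors $i-x$ and $i+x$ have the same modulus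
  -- $\sqrt{1+x^2}\ge1$ because $x$ is real, so the homogeneous step is an isometry and the source
  -- is not amplified.
  have h5 : (Complex.I - (x : ℂ)) * a = (Complex.I + (x : ℂ)) * b - σ * f := by
    rw [hx]
    push_cast
    field_simp at h4 ⊢
    linear_combination h4
  have hnorm : ∀ y : ℝ, ‖Complex.I + (y : ℂ)‖ = Real.sqrt (1 + y ^ 2) := by
    intro y
    rw [Complex.norm_def, Complex.normSq_apply]
    congr 1
    simp
    ring
  have h6 : ‖Complex.I - (x : ℂ)‖ = Real.sqrt (1 + x ^ 2) := by
    have := hnorm (-x)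
    rw [neg_sq] at this
    rw [← this]
    push_cast
    rw [sub_eq_add_neg]
  have h7 : Real.sqrt (1 + x ^ 2) * ‖a‖ ≤ Real.sqrt (1 + x ^ 2) * ‖b‖ + σ * ‖f‖ := by
    rw [← h6, ← norm_mul, h5, h6, ← hnorm x, ← norm_mul]
    refine (norm_sub_le _ _).trans_eq ?_
    rw [norm_mul (σ : ℂ), Complex.norm_real, Real.norm_of_nonneg hσ.le]
  have h8 : 1 ≤ Real.sqrt (1 + x ^ 2) := by
    rw [Real.one_le_sqrt]
    nlinarith [sq_nonneg x]
  have h9 : σ * ‖f‖ ≤ Real.sqrt (1 + x ^ 2) * (σ * ‖f‖) :=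
    le_mul_of_one_le_left (by positivity) h8
  have h10 : Real.sqrt (1 + x ^ 2) * ‖a‖ ≤ Real.sqrt (1 + x ^ 2) * (‖b‖ + σ * ‖f‖) := by
    linarith
  exact le_of_mul_le_mul_left h10 (by linarith)

end Grid

/-! ### Fourier series on the torus -/

/-- The exponential `e^{i k·x}`. -/
def fourierMode (k : Fin 3 → ℤ) (x : EuclideanSpace ℝ (Fin 3)) : ℂ :=
  Complex.exp (Complex.I * ∑ r, (k r : ℂ) * ((x r : ℝ) : ℂ))

lemma norm_fourierMode (k : Fin 3 → ℤ) (x : EuclideanSpace ℝ (Fin 3)) : ‖fourierMode k x‖ = 1 := by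
  have : Complex.I * ∑ r, (k r : ℂ) * ((x r : ℝ) : ℂ)
      = ((∑ r, (k r : ℝ) * x r : ℝ) : ℂ) * Complex.I := by
    push_cast; ring
  rw [fourierMode, this, Complex.norm_exp_ofReal_mul_I]

lemma fourierMode_add (k l : Fin 3 → ℤ) (x : EuclideanSpace ℝ (Fin 3)) :
    fourierMode (k + l) x = fourierMode k x * fourierMode l x := by
  rw [fourierMode, fourierMode, fourierMode, ← Complex.exp_add]
  congr 1
  simp only [Pi.add_apply, Int.cast_add, add_mul, Finset.sum_add_distrib, mul_add]

lemma star_fourierMode (k : Fin 3 → ℤ) (x : EuclideanSpace ℝ (Fin 3)) :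
    star (fourierMode k x) = fourierMode (-k) x := by
  rw [fourierMode, fourierMode, ← starRingEnd_apply, ← Complex.exp_conj]
  congr 1
  simp [map_sum]

@[fun_prop]
lemma continuous_fourierMode (k : Fin 3 → ℤ) : Continuous (fourierMode k) := by
  unfold fourierMode
  fun_prop

lemma IsPeriodic.add_int {f : EuclideanSpace ℝ (Fin 3) → ℂ} (hf : IsPeriodic f)
    (x : EuclideanSpace ℝ (Fin 3)) (m : Fin 3 → ℤ) :
    f (x + WithLp.toLp 2 (fun r => 2 * Real.pi * (m r : ℝ))) = f x := by
  have h : ∀ r : Fin 3, Function.Periodic f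
      (m r • EuclideanSpace.single r (2 * Real.pi) : EuclideanSpace ℝ (Fin 3)) := fun r =>
    Function.Periodic.zsmul (fun x => hf x r) (m r)
  have h3 := ((h 0).add_period (h 1)).add_period (h 2)
  have h4 : (WithLp.toLp 2 (fun r => 2 * Real.pi * (m r : ℝ)) : EuclideanSpace ℝ (Fin 3)) =
      m 0 • EuclideanSpace.single 0 (2 * Real.pi) + m 1 • EuclideanSpace.single 1 (2 * Real.pi)
        + m 2 • EuclideanSpace.single 2 (2 * Real.pi) := by
    ext r
    fin_cases r <;> simp [mul_comm]
  rw [h4]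
  exact h3 x

/-- The continuous function on `(ℝ/ℤ)³` given by a continuous periodic function. -/
lemma exists_torus_function {f : EuclideanSpace ℝ (Fin 3) → ℂ} (hc : Continuous f)
    (hp : IsPeriodic f) : ∃ F : C(UnitAddTorus (Fin 3), ℂ), ∀ y : Fin 3 → ℝ,
      F (fun r => (y r : UnitAddCircle)) = f (WithLp.toLp 2 (fun r => 2 * Real.pi * y r)) := by
  -- Openness matters: a product of open quotient maps is again a quotient map, so periodic
  -- functions descend to the torus.
  have hq : IsOpenQuotientMap
      (Pi.map fun (_ : Fin 3) (y : ℝ) => (y : UnitAddCircle)) :=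
    IsOpenQuotientMap.piMap fun _ => QuotientAddGroup.isOpenQuotientMap_mk
  let π : C(Fin 3 → ℝ, UnitAddTorus (Fin 3)) :=
    ⟨Pi.map fun (_ : Fin 3) (y : ℝ) => (y : UnitAddCircle), hq.continuous⟩
  let g : C(Fin 3 → ℝ, ℂ) := ⟨fun y => f (WithLp.toLp 2 (fun r => 2 * Real.pi * y r)), by fun_prop⟩
  have hπ : Topology.IsQuotientMap π := hq.isQuotientMap
  have hg : ∀ a b, π a = π b → g a = g b := by
    intro a b hab
    have h1 : ∀ r, ∃ n : ℤ, a r = b r + n := by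
      intro r
      have h2 : ((a r : ℝ) : UnitAddCircle) = (b r : ℝ) := congrFun hab r
      rw [QuotientAddGroup.eq_iff_sub_mem, AddSubgroup.mem_zmultiples_iff] at h2
      obtain ⟨n, hn⟩ := h2
      refine ⟨n, ?_⟩
      rw [zsmul_eq_mul, mul_one] at hn
      linarith
    choose m hm using h1
    have h3 := hp.add_int (WithLp.toLp 2 (fun r => 2 * Real.pi * b r)) m
    simp only [g, ContinuousMap.coe_mk]
    rw [← h3, ← WithLp.toLp_add]
    congr 2
    funext r
    simp only [Pi.add_apply, hm r]
    ring
  refine ⟨hπ.lift g (fun a b h => hg a b h), fun y => ?_⟩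
  exact congrArg (fun G : C(Fin 3 → ℝ, ℂ) => G y) (hπ.lift_comp g (fun a b h => hg a b h))

lemma mFourier_coe (k : Fin 3 → ℤ) (y : Fin 3 → ℝ) :
    UnitAddTorus.mFourier k (fun r => (y r : UnitAddCircle)) =
      fourierMode k (WithLp.toLp 2 (fun r => 2 * Real.pi * y r)) := by
  simp only [UnitAddTorus.mFourier, ContinuousMap.coe_mk, fourier_coe_apply, fourierMode]
  rw [Finset.mul_sum, Complex.exp_sum]
  refine Finset.prod_congr rfl fun r _ => ?_
  congr 1
  push_cast
  ring

-- Rescaling by $2\pi$ turns the integral over $[0,2\pi]^3$ into one over the unit cube. The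
-- half-open cube of the torus differs from the closed one by a null set.
open scoped Pointwise in
lemma torusCoeff_eq_mFourierCoeff {f : EuclideanSpace ℝ (Fin 3) → ℂ}
    (F : UnitAddTorus (Fin 3) → ℂ)
    (hF : ∀ y : Fin 3 → ℝ,
      F (fun r => (y r : UnitAddCircle)) = f (WithLp.toLp 2 (fun r => 2 * Real.pi * y r)))
    (k : Fin 3 → ℤ) : torusCoeff f k = UnitAddTorus.mFourierCoeff F k := by
  rw [UnitAddTorus.mFourierCoeff_eq_integral F k 0]
  simp only [hF, mFourier_coe, Pi.zero_apply, zero_add]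
  have hset : ({x : Fin 3 → ℝ | ∀ i, x i ∈ Set.Ioc (0 : ℝ) 1}) =
      Set.univ.pi fun _ : Fin 3 => Set.Ioc (0 : ℝ) 1 := by
    ext x; simp
  have hae : (Set.univ.pi fun _ : Fin 3 => Set.Ioc (0 : ℝ) 1) =ᵐ[MeasureTheory.volume]
      Set.Icc (0 : Fin 3 → ℝ) 1 :=
    MeasureTheory.Measure.univ_pi_Ioc_ae_eq_Icc (f := fun _ : Fin 3 => (0 : ℝ)) (g := fun _ => 1)
  rw [hset, MeasureTheory.setIntegral_congr_set hae]
  have h2 := MeasureTheory.Measure.setIntegral_comp_smul_of_pos (MeasureTheory.volume)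
    (fun x : Fin 3 → ℝ => fourierMode (-k) (WithLp.toLp 2 x) • f (WithLp.toLp 2 x))
    (Set.Icc (0 : Fin 3 → ℝ) 1) (R := 2 * Real.pi) (by positivity)
  have h3 : (2 * Real.pi) • Set.Icc (0 : Fin 3 → ℝ) 1 = Set.Icc 0 (fun _ => 2 * Real.pi) := by
    ext x
    rw [Set.mem_smul_set_iff_inv_smul_mem₀ (by positivity)]
    simp only [Set.mem_Icc, Pi.le_def, Pi.smul_apply, Pi.zero_apply, Pi.one_apply, smul_eq_mul]
    have hpi : 0 < 2 * Real.pi := by positivity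
    refine and_congr (forall_congr' fun i => ?_) (forall_congr' fun i => ?_)
    · rw [mul_nonneg_iff_of_pos_left (inv_pos.2 hpi)]
    · rw [inv_mul_le_iff₀ hpi, mul_one]
  rw [h3] at h2
  have h4 : ∀ x : Fin 3 → ℝ, (2 * Real.pi) • x = fun r => 2 * Real.pi * x r := fun x => rfl
  simp only [h4] at h2
  rw [h2, torusCoeff, Module.finrank_fin_fun, ← one_div, Complex.real_smul]
  congr 1
  refine MeasureTheory.integral_congr_ae (Filter.Eventually.of_forall fun x => ?_)
  simp only [smul_eq_mul]
  rw [mul_comm]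
  congr 1
  rw [fourierMode]
  congr 1
  simp [Finset.sum_neg_distrib]

/-- Fourier inversion for continuous periodic functions with summable Fourier coefficients. -/
lemma hasSum_torusCoeff {f : EuclideanSpace ℝ (Fin 3) → ℂ} (hc : Continuous f)
    (hp : IsPeriodic f) (hs : Summable (torusCoeff f)) (x : EuclideanSpace ℝ (Fin 3)) :
    HasSum (fun k => torusCoeff f k * fourierMode k x) (f x) := by
  obtain ⟨F, hF⟩ := exists_torus_function hc hp
  have h1 : UnitAddTorus.mFourierCoeff F = torusCoeff f :=
    funext fun k => (torusCoeff_eq_mFourierCoeff F hF k).symm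
  have h2 := UnitAddTorus.hasSum_mFourier_series_apply_of_summable (f := F) (by rwa [h1])
    (fun r => ((x r / (2 * Real.pi) : ℝ) : UnitAddCircle))
  rw [hF, h1] at h2
  have h3 : (fun r => 2 * Real.pi * (x r / (2 * Real.pi))) = WithLp.ofLp x := by
    funext r
    field_simp
  simpa only [mFourier_coe, h3, WithLp.toLp_ofLp, smul_eq_mul] using h2

lemma integral_exp_int (m : ℤ) :
    ∫ x in Set.Icc (0 : ℝ) (2 * Real.pi), Complex.exp (Complex.I * (m : ℂ) * (x : ℂ)) =
      if m = 0 then (2 * Real.pi : ℂ) else 0 := by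
  rw [MeasureTheory.integral_Icc_eq_integral_Ioc, ← intervalIntegral.integral_of_le (by positivity)]
  split_ifs with h
  · simp [h]
  · have hm : Complex.I * (m : ℂ) ≠ 0 := mul_ne_zero Complex.I_ne_zero (by exact_mod_cast h)
    rw [integral_exp_mul_complex hm]
    have : Complex.exp (Complex.I * (m : ℂ) * ((2 * Real.pi : ℝ) : ℂ)) = 1 := by
      rw [Complex.exp_eq_one_iff]
      exact ⟨m, by push_cast; ring⟩
    rw [this]
    simp

lemma integral_fourierMode (k : Fin 3 → ℤ) :
    ∫ x in Set.Icc (0 : Fin 3 → ℝ) (fun _ => 2 * Real.pi), fourierMode k (WithLp.toLp 2 x) =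
      if k = 0 then ((2 * Real.pi) ^ 3 : ℂ) else 0 := by
  have h1 : Set.Icc (0 : Fin 3 → ℝ) (fun _ => 2 * Real.pi) =
      Set.univ.pi fun _ : Fin 3 => Set.Icc (0 : ℝ) (2 * Real.pi) := (Set.pi_univ_Icc _ _).symm
  have h2 : ∀ x : Fin 3 → ℝ, fourierMode k (WithLp.toLp 2 x) =
      ∏ r, Complex.exp (Complex.I * (k r : ℂ) * ((x r : ℝ) : ℂ)) := by
    intro x
    rw [← Complex.exp_sum, fourierMode, Finset.mul_sum]
    simp only [mul_assoc]
  simp only [h2]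
  rw [h1, MeasureTheory.volume_pi, MeasureTheory.Measure.restrict_pi_pi,
    MeasureTheory.integral_fintype_prod_eq_prod
      (f := fun r (x : ℝ) => Complex.exp (Complex.I * (k r : ℂ) * (x : ℂ)))]
  simp only [integral_exp_int]
  split_ifs with h
  · simp [h]
  · obtain ⟨r, hr⟩ := Function.ne_iff.1 h
    exact Finset.prod_eq_zero (Finset.mem_univ r) (if_neg (by simpa using hr))

/-- The Fourier coefficients of an absolutely convergent Fourier series. -/
lemma torusCoeff_tsum {c : (Fin 3 → ℤ) → ℂ} (hc : Summable fun k => ‖c k‖) (k : Fin 3 → ℤ) :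
    torusCoeff (fun x => ∑' l, c l * fourierMode l x) k = c k := by
  have hmode : ∀ x : Fin 3 → ℝ, Complex.exp (-Complex.I * ∑ r, (k r : ℂ) * ((x r : ℝ) : ℂ)) =
      fourierMode (-k) (WithLp.toLp 2 x) := by
    intro x
    rw [fourierMode]
    congr 1
    simp [Finset.sum_neg_distrib]
  have h1 : ∀ x : Fin 3 → ℝ, (∑' l, c l * fourierMode l (WithLp.toLp 2 x)) *
      Complex.exp (-Complex.I * ∑ r, (k r : ℂ) * ((x r : ℝ) : ℂ)) =
      ∑' l, c l * fourierMode (l - k) (WithLp.toLp 2 x) := by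
    intro x
    rw [hmode, ← tsum_mul_right]
    refine tsum_congr fun l => ?_
    rw [mul_assoc, ← fourierMode_add, sub_eq_add_neg]
  have hint : ∀ l, MeasureTheory.IntegrableOn
      (fun x : Fin 3 → ℝ => c l * fourierMode (l - k) (WithLp.toLp 2 x))
      (Set.Icc (0 : Fin 3 → ℝ) (fun _ => 2 * Real.pi)) := fun l =>
    Continuous.integrableOn_Icc (by fun_prop)
  have hsum : Summable fun l => ∫ x in Set.Icc (0 : Fin 3 → ℝ) (fun _ => 2 * Real.pi),
      ‖c l * fourierMode (l - k) (WithLp.toLp 2 x)‖ := by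
    simp only [norm_mul, norm_fourierMode, mul_one, MeasureTheory.integral_const, smul_eq_mul]
    exact hc.mul_left _
  rw [torusCoeff]
  simp only [h1]
  rw [← MeasureTheory.integral_tsum_of_summable_integral_norm hint hsum]
  simp only [MeasureTheory.integral_const_mul, integral_fourierMode, sub_eq_zero]
  rw [tsum_eq_single k (fun l hl => by simp [hl])]
  rw [if_pos rfl]
  push_cast
  field_simp

/-! ### Fourier coefficients of the Laplacian -/

lemma fderiv_periodic {f : EuclideanSpace ℝ (Fin 3) → ℂ} (hp : IsPeriodic f)
    (x : EuclideanSpace ℝ (Fin 3)) (r : Fin 3) :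
    fderiv ℝ f (x + EuclideanSpace.single r (2 * Real.pi)) = fderiv ℝ f x := by
  rw [← fderiv_comp_add_right]
  congr 1
  funext y
  exact hp y r

lemma laplacian_eq_sum (f : EuclideanSpace ℝ (Fin 3) → ℂ) (x : EuclideanSpace ℝ (Fin 3)) :
    Laplacian.laplacian f x = ∑ r, fderiv ℝ (fderiv ℝ f) x (EuclideanSpace.single r 1)
      (EuclideanSpace.single r 1) := by
  rw [InnerProductSpace.laplacian_eq_iteratedFDeriv_orthonormalBasis f
    (EuclideanSpace.basisFun (Fin 3) ℝ)]
  simp [iteratedFDeriv_two_apply]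

/-- Both integrations by parts are done at once: the field $e^{-ik\cdot x}(\partial_r f+ik_rf)$ has
divergence $(\Delta f+|k|^2f)e^{-ik\cdot x}$. The divergence theorem applies, and its fluxes through
opposite faces cancel by periodicity. -/
lemma torusCoeff_laplacian {f : EuclideanSpace ℝ (Fin 3) → ℂ} (hf : ContDiff ℝ 2 f)
    (hp : IsPeriodic f) (k : Fin 3 → ℤ) :
    torusCoeff (Laplacian.laplacian f) k = -((∑ r, (k r : ℝ) ^ 2 : ℝ) : ℂ) * torusCoeff f k := by
  set m : (Fin 3 → ℝ) → ℂ := fun x => Complex.exp (-Complex.I * ∑ r, (k r : ℂ) * (x r : ℂ)) with hm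
  let L : (Fin 3 → ℝ) →L[ℝ] EuclideanSpace ℝ (Fin 3) :=
    (EuclideanSpace.equiv (Fin 3) ℝ).symm.toContinuousLinearMap
  have hL : ∀ x, L x = WithLp.toLp 2 x := fun x => rfl
  have hL1 : ∀ r, L (Pi.single r 1) = EuclideanSpace.single r 1 := fun r => rfl
  let D : Fin 3 → EuclideanSpace ℝ (Fin 3) → ℂ := fun r x => fderiv ℝ f x (EuclideanSpace.single r 1)
  have hf1 : ContDiff ℝ 1 (fderiv ℝ f) := hf.fderiv_right (by norm_num)
  let q : Fin 3 → (Fin 3 → ℝ) →L[ℝ] ℂ := fun r =>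
    Complex.ofRealCLM.comp (ContinuousLinearMap.proj r)
  let m' : (Fin 3 → ℝ) → (Fin 3 → ℝ) →L[ℝ] ℂ := fun x => m x • (-Complex.I) • ∑ r, (k r : ℂ) • q r
  have hm' : ∀ x, HasFDerivAt m (m' x) x := by
    intro x
    have h1 : HasFDerivAt (fun x : Fin 3 → ℝ => -Complex.I * ∑ r, (k r : ℂ) * (x r : ℂ))
        ((-Complex.I) • ∑ r, (k r : ℂ) • q r) x :=
      (HasFDerivAt.fun_sum fun r _ => ((q r).hasFDerivAt.const_mul (k r : ℂ))).const_mul _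
    exact h1.cexp
  have hm'1 : ∀ x r, m' x (Pi.single r 1) = -Complex.I * k r * m x := by
    intro x r
    simp only [m', q, smul_apply, sum_apply,
      ContinuousLinearMap.comp_apply, ContinuousLinearMap.proj_apply, Complex.ofRealCLM_apply,
      smul_eq_mul]
    rw [Finset.sum_eq_single r]
    · simp; ring
    · intro b _ hb
      simp [hb]
    · simp
  have hmc : Continuous m := by
    rw [hm]; fun_prop
  have hfL : ∀ x, HasFDerivAt (fun x => f (L x)) ((fderiv ℝ f (L x)).comp L) x := fun x =>
    ((hf.differentiable (by norm_num)) (L x)).hasFDerivAt.comp x L.hasFDerivAt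
  have hDL : ∀ r x, HasFDerivAt (fun x => D r (L x))
      (((ContinuousLinearMap.apply ℝ ℂ (EuclideanSpace.single r (1 : ℝ))).comp
        (fderiv ℝ (fderiv ℝ f) (L x))).comp L) x := by
    intro r x
    have h1 := ((hf1.differentiable (by norm_num)) (L x)).hasFDerivAt
    exact ((ContinuousLinearMap.apply ℝ ℂ
      (EuclideanSpace.single r (1 : ℝ))).hasFDerivAt.comp (L x) h1).comp x L.hasFDerivAt
  let F : Fin 3 → (Fin 3 → ℝ) → ℂ := fun r x =>
    D r (L x) * m x + Complex.I * k r * (f (L x) * m x)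
  let F' : Fin 3 → (Fin 3 → ℝ) → (Fin 3 → ℝ) →L[ℝ] ℂ := fun r x =>
    (D r (L x) • m' x + m x • (((ContinuousLinearMap.apply ℝ ℂ (EuclideanSpace.single r (1 : ℝ))).comp
        (fderiv ℝ (fderiv ℝ f) (L x))).comp L)) +
      (Complex.I * k r) • (f (L x) • m' x + m x • ((fderiv ℝ f (L x)).comp L))
  have hF' : ∀ r x, HasFDerivAt (F r) (F' r x) x := fun r x =>
    ((hDL r x).mul (hm' x)).add (((hfL x).mul (hm' x)).const_mul _)
  have hdiv : ∀ x, ∑ r, F' r x (Pi.single r 1) =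
      Laplacian.laplacian f (L x) * m x + ((∑ r, (k r : ℝ) ^ 2 : ℝ) : ℂ) * (f (L x) * m x) := by
    intro x
    rw [laplacian_eq_sum, Finset.sum_mul]
    push_cast
    rw [Finset.sum_mul, ← Finset.sum_add_distrib]
    refine Finset.sum_congr rfl fun r _ => ?_
    simp only [F', add_apply, smul_apply, hm'1,
      ContinuousLinearMap.comp_apply, hL1, ContinuousLinearMap.apply_apply, smul_eq_mul, D]
    linear_combination (-(k r : ℂ) ^ 2 * f (L x) * m x) * Complex.I_mul_I
  have hfc : Continuous fun x => f (L x) := hf.continuous.comp L.continuous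
  have hlapc : Continuous fun x => Laplacian.laplacian f (L x) := by
    simp only [laplacian_eq_sum]
    have h2 : Continuous (fderiv ℝ (fderiv ℝ f)) := hf1.continuous_fderiv (by norm_num)
    have := h2.comp L.continuous
    fun_prop
  have hle : (0 : Fin 3 → ℝ) ≤ fun _ => 2 * Real.pi := fun _ => by
    simp only [Pi.zero_apply]; positivity
  have key := MeasureTheory.integral_divergence_of_hasFDerivAt_off_countable' (n := 2) (0 : Fin 3 → ℝ)
    (fun _ => 2 * Real.pi) hle F F' ∅ Set.countable_empty
    (fun r => (continuous_iff_continuousAt.2 fun x => (hF' r x).continuousAt).continuousOn)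
    (fun x _ r => hF' r x)
    (by
      simp only [hdiv]
      exact Continuous.integrableOn_Icc (by fun_prop))
  have hFper : ∀ r x, F r (x + Pi.single r (2 * Real.pi)) = F r x := by
    intro r x
    have h1 : L (x + Pi.single r (2 * Real.pi)) = L x + EuclideanSpace.single r (2 * Real.pi) := rfl
    have h2 : m (x + Pi.single r (2 * Real.pi)) = m x := by
      rw [hm]
      simp only
      rw [Complex.exp_eq_exp_iff_exists_int]
      refine ⟨-k r, ?_⟩
      have : ∑ i, (k i : ℂ) * (((x + Pi.single r (2 * Real.pi) : Fin 3 → ℝ) i : ℝ) : ℂ) =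
          ∑ i, (k i : ℂ) * (x i : ℂ) + k r * (2 * Real.pi) := by
        simp only [Pi.add_apply, Complex.ofReal_add, mul_add, Finset.sum_add_distrib]
        congr 1
        rw [Finset.sum_eq_single r]
        · simp
        · intro b _ hb
          simp [hb]
        · simp
      rw [this]
      push_cast
      ring
    simp only [F, D, h1, h2, fderiv_periodic hp, hp (L x) r]
  have hzero : ∀ r : Fin 3, ∀ y : Fin 2 → ℝ,
      F r (r.insertNth (2 * Real.pi) y) = F r (r.insertNth (0 : ℝ) y) := by
    intro r y
    rw [← hFper r (r.insertNth (0 : ℝ) y)]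
    congr 1
    funext i
    refine Fin.succAboveCases r ?_ (fun j => ?_) i
    · simp
    · simp [Fin.succAbove_ne]
  simp only [hdiv, hzero, Pi.zero_apply, sub_self, Finset.sum_const_zero] at key
  rw [MeasureTheory.integral_add (Continuous.integrableOn_Icc (by fun_prop))
    (Continuous.integrableOn_Icc (by fun_prop)), MeasureTheory.integral_const_mul] at key
  rw [torusCoeff, torusCoeff]
  simp only [← hL]
  linear_combination ((1 / (2 * Real.pi) ^ 3 : ℝ) : ℂ) * key

/-! ### Weighted Fourier series -/

/-- Cauchy-Schwarz for series: $t\mapsto\sum(f+tg)^2$ is a nonnegative quadratic polynomial, so its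
discriminant is not positive. -/
lemma summable_mul_and_sq_tsum_mul_le {ι : Type*} {f g : ι → ℝ} (hf : Summable fun i => f i ^ 2)
    (hg : Summable fun i => g i ^ 2) : Summable (fun i => f i * g i) ∧
      (∑' i, f i * g i) ^ 2 ≤ (∑' i, f i ^ 2) * ∑' i, g i ^ 2 := by
  have hfg : Summable fun i => f i * g i := by
    refine Summable.of_norm_bounded (hf.add hg) fun i => ?_
    rw [Real.norm_eq_abs, abs_le]
    constructor <;> nlinarith [sq_nonneg (f i + g i), sq_nonneg (f i - g i)]
  refine ⟨hfg, ?_⟩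
  have h : ∀ t : ℝ, 0 ≤ (∑' i, g i ^ 2) * (t * t) + (2 * ∑' i, f i * g i) * t + ∑' i, f i ^ 2 := by
    intro t
    have h1 : HasSum (fun i => (f i + t * g i) ^ 2)
        ((∑' i, g i ^ 2) * (t * t) + (2 * ∑' i, f i * g i) * t + ∑' i, f i ^ 2) := by
      have h2 := ((hg.hasSum.mul_right (t * t)).add ((hfg.hasSum.mul_left 2).mul_right t)).add
        hf.hasSum
      refine h2.congr_fun ?_
      intro i
      ring
    exact h1.nonneg fun i => sq_nonneg _
  have h3 := discrim_le_zero h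
  rw [discrim] at h3
  nlinarith

lemma summable_one_add_sq_rpow {a : ℝ} (ha : 1 < 2 * a) :
    Summable fun n : ℤ => (1 + (n : ℝ) ^ 2) ^ (-a) := by
  have h1 := Real.summable_abs_int_rpow ha
  have h2 : Summable (Pi.single (0 : ℤ) (1 : ℝ)) := (hasSum_pi_single _ _).summable
  -- Comparison with $|n|^{-2a}$ fails only at $n=0$; the added point mass takes care of that term.
  refine Summable.of_nonneg_of_le (fun n => by positivity) (fun n => ?_) (h1.add h2)
  by_cases hn : n = 0
  · have h3 : (0 : ℝ) ≤ |((0 : ℤ) : ℝ)| ^ (-(2 * a)) := by positivity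
    subst hn
    simpa using h3
  · rw [Pi.single_eq_of_ne hn, add_zero]
    have hn' : 0 < |(n : ℝ)| := abs_pos.2 (by exact_mod_cast hn)
    have h4 : |(n : ℝ)| ^ (-(2 * a)) = ((n : ℝ) ^ 2) ^ (-a) := by
      rw [← sq_abs, ← Real.rpow_natCast |(n : ℝ)| 2, ← Real.rpow_mul hn'.le]
      congr 1
      push_cast
      ring
    rw [h4]
    refine Real.rpow_le_rpow_of_nonpos ?_ (by linarith) (by linarith)
    have : (n : ℝ) ≠ 0 := by exact_mod_cast hn
    positivity

/-- The weight `(1 + |k|²)^{s/2}`. -/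
def sobolevWeight (s : ℝ) (k : Fin 3 → ℤ) : ℝ := (1 + ∑ r, (k r : ℝ) ^ 2) ^ (s / 2)

lemma one_le_sobolevBase (k : Fin 3 → ℤ) : 1 ≤ 1 + ∑ r, (k r : ℝ) ^ 2 :=
  le_add_of_nonneg_right (Finset.sum_nonneg fun _ _ => sq_nonneg _)

lemma sobolevWeight_pos (s : ℝ) (k : Fin 3 → ℤ) : 0 < sobolevWeight s k :=
  Real.rpow_pos_of_pos (by linarith [one_le_sobolevBase k]) _

lemma sobolevWeight_neg (s : ℝ) (k : Fin 3 → ℤ) : sobolevWeight s (-k) = sobolevWeight s k := by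
  simp [sobolevWeight]

lemma sobolevWeight_inv_sq (s : ℝ) (k : Fin 3 → ℤ) :
    ((sobolevWeight s k)⁻¹) ^ 2 = (1 + ∑ r, (k r : ℝ) ^ 2) ^ (-s) := by
  have h := one_le_sobolevBase k
  rw [sobolevWeight, ← Real.rpow_neg (by linarith), ← Real.rpow_natCast, ← Real.rpow_mul (by linarith)]
  congr 1
  push_cast
  ring

/-- The exponent is shared equally by the three coordinates. Each factor is then a one-dimensional
series with exponent $s/3>1/2$, which is precisely $s>3/2$. -/
lemma summable_sobolevBase {s : ℝ} (hs : 3 / 2 < s) :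
    Summable fun k : Fin 3 → ℤ => (1 + ∑ r, (k r : ℝ) ^ 2) ^ (-s) := by
  have h1 : Summable fun n : ℤ => (1 + (n : ℝ) ^ 2) ^ (-(s / 3)) :=
    summable_one_add_sq_rpow (by linarith)
  refine Summable.of_nonneg_of_le
    (fun k => Real.rpow_nonneg (by linarith [one_le_sobolevBase k]) _) (fun k => ?_)
    (f := fun k => ∏ r, (1 + (k r : ℝ) ^ 2) ^ (-(s / 3))) ?_
  · have h2 : (1 + ∑ r, (k r : ℝ) ^ 2) ^ (-s) =
        ∏ _i : Fin 3, (1 + ∑ r, (k r : ℝ) ^ 2) ^ (-(s / 3)) := by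
      rw [Finset.prod_const, ← Real.rpow_natCast, ← Real.rpow_mul (by linarith [one_le_sobolevBase k])]
      congr 1
      simp
    rw [h2]
    refine Finset.prod_le_prod
      (fun r _ => Real.rpow_nonneg (by linarith [one_le_sobolevBase k]) _) fun r _ => ?_
    refine Real.rpow_le_rpow_of_nonpos (by positivity) ?_ (by linarith)
    have := Finset.single_le_sum (fun r _ => sq_nonneg (k r : ℝ)) (Finset.mem_univ r)
    linarith
  · refine summable_of_sum_le (c := ∏ _r : Fin 3, ∑' n : ℤ, (1 + (n : ℝ) ^ 2) ^ (-(s / 3)))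
      (fun k => Finset.prod_nonneg fun r _ => by positivity) fun S => ?_
    have h3 : S ⊆ Fintype.piFinset fun r => S.image fun k => k r := by
      intro k hk
      rw [Fintype.mem_piFinset]
      exact fun r => Finset.mem_image_of_mem _ hk
    refine (Finset.sum_le_sum_of_subset_of_nonneg h3
      fun k _ _ => Finset.prod_nonneg fun r _ => by positivity).trans ?_
    rw [← Finset.prod_univ_sum (fun r => S.image fun k => k r)
      (fun _ (n : ℤ) => (1 + (n : ℝ) ^ 2) ^ (-(s / 3)))]
    refine Finset.prod_le_prod (fun r _ => Finset.sum_nonneg fun n _ => by positivity) fun r _ => ?_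
    exact h1.sum_le_tsum _ fun n _ => by positivity

/-- The space `ℓ²(ℤ³)` of weighted Fourier coefficients. -/
abbrev Coeffs : Type := lp (fun _ : Fin 3 → ℤ => ℂ) 2

lemma hasSum_norm_sq (w : Coeffs) : HasSum (fun k => ‖w k‖ ^ 2) (‖w‖ ^ 2) := by
  have h := lp.hasSum_norm (p := 2) (by simp) w
  simpa using h

lemma exists_coeffs {f : (Fin 3 → ℤ) → ℂ} {C : ℝ} (hC : 0 ≤ C) (hf : Summable fun k => ‖f k‖ ^ 2)
    (hfC : ∑' k, ‖f k‖ ^ 2 ≤ C ^ 2) : ∃ z : Coeffs, ‖z‖ ≤ C ∧ ∀ k, z k = f k := by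
  let z : Coeffs := ⟨f, memℓp_gen (by simpa using hf)⟩
  refine ⟨z, ?_, fun k => rfl⟩
  have h1 : ‖z‖ ^ 2 ≤ C ^ 2 := by
    rw [← (hasSum_norm_sq z).tsum_eq]
    exact hfC
  exact le_of_sq_le_sq h1 hC

/-- The Fourier coefficients with weighted coefficients `w`. -/
def plainCoeff (s : ℝ) (w : Coeffs) (k : Fin 3 → ℤ) : ℂ := ((sobolevWeight s k)⁻¹ : ℝ) * w k

lemma norm_plainCoeff (s : ℝ) (w : Coeffs) (k : Fin 3 → ℤ) :
    ‖plainCoeff s w k‖ = (sobolevWeight s k)⁻¹ * ‖w k‖ := by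
  rw [plainCoeff, norm_mul, Complex.norm_real, Real.norm_of_nonneg
    (inv_nonneg.2 (sobolevWeight_pos s k).le)]

/-- The norm of the embedding of `H_p^s` into the Wiener algebra. -/
def embeddingConst (s : ℝ) : ℝ := Real.sqrt (∑' k : Fin 3 → ℤ, (1 + ∑ r, (k r : ℝ) ^ 2) ^ (-s))

lemma embeddingConst_nonneg (s : ℝ) : 0 ≤ embeddingConst s := Real.sqrt_nonneg _

/-! ### Embedding of $H^s_p$ into the Wiener algebra -/

section

variable {s : ℝ} (hs : 3 / 2 < s)
include hs

lemma summable_plainCoeff (w : Coeffs) : Summable fun k => ‖plainCoeff s w k‖ := by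
  simp only [norm_plainCoeff]
  refine (summable_mul_and_sq_tsum_mul_le ?_ (hasSum_norm_sq w).summable).1
  simpa only [sobolevWeight_inv_sq] using summable_sobolevBase hs

lemma tsum_norm_plainCoeff_le (w : Coeffs) :
    ∑' k, ‖plainCoeff s w k‖ ≤ embeddingConst s * ‖w‖ := by
  simp only [norm_plainCoeff]
  have h := (summable_mul_and_sq_tsum_mul_le (f := fun k => (sobolevWeight s k)⁻¹)
    (by simpa only [sobolevWeight_inv_sq] using summable_sobolevBase hs)
    (hasSum_norm_sq w).summable).2
  simp only [sobolevWeight_inv_sq, (hasSum_norm_sq w).tsum_eq] at h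
  refine le_of_sq_le_sq ?_ (mul_nonneg (embeddingConst_nonneg s) (norm_nonneg w))
  rw [mul_pow, embeddingConst, Real.sq_sqrt]
  · exact h
  · exact tsum_nonneg fun k => Real.rpow_nonneg (by linarith [one_le_sobolevBase k]) _

lemma summable_plainCoeff_mul (w : Coeffs) (x : EuclideanSpace ℝ (Fin 3)) :
    Summable fun k => plainCoeff s w k * fourierMode k x := by
  refine Summable.of_norm ?_
  simpa only [norm_mul, norm_fourierMode, mul_one] using summable_plainCoeff hs w

end

/-- The function in `H_p^s` with weighted Fourier coefficients `w`. -/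
def fourierSeries (s : ℝ) (w : Coeffs) (x : EuclideanSpace ℝ (Fin 3)) : ℂ :=
  ∑' k, plainCoeff s w k * fourierMode k x

lemma plainCoeff_add (s : ℝ) (v w : Coeffs) (k : Fin 3 → ℤ) :
    plainCoeff s (v + w) k = plainCoeff s v k + plainCoeff s w k := by
  simp only [plainCoeff, lp.coeFn_add, Pi.add_apply, mul_add]

lemma plainCoeff_smul (s : ℝ) (c : ℂ) (w : Coeffs) (k : Fin 3 → ℤ) :
    plainCoeff s (c • w) k = c * plainCoeff s w k := by
  simp only [plainCoeff, lp.coeFn_smul, Pi.smul_apply, smul_eq_mul]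
  ring

lemma fourierSeries_smul (s : ℝ) (c : ℂ) (w : Coeffs) (x : EuclideanSpace ℝ (Fin 3)) :
    fourierSeries s (c • w) x = c * fourierSeries s w x := by
  simp only [fourierSeries, plainCoeff_smul, mul_assoc, tsum_mul_left]

section

variable {s : ℝ} (hs : 3 / 2 < s)
include hs

lemma fourierSeries_add (v w : Coeffs) (x : EuclideanSpace ℝ (Fin 3)) :
    fourierSeries s (v + w) x = fourierSeries s v x + fourierSeries s w x := by
  simp only [fourierSeries, plainCoeff_add, add_mul]
  exact (summable_plainCoeff_mul hs v x).tsum_add (summable_plainCoeff_mul hs w x)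

lemma norm_fourierSeries_le (w : Coeffs) (x : EuclideanSpace ℝ (Fin 3)) :
    ‖fourierSeries s w x‖ ≤ embeddingConst s * ‖w‖ := by
  refine (norm_tsum_le_tsum_norm ?_).trans ?_
  · simpa only [norm_mul, norm_fourierMode, mul_one] using summable_plainCoeff hs w
  · simpa only [norm_mul, norm_fourierMode, mul_one] using tsum_norm_plainCoeff_le hs w

/-- Point evaluation of functions in `H_p^s`. -/
def pointEval (x : EuclideanSpace ℝ (Fin 3)) : Coeffs →L[ℝ] ℂ :=
  LinearMap.mkContinuous
    { toFun := fun w => fourierSeries s w x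
      map_add' := fun v w => fourierSeries_add hs v w x
      map_smul' := fun c w => by
        have : c • w = (c : ℂ) • w := by
          ext k
          rw [lp.coeFn_smul, lp.coeFn_smul]
          simp
        rw [this, fourierSeries_smul]
        simp }
    (embeddingConst s) fun w => norm_fourierSeries_le hs w x

lemma torusCoeff_fourierSeries (w : Coeffs) (k : Fin 3 → ℤ) :
    torusCoeff (fourierSeries s w) k = plainCoeff s w k :=
  torusCoeff_tsum (summable_plainCoeff hs w) k

/-- A continuous periodic function whose weighted coefficients are `w` is the sum of its series. -/
lemma eq_fourierSeries {f : EuclideanSpace ℝ (Fin 3) → ℂ} (hc : Continuous f) (hp : IsPeriodic f)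
    {w : Coeffs} (hw : ∀ k, w k = sobolevCoeff s f k) (x : EuclideanSpace ℝ (Fin 3)) :
    f x = fourierSeries s w x := by
  have h1 : torusCoeff f = plainCoeff s w := by
    funext k
    rw [plainCoeff, hw, sobolevCoeff, ← mul_assoc, ← Complex.ofReal_mul]
    change _ = (((sobolevWeight s k)⁻¹ * sobolevWeight s k : ℝ) : ℂ) * _
    rw [inv_mul_cancel₀ (sobolevWeight_pos s k).ne', Complex.ofReal_one, one_mul]
  have h2 := hasSum_torusCoeff hc hp (by rw [h1]; exact (summable_plainCoeff hs w).of_norm) x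
  rw [h1] at h2
  exact h2.tsum_eq.symm

lemma plainCoeff_of_laplacian {f : EuclideanSpace ℝ (Fin 3) → ℂ} (hf : ContDiff ℝ 2 f)
    (hp : IsPeriodic f) {w z : Coeffs} (hw : ∀ x, f x = fourierSeries s w x)
    (hz : ∀ x, Laplacian.laplacian f x = fourierSeries s z x) (k : Fin 3 → ℤ) :
    plainCoeff s z k = -((∑ r, (k r : ℝ) ^ 2 : ℝ) : ℂ) * plainCoeff s w k := by
  rw [← torusCoeff_fourierSeries hs, ← torusCoeff_fourierSeries hs, ← funext hz, ← funext hw]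
  exact torusCoeff_laplacian hf hp k

end

/-! ### Conjugation and products in $H^s_p$ -/

lemma exists_fourierSeries_conj (s : ℝ) (w : Coeffs) : ∃ z : Coeffs, ‖z‖ ≤ ‖w‖ ∧
    ∀ x, fourierSeries s z x = star (fourierSeries s w x) := by
  have h1 : HasSum (fun k => ‖star (w (-k))‖ ^ 2) (‖w‖ ^ 2) := by
    simp only [norm_star]
    exact (Equiv.neg (Fin 3 → ℤ)).hasSum_iff.2 (hasSum_norm_sq w)
  obtain ⟨z, hz, hzk⟩ := exists_coeffs (norm_nonneg w) h1.summable h1.tsum_eq.le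
  refine ⟨z, hz, fun x => ?_⟩
  rw [fourierSeries, fourierSeries, tsum_star,
    ← (Equiv.neg (Fin 3 → ℤ)).tsum_eq fun k => star (plainCoeff s w k * fourierMode k x)]
  refine tsum_congr fun k => ?_
  simp only [plainCoeff, Equiv.neg_apply, sobolevWeight_neg, star_mul', star_fourierMode, neg_neg,
    hzk]
  congr 2
  exact (Complex.conj_ofReal _).symm

/-- The change of variables `(k, j) ↦ (j, k - j)`. -/
def convEquiv : (Fin 3 → ℤ) × (Fin 3 → ℤ) ≃ (Fin 3 → ℤ) × (Fin 3 → ℤ) where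
  toFun p := (p.2, p.1 - p.2)
  invFun p := (p.1 + p.2, p.1)
  left_inv p := by simp
  right_inv p := by simp

/-- Young's inequality `ℓ¹ * ℓ² ⊆ ℓ²`. -/
lemma young_convolution {α β : (Fin 3 → ℤ) → ℝ} (hα0 : ∀ k, 0 ≤ α k)
    (hα : Summable α) (hβ : Summable fun k => β k ^ 2) :
    (∀ k, Summable fun j => α j * β (k - j)) ∧
      Summable (fun k => (∑' j, α j * β (k - j)) ^ 2) ∧
      ∑' k, (∑' j, α j * β (k - j)) ^ 2 ≤ (∑' k, α k) ^ 2 * ∑' k, β k ^ 2 := by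
  have h1 : Summable fun p : (Fin 3 → ℤ) × (Fin 3 → ℤ) => α p.1 * β p.2 ^ 2 :=
    hα.mul_of_nonneg hβ hα0 fun k => sq_nonneg _
  have h2 : Summable fun p : (Fin 3 → ℤ) × (Fin 3 → ℤ) => α p.2 * β (p.1 - p.2) ^ 2 :=
    convEquiv.summable_iff.2 h1
  have h3 : ∑' k, ∑' j, α j * β (k - j) ^ 2 = (∑' k, α k) * ∑' k, β k ^ 2 := by
    rw [hα.tsum_mul_tsum hβ h1, ← convEquiv.tsum_eq]
    exact h2.tsum_prod.symm
  -- Cauchy-Schwarz with the splitting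
  -- $\alpha_j\beta_{k-j}=\sqrt{\alpha_j}\cdot\sqrt{\alpha_j}\,\beta_{k-j}$. Summing over `k`
  -- afterwards decouples the two factors.
  have hcs : ∀ k, Summable (fun j => α j * β (k - j)) ∧
      (∑' j, α j * β (k - j)) ^ 2 ≤ (∑' j, α j) * ∑' j, α j * β (k - j) ^ 2 := by
    intro k
    have h4 : ∀ j, Real.sqrt (α j) ^ 2 = α j := fun j => Real.sq_sqrt (hα0 j)
    have h5 : ∀ j, (Real.sqrt (α j) * β (k - j)) ^ 2 = α j * β (k - j) ^ 2 := fun j => by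
      rw [mul_pow, h4]
    have h6 : ∀ j, Real.sqrt (α j) * (Real.sqrt (α j) * β (k - j)) = α j * β (k - j) := fun j => by
      rw [← mul_assoc, ← sq, h4]
    have h7 := summable_mul_and_sq_tsum_mul_le (f := fun j => Real.sqrt (α j))
      (g := fun j => Real.sqrt (α j) * β (k - j)) (by simpa only [h4] using hα)
      (by simpa only [h5] using h2.prod_factor k)
    simpa only [h4, h5, h6] using h7
  have h8 : Summable fun k => (∑' j, α j) * ∑' j, α j * β (k - j) ^ 2 := h2.prod.mul_left _
  have h9 := Summable.of_nonneg_of_le (fun k => sq_nonneg _) (fun k => (hcs k).2) h8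
  refine ⟨fun k => (hcs k).1, h9, ?_⟩
  refine (h9.tsum_le_tsum (fun k => (hcs k).2) h8).trans_eq ?_
  rw [tsum_mul_left, h3]
  ring

/-- From $|k|^2\le2|j|^2+2|k-j|^2$. In a product the weight therefore falls on one factor at a time,
which leaves the other factor in $\ell^1$. -/
lemma sobolevWeight_le {s : ℝ} (hs : 0 ≤ s) (k j : Fin 3 → ℤ) :
    sobolevWeight s k ≤ 4 ^ (s / 2) * (sobolevWeight s j + sobolevWeight s (k - j)) := by
  have hj := one_le_sobolevBase j
  have hkj := one_le_sobolevBase (k - j)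
  have h1 : 1 + ∑ r, (k r : ℝ) ^ 2 ≤
      4 * max (1 + ∑ r, (j r : ℝ) ^ 2) (1 + ∑ r, ((k - j) r : ℝ) ^ 2) := by
    have h2 : ∑ r, (k r : ℝ) ^ 2 ≤ ∑ r, (2 * (j r : ℝ) ^ 2 + 2 * ((k - j) r : ℝ) ^ 2) := by
      refine Finset.sum_le_sum fun r _ => ?_
      simp only [Pi.sub_apply]
      push_cast
      nlinarith [sq_nonneg ((j r : ℝ) - (k r - j r))]
    rw [Finset.sum_add_distrib, ← Finset.mul_sum, ← Finset.mul_sum] at h2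
    have h3 := le_max_left (1 + ∑ r, (j r : ℝ) ^ 2) (1 + ∑ r, ((k - j) r : ℝ) ^ 2)
    have h4 := le_max_right (1 + ∑ r, (j r : ℝ) ^ 2) (1 + ∑ r, ((k - j) r : ℝ) ^ 2)
    linarith
  have h5 : sobolevWeight s k ≤ 4 ^ (s / 2) *
      (max (1 + ∑ r, (j r : ℝ) ^ 2) (1 + ∑ r, ((k - j) r : ℝ) ^ 2)) ^ (s / 2) := by
    rw [← Real.mul_rpow (by norm_num) (le_max_of_le_left (by linarith))]
    exact Real.rpow_le_rpow (by linarith [one_le_sobolevBase k]) h1 (by linarith)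
  refine h5.trans (mul_le_mul_of_nonneg_left ?_ (by positivity))
  rcases max_cases (1 + ∑ r, (j r : ℝ) ^ 2) (1 + ∑ r, ((k - j) r : ℝ) ^ 2) with h | h
  · rw [h.1]
    exact le_add_of_nonneg_right (sobolevWeight_pos s (k - j)).le
  · rw [h.1]
    exact le_add_of_nonneg_left (sobolevWeight_pos s j).le

/-- `H_p^s` is an algebra for `s > 3/2`. -/
lemma exists_fourierSeries_mul {s : ℝ} (hs : 3 / 2 < s) : ∃ K : ℝ, 0 ≤ K ∧ ∀ v w : Coeffs,
    ∃ z : Coeffs, ‖z‖ ≤ K * ‖v‖ * ‖w‖ ∧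
      ∀ x, fourierSeries s z x = fourierSeries s v x * fourierSeries s w x := by
  set C := embeddingConst s
  have hC : 0 ≤ C := embeddingConst_nonneg s
  refine ⟨2 * (4 ^ (s / 2) * C), by positivity, fun v w => ?_⟩
  set a := plainCoeff s v with ha_def
  set b := plainCoeff s w with hb_def
  have ha : Summable fun k => ‖a k‖ := summable_plainCoeff hs v
  have hb : Summable fun k => ‖b k‖ := summable_plainCoeff hs w
  have hWa : ∀ k, sobolevWeight s k * ‖a k‖ = ‖v k‖ := fun k => by
    rw [ha_def, norm_plainCoeff, mul_inv_cancel_left₀ (sobolevWeight_pos s k).ne']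
  have hWb : ∀ k, sobolevWeight s k * ‖b k‖ = ‖w k‖ := fun k => by
    rw [hb_def, norm_plainCoeff, mul_inv_cancel_left₀ (sobolevWeight_pos s k).ne']
  obtain ⟨hy1, hy2, hy3⟩ := young_convolution (fun k => norm_nonneg (a k)) ha
    (hasSum_norm_sq w).summable
  obtain ⟨hx1, hx2, hx3⟩ := young_convolution (fun k => norm_nonneg (b k)) hb
    (hasSum_norm_sq v).summable
  have hx1' : ∀ k, HasSum (fun j => ‖v j‖ * ‖b (k - j)‖) (∑' j, ‖b j‖ * ‖v (k - j)‖) := by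
    intro k
    have h := (Equiv.subLeft k).hasSum_iff.2 (hx1 k).hasSum
    refine h.congr_fun fun j => ?_
    simp [mul_comm]
  set f : (Fin 3 → ℤ) → ℂ := fun k => (sobolevWeight s k : ℂ) * ∑' j, a j * b (k - j) with hf_def
  have hab : ∀ k, Summable fun j => ‖a j * b (k - j)‖ := by
    intro k
    simp only [norm_mul]
    have hbd : ∀ j, ‖b (k - j)‖ ≤ ∑' l, ‖b l‖ := fun j =>
      hb.le_tsum (k - j) fun _ _ => norm_nonneg _
    exact Summable.of_nonneg_of_le (fun j => by positivity)
      (fun j => mul_le_mul_of_nonneg_left (hbd j) (norm_nonneg _)) (ha.mul_right _)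
  -- Once the weight is distributed, the coefficients of the product are dominated by two
  -- convolutions of an $\ell^1$ sequence (plain coefficients) with an $\ell^2$ sequence (weighted
  -- coefficients). Young's inequality applies to both, and this is the factor 2 in the algebra
  -- constant.
  have hfk : ∀ k, ‖f k‖ ≤ 4 ^ (s / 2) *
      ((∑' j, ‖b j‖ * ‖v (k - j)‖) + ∑' j, ‖a j‖ * ‖w (k - j)‖) := by
    intro k
    rw [hf_def]
    simp only
    rw [norm_mul, Complex.norm_real, Real.norm_of_nonneg (sobolevWeight_pos s k).le]
    have h1 := ((hx1' k).add (hy1 k).hasSum).mul_left ((4 : ℝ) ^ (s / 2))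
    refine (mul_le_mul_of_nonneg_left (norm_tsum_le_tsum_norm (hab k))
      (sobolevWeight_pos s k).le).trans ?_
    rw [← tsum_mul_left, ← h1.tsum_eq]
    refine ((hab k).mul_left _).tsum_le_tsum (fun j => ?_) h1.summable
    rw [norm_mul, ← hWa j, ← hWb (k - j)]
    have h2 := mul_le_mul_of_nonneg_right (sobolevWeight_le (by linarith : 0 ≤ s) k j)
      (mul_nonneg (norm_nonneg (a j)) (norm_nonneg (b (k - j))))
    refine h2.trans_eq ?_
    ring
  have hA : ∑' k, ‖a k‖ ≤ C * ‖v‖ := tsum_norm_plainCoeff_le hs v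
  have hB : ∑' k, ‖b k‖ ≤ C * ‖w‖ := tsum_norm_plainCoeff_le hs w
  have hA0 : 0 ≤ ∑' k, ‖a k‖ := tsum_nonneg fun k => norm_nonneg _
  have hB0 : 0 ≤ ∑' k, ‖b k‖ := tsum_nonneg fun k => norm_nonneg _
  rw [(hasSum_norm_sq w).tsum_eq] at hy3
  rw [(hasSum_norm_sq v).tsum_eq] at hx3
  have hy4 : ∑' k, (∑' j, ‖a j‖ * ‖w (k - j)‖) ^ 2 ≤ (C * ‖v‖ * ‖w‖) ^ 2 := by
    refine hy3.trans ?_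
    rw [← mul_pow]
    gcongr
  have hx4 : ∑' k, (∑' j, ‖b j‖ * ‖v (k - j)‖) ^ 2 ≤ (C * ‖v‖ * ‖w‖) ^ 2 := by
    refine hx3.trans ?_
    rw [← mul_pow, mul_right_comm]
    gcongr
  have hbound : ∀ k, ‖f k‖ ^ 2 ≤ (4 ^ (s / 2)) ^ 2 * (2 *
      ((∑' j, ‖b j‖ * ‖v (k - j)‖) ^ 2 + (∑' j, ‖a j‖ * ‖w (k - j)‖) ^ 2)) := by
    intro k
    refine (pow_le_pow_left₀ (norm_nonneg _) (hfk k) 2).trans ?_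
    rw [mul_pow]
    gcongr
    nlinarith [sq_nonneg ((∑' j, ‖b j‖ * ‖v (k - j)‖) - ∑' j, ‖a j‖ * ‖w (k - j)‖)]
  have hmaj : Summable fun k => ((4 : ℝ) ^ (s / 2)) ^ 2 * (2 *
      ((∑' j, ‖b j‖ * ‖v (k - j)‖) ^ 2 + (∑' j, ‖a j‖ * ‖w (k - j)‖) ^ 2)) :=
    ((hx2.add hy2).mul_left 2).mul_left _
  have hfs : Summable fun k => ‖f k‖ ^ 2 :=
    Summable.of_nonneg_of_le (fun k => sq_nonneg _) hbound hmaj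
  have hfC : ∑' k, ‖f k‖ ^ 2 ≤ (2 * (4 ^ (s / 2) * C) * ‖v‖ * ‖w‖) ^ 2 := by
    refine (hfs.tsum_le_tsum hbound hmaj).trans ?_
    rw [tsum_mul_left, tsum_mul_left, hx2.tsum_add hy2]
    have h4 : (0 : ℝ) ≤ (4 ^ (s / 2)) ^ 2 := by positivity
    calc _ ≤ ((4 : ℝ) ^ (s / 2)) ^ 2 * (2 * ((C * ‖v‖ * ‖w‖) ^ 2 + (C * ‖v‖ * ‖w‖) ^ 2)) := by
          gcongr
      _ = _ := by ring
  obtain ⟨z, hz, hzk⟩ := exists_coeffs (by positivity) hfs hfC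
  refine ⟨z, hz, fun x => ?_⟩
  have hzc : ∀ k, plainCoeff s z k = ∑' j, a j * b (k - j) := by
    intro k
    rw [plainCoeff, hzk, hf_def]
    simp only
    rw [← mul_assoc, ← Complex.ofReal_mul, inv_mul_cancel₀ (sobolevWeight_pos s k).ne',
      Complex.ofReal_one, one_mul]
  have hna : Summable fun k => ‖a k * fourierMode k x‖ := by
    simpa only [norm_mul, norm_fourierMode, mul_one] using ha
  have hnb : Summable fun k => ‖b k * fourierMode k x‖ := by
    simpa only [norm_mul, norm_fourierMode, mul_one] using hb
  have hprod := summable_mul_of_summable_norm hna hnb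
  have hprod' : Summable fun p : (Fin 3 → ℤ) × (Fin 3 → ℤ) =>
      a p.2 * fourierMode p.2 x * (b (p.1 - p.2) * fourierMode (p.1 - p.2) x) :=
    convEquiv.summable_iff.2 hprod
  rw [fourierSeries, fourierSeries, fourierSeries, tsum_mul_tsum_of_summable_norm hna hnb,
    ← convEquiv.tsum_eq]
  refine Eq.trans ?_ hprod'.tsum_prod.symm
  refine tsum_congr fun k => ?_
  rw [hzc, ← tsum_mul_right]
  refine tsum_congr fun j => ?_
  have : fourierMode k x = fourierMode j x * fourierMode (k - j) x := by
    rw [← fourierMode_add, add_sub_cancel]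
  rw [this]
  ring

/-! ### Restriction of Fourier series to the grid -/

/-- The parametrization of the frequencies by their class modulo `N` and their offset from the
representative of least absolute value. -/
def aliasFreq {N : ℕ} (p : (Fin 3 → ZMod N) × (Fin 3 → ℤ)) : Fin 3 → ℤ :=
  fun r => (p.1 r).valMinAbs + N * p.2 r

lemma intCast_aliasFreq {N : ℕ} (p : (Fin 3 → ZMod N) × (Fin 3 → ℤ)) :
    (fun r => ((aliasFreq p r : ℤ) : ZMod N)) = p.1 := by
  funext r
  simp [aliasFreq]

section Grid

variable {N : ℕ} [NeZero N]

lemma bijective_aliasFreq : Function.Bijective (aliasFreq (N := N)) := by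
  have hN : (N : ℤ) ≠ 0 := by exact_mod_cast NeZero.ne N
  constructor
  · intro p q h
    have h1 : p.1 = q.1 := by rw [← intCast_aliasFreq p, ← intCast_aliasFreq q, h]
    refine Prod.ext h1 (funext fun r => ?_)
    have h2 := congrFun h r
    simp only [aliasFreq, h1] at h2
    exact mul_left_cancel₀ hN (add_left_cancel h2)
  · intro k
    have h1 : ∀ r, (N : ℤ) ∣ k r - ((k r : ZMod N)).valMinAbs := by
      intro r
      rw [← ZMod.intCast_eq_intCast_iff_dvd_sub]
      simp
    choose m hm using h1
    refine ⟨(fun r => (k r : ZMod N), m), funext fun r => ?_⟩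
    simp only [aliasFreq]
    linarith [hm r]

/-- The equivalence given by `aliasFreq`. -/
def aliasEquiv : (Fin 3 → ZMod N) × (Fin 3 → ℤ) ≃ (Fin 3 → ℤ) :=
  Equiv.ofBijective aliasFreq bijective_aliasFreq

/-- Restriction of a Fourier series to the grid. -/
def gridSeries (N : ℕ) (c : (Fin 3 → ℤ) → ℂ) : GridFun N :=
  fun j => ∑' k, c k * fourierMode k (gridPoint N j)

lemma fourierMode_aliasFreq (κ : Fin 3 → ZMod N) (m : Fin 3 → ℤ) (j : Fin 3 → Fin N) :
    fourierMode (aliasFreq (κ, m)) (gridPoint N j) = gridChar κ j := by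
  have h := gridChar_intCast (aliasFreq (κ, m)) j
  rw [intCast_aliasFreq] at h
  exact h.symm

lemma gridSeries_eq_sum {c : (Fin 3 → ℤ) → ℂ} (hc : Summable fun k => ‖c k‖) :
    gridSeries N c = ∑ κ, (∑' m, c (aliasFreq (κ, m))) • gridChar κ := by
  funext j
  have h1 : Summable fun k => c k * fourierMode k (gridPoint N j) := by
    refine Summable.of_norm ?_
    simpa only [norm_mul, norm_fourierMode, mul_one] using hc
  have h2 := (aliasEquiv (N := N)).summable_iff.2 h1
  rw [gridSeries, ← (aliasEquiv (N := N)).tsum_eq]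
  refine Eq.trans h2.tsum_prod ?_
  rw [tsum_fintype, Finset.sum_apply]
  refine Finset.sum_congr rfl fun κ _ => ?_
  rw [Pi.smul_apply, smul_eq_mul, ← tsum_mul_right]
  refine tsum_congr fun m => ?_
  rw [← fourierMode_aliasFreq κ m j]
  rfl

/-- Aliasing formula. -/
lemma dft_gridSeries {c : (Fin 3 → ℤ) → ℂ} (hc : Summable fun k => ‖c k‖) (κ : Fin 3 → ZMod N) :
    dft κ (gridSeries N c) = ∑' m, c (aliasFreq (κ, m)) := by
  rw [gridSeries_eq_sum hc, map_sum]
  simp only [map_smul, dft_gridChar, smul_eq_mul]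
  simp

lemma summable_comp_aliasFreq {g : (Fin 3 → ℤ) → ℝ} (hg : Summable g) (κ : Fin 3 → ZMod N) :
    Summable fun m => g (aliasFreq (κ, m)) :=
  ((aliasEquiv (N := N)).summable_iff.2 hg).prod_factor κ

lemma sum_tsum_aliasFreq {g : (Fin 3 → ℤ) → ℝ} (hg : Summable g) :
    ∑ κ : Fin 3 → ZMod N, ∑' m, g (aliasFreq (κ, m)) = ∑' k, g k := by
  have h2 := (aliasEquiv (N := N)).summable_iff.2 hg
  rw [← (aliasEquiv (N := N)).tsum_eq g]
  refine Eq.trans ?_ h2.tsum_prod.symm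
  rw [tsum_fintype]
  rfl

lemma wienerNorm_gridSeries_le {c : (Fin 3 → ℤ) → ℂ} (hc : Summable fun k => ‖c k‖) :
    wienerNorm (gridSeries N c) ≤ ∑' k, ‖c k‖ := by
  rw [wienerNorm, ← sum_tsum_aliasFreq (N := N) hc]
  refine Finset.sum_le_sum fun κ _ => ?_
  rw [dft_gridSeries hc]
  exact norm_tsum_le_tsum_norm (summable_comp_aliasFreq hc κ)

lemma valMinAbs_sq_le (q : ZMod N) (k : ℤ) (h : (k : ZMod N) = q) :
    (q.valMinAbs : ℝ) ^ 2 ≤ (k : ℝ) ^ 2 := by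
  have h1 := ZMod.natAbs_min_of_le_div_two N q.valMinAbs k (by rw [ZMod.coe_valMinAbs, h])
    (ZMod.natAbs_valMinAbs_le q)
  have h2 := Int.natAbs_le_iff_sq_le.1 h1
  exact_mod_cast h2

lemma gridSymbol_le (κ : Fin 3 → ZMod N) (m : Fin 3 → ℤ) :
    gridSymbol κ ≤ ∑ r, (aliasFreq (κ, m) r : ℝ) ^ 2 :=
  Finset.sum_le_sum fun r _ => valMinAbs_sq_le _ _ (congrFun (intCast_aliasFreq (κ, m)) r)

/-- The representative has coordinates at most $N/2$, so a nonzero offset $m_r$ leaves a coordinate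
of modulus at least $N|m_r|/2$. Since $|m|\ge1$, the quantity $|m|^2$ may be replaced by
$(1+|m|^2)/2$, whence the denominator 8. -/
lemma sobolevBase_aliasFreq (κ : Fin 3 → ZMod N) {m : Fin 3 → ℤ} (hm : m ≠ 0) :
    ((N : ℝ) ^ 2 / 8) * (1 + ∑ r, (m r : ℝ) ^ 2) ≤ 1 + ∑ r, (aliasFreq (κ, m) r : ℝ) ^ 2 := by
  have h1 : ∀ r, (N : ℝ) ^ 2 / 4 * (m r : ℝ) ^ 2 ≤ (aliasFreq (κ, m) r : ℝ) ^ 2 := by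
    intro r
    by_cases hr : m r = 0
    · rw [hr]
      simpa using sq_nonneg _
    · have h2 : (((κ r).valMinAbs : ℝ)) ^ 2 ≤ ((N : ℝ) / 2) ^ 2 := by
        have h3 := ZMod.valMinAbs_mem_Ioc (κ r)
        rw [Set.mem_Ioc] at h3
        have h4 : (-(N : ℝ)) < (κ r).valMinAbs * 2 := by exact_mod_cast h3.1
        have h5 : ((κ r).valMinAbs : ℝ) * 2 ≤ N := by exact_mod_cast h3.2
        apply sq_le_sq'
        · linarith
        · linarith
      have h6 : |((κ r).valMinAbs : ℝ)| ≤ (N : ℝ) / 2 := abs_le_of_sq_le_sq h2 (by positivity)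
      have h7 : (1 : ℝ) ≤ |(m r : ℝ)| := by exact_mod_cast Int.one_le_abs hr
      have h8 : (N : ℝ) / 2 * |(m r : ℝ)| ≤ |(aliasFreq (κ, m) r : ℝ)| := by
        have h9 : |(N : ℝ) * (m r : ℝ)| ≤
            |(aliasFreq (κ, m) r : ℝ)| + |((κ r).valMinAbs : ℝ)| := by
          have : (N : ℝ) * (m r : ℝ) = (aliasFreq (κ, m) r : ℝ) - ((κ r).valMinAbs : ℝ) := by
            simp only [aliasFreq]
            push_cast
            ring
          rw [this]
          exact abs_sub _ _
        rw [abs_mul, Nat.abs_cast] at h9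
        have h10 : (N : ℝ) ≤ N * |(m r : ℝ)| := le_mul_of_one_le_right (by positivity) h7
        linarith
      have h11 := pow_le_pow_left₀ (by positivity) h8 2
      rw [mul_pow, sq_abs, sq_abs] at h11
      refine le_trans (le_of_eq ?_) h11
      ring
  have h12 : (N : ℝ) ^ 2 / 4 * ∑ r, (m r : ℝ) ^ 2 ≤ ∑ r, (aliasFreq (κ, m) r : ℝ) ^ 2 := by
    rw [Finset.mul_sum]
    exact Finset.sum_le_sum fun r _ => h1 r
  have h13 : 1 ≤ ∑ r, (m r : ℝ) ^ 2 := by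
    obtain ⟨r, hr⟩ := Function.ne_iff.1 hm
    refine le_trans ?_ (Finset.single_le_sum (fun r _ => sq_nonneg (m r : ℝ)) (Finset.mem_univ r))
    have : (1 : ℝ) ≤ |(m r : ℝ)| := by exact_mod_cast Int.one_le_abs hr
    rw [← sq_abs]
    nlinarith
  have h14 : 0 ≤ (N : ℝ) ^ 2 / 8 := by positivity
  nlinarith

/-- The spatial error of the pseudo-spectral Laplacian on Fourier series. -/
lemma norm_dft_spatialError_le (hN : Even N) {a b : (Fin 3 → ℤ) → ℂ}
    (ha : Summable fun k => ‖a k‖) (hb : Summable fun k => ‖b k‖)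
    (hab : ∀ k, b k = -((∑ r, (k r : ℝ) ^ 2 : ℝ) : ℂ) * a k) (κ : Fin 3 → ZMod N) :
    ‖dft κ (discreteLaplacian N (gridSeries N a) - gridSeries N b)‖ ≤
      ∑' m, if m = 0 then 0 else ‖b (aliasFreq (κ, m))‖ := by
  have ha' : Summable fun m => a (aliasFreq (κ, m)) :=
    (summable_comp_aliasFreq ha κ).of_norm
  have hbn := summable_comp_aliasFreq (N := N) hb κ
  rw [map_sub, dft_discreteLaplacian hN, dft_gridSeries ha, dft_gridSeries hb, ← tsum_mul_left,
    ← (ha'.mul_left _).tsum_sub hbn.of_norm]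
  -- The offset $m=0$ contributes nothing, because $\Delta_h$ is exact on the representatives. On
  -- aliased frequencies the symbol lies between $0$ and $|k|^2$, so the discrepancy is at most
  -- $|k|^2|a_k|=|b_k|$.
  have hle : ∀ m, ‖-(gridSymbol κ : ℂ) * a (aliasFreq (κ, m)) - b (aliasFreq (κ, m))‖ ≤
      if m = 0 then 0 else ‖b (aliasFreq (κ, m))‖ := by
    intro m
    have h1 : -(gridSymbol κ : ℂ) * a (aliasFreq (κ, m)) - b (aliasFreq (κ, m)) =
        ((∑ r, (aliasFreq (κ, m) r : ℝ) ^ 2 - gridSymbol κ : ℝ) : ℂ) * a (aliasFreq (κ, m)) := by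
      rw [hab, Complex.ofReal_sub]
      ring
    rw [h1]
    split_ifs with hm
    · have h2 : ∑ r, (aliasFreq (κ, m) r : ℝ) ^ 2 - gridSymbol κ = 0 := by
        simp [gridSymbol, aliasFreq, hm]
      rw [h2]
      simp
    · have h0 : 0 ≤ gridSymbol κ := Finset.sum_nonneg fun r _ => sq_nonneg _
      have h3 := gridSymbol_le κ m
      rw [hab, norm_mul, norm_mul, norm_neg, Complex.norm_real, Complex.norm_real,
        Real.norm_of_nonneg (by linarith), Real.norm_of_nonneg (by linarith)]
      gcongr
      linarith
  have hs : Summable fun m => if m = 0 then 0 else ‖b (aliasFreq (κ, m))‖ := by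
    refine Summable.of_nonneg_of_le (fun m => ?_) (fun m => ?_) hbn
    · split_ifs <;> positivity
    · split_ifs <;> simp
  have hn := Summable.of_nonneg_of_le (fun m => norm_nonneg _) hle hs
  exact (norm_tsum_le_tsum_norm hn).trans (hn.tsum_le_tsum hle hs)

/-- Cauchy-Schwarz over the aliases of one class. Their inverse squared weights are bounded by
$8^sN^{-2s}(1+|m|^2)^{-s}$, summable in $m$. The remaining sums over the classes add up to
$\|z\|^2$. -/
lemma tsum_alias_sq_le {s : ℝ} (hs : 3 / 2 < s) (z : Coeffs) (κ : Fin 3 → ZMod N) :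
    (∑' m, if m = 0 then 0 else ‖plainCoeff s z (aliasFreq (κ, m))‖) ^ 2 ≤
      (8 ^ s * embeddingConst s ^ 2 * ((N : ℝ) ^ (-s)) ^ 2) * ∑' m, ‖z (aliasFreq (κ, m))‖ ^ 2 := by
  have hN : (0 : ℝ) < N := by exact_mod_cast NeZero.pos N
  set f : (Fin 3 → ℤ) → ℝ := fun m => if m = 0 then 0 else (sobolevWeight s (aliasFreq (κ, m)))⁻¹
  have hf : ∀ m, f m ^ 2 ≤ 8 ^ s * ((N : ℝ) ^ (-s)) ^ 2 * (1 + ∑ r, (m r : ℝ) ^ 2) ^ (-s) := by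
    intro m
    have hm1 := one_le_sobolevBase m
    by_cases hm : m = 0
    · simp only [f, if_pos hm]
      rw [zero_pow two_ne_zero]
      positivity
    · simp only [f, if_neg hm]
      rw [sobolevWeight_inv_sq]
      refine (Real.rpow_le_rpow_of_nonpos (by positivity) (sobolevBase_aliasFreq κ hm)
        (by linarith)).trans_eq ?_
      rw [Real.mul_rpow (by positivity) (by linarith), Real.div_rpow (by positivity) (by norm_num),
        Real.rpow_neg (by norm_num : (0 : ℝ) ≤ 8), div_inv_eq_mul, mul_comm (_ ^ (-s)) ((8 : ℝ) ^ s),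
        ← Real.rpow_natCast (N : ℝ) 2, ← Real.rpow_mul hN.le, ← Real.rpow_natCast _ 2,
        ← Real.rpow_mul hN.le, mul_comm (-s)]
  have hsum := (summable_sobolevBase hs).mul_left (8 ^ s * ((N : ℝ) ^ (-s)) ^ 2)
  have hfs : Summable fun m => f m ^ 2 :=
    Summable.of_nonneg_of_le (fun m => sq_nonneg _) hf hsum
  have hz : Summable fun m => ‖z (aliasFreq (κ, m))‖ ^ 2 :=
    summable_comp_aliasFreq (g := fun k => ‖z k‖ ^ 2) (hasSum_norm_sq z).summable κ
  have h1 := (summable_mul_and_sq_tsum_mul_le hfs hz).2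
  have h2 : ∀ m, (if m = 0 then 0 else ‖plainCoeff s z (aliasFreq (κ, m))‖) =
      f m * ‖z (aliasFreq (κ, m))‖ := by
    intro m
    simp only [f, norm_plainCoeff]
    split_ifs <;> simp
  simp only [h2]
  refine h1.trans (mul_le_mul_of_nonneg_right ?_ (tsum_nonneg fun m => sq_nonneg _))
  refine (hfs.tsum_le_tsum hf hsum).trans_eq ?_
  rw [tsum_mul_left, embeddingConst, Real.sq_sqrt]
  · ring
  · exact tsum_nonneg fun k => Real.rpow_nonneg (by linarith [one_le_sobolevBase k]) _

end Grid

/-- The constant of the spatial error estimate. -/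
def spatialConst (s : ℝ) : ℝ :=
  Real.sqrt ((2 * Real.pi) ^ 3) * (Real.sqrt (8 ^ s) * embeddingConst s)

lemma spatialConst_nonneg (s : ℝ) : 0 ≤ spatialConst s := by
  have := embeddingConst_nonneg s
  unfold spatialConst
  positivity

/-- The spatial error in the discrete `L²` norm. -/
lemma gridNorm_spatialError_le {N : ℕ} [NeZero N] (hN : Even N) {s : ℝ} (hs : 3 / 2 < s)
    (w z : Coeffs)
    (hwz : ∀ k, plainCoeff s z k = -((∑ r, (k r : ℝ) ^ 2 : ℝ) : ℂ) * plainCoeff s w k) :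
    gridNorm N (discreteLaplacian N (gridSeries N (plainCoeff s w)) -
      gridSeries N (plainCoeff s z)) ≤ spatialConst s * (N : ℝ) ^ (-s) * ‖z‖ := by
  have hE := embeddingConst_nonneg s
  have h1 : ∑ κ : Fin 3 → ZMod N, ‖dft κ (discreteLaplacian N (gridSeries N (plainCoeff s w)) -
      gridSeries N (plainCoeff s z))‖ ^ 2 ≤
      (8 ^ s * embeddingConst s ^ 2 * ((N : ℝ) ^ (-s)) ^ 2) * ‖z‖ ^ 2 := by
    rw [← (hasSum_norm_sq z).tsum_eq, ← sum_tsum_aliasFreq (N := N) (hasSum_norm_sq z).summable,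
      Finset.mul_sum]
    refine Finset.sum_le_sum fun κ _ => le_trans ?_ (tsum_alias_sq_le hs z κ)
    exact pow_le_pow_left₀ (norm_nonneg _) (norm_dft_spatialError_le hN (summable_plainCoeff hs w)
      (summable_plainCoeff hs z) hwz κ) 2
  rw [gridNorm_eq, Real.sqrt_mul (by positivity), spatialConst, mul_assoc, mul_assoc]
  refine mul_le_mul_of_nonneg_left ?_ (Real.sqrt_nonneg _)
  refine (Real.sqrt_le_sqrt h1).trans_eq ?_
  have h2 : (8 : ℝ) ^ s * embeddingConst s ^ 2 * ((N : ℝ) ^ (-s)) ^ 2 * ‖z‖ ^ 2 =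
      8 ^ s * (embeddingConst s * ((N : ℝ) ^ (-s) * ‖z‖)) ^ 2 := by ring
  rw [h2, Real.sqrt_mul (by positivity), Real.sqrt_sq (by positivity)]
  ring

/-! ### Difference quotients of `C³` curves -/

/-- The difference estimates used by the scheme, for a curve `w` with derivative `w'`. -/
structure HasDifferenceBounds {E : Type*} [NormedAddCommGroup E] [NormedSpace ℝ E] (T B : ℝ)
    (w w' : ℝ → E) : Prop where
  deriv : ∀ t ∈ Set.Icc 0 T, HasDerivWithinAt w (w' t) (Set.Icc 0 T) t
  bound : ∀ t ∈ Set.Icc 0 T, ‖w t‖ ≤ B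
  bound_deriv : ∀ t ∈ Set.Icc 0 T, ‖w' t‖ ≤ B
  lip : ∀ t ∈ Set.Icc 0 T, ∀ r ∈ Set.Icc 0 T, ‖w r - w t‖ ≤ B * |r - t|
  lip_deriv : ∀ t ∈ Set.Icc 0 T, ∀ r ∈ Set.Icc 0 T, ‖w' r - w' t‖ ≤ B * |r - t|
  second : ∀ t τ, 0 ≤ τ → 0 ≤ t - τ → t + τ ≤ T →
    ‖w (t + τ) + w (t - τ) - (2 : ℝ) • w t‖ ≤ B * τ ^ 2
  trapezoid : ∀ t τ, 0 ≤ τ → 0 ≤ t - τ → t + τ ≤ T →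
    ‖w (t + τ) - w (t - τ) - τ • (w' (t + τ) + w' (t - τ))‖ ≤ B * τ ^ 3

section Curve

variable {E : Type*} [NormedAddCommGroup E] [NormedSpace ℝ E]

lemma norm_sub_le_of_deriv_bound {T B : ℝ} {w w' : ℝ → E}
    (hd : ∀ t ∈ Set.Icc 0 T, HasDerivWithinAt w (w' t) (Set.Icc 0 T) t)
    (hb : ∀ t ∈ Set.Icc 0 T, ‖w' t‖ ≤ B) {t r : ℝ} (ht : t ∈ Set.Icc 0 T) (hr : r ∈ Set.Icc 0 T) :
    ‖w r - w t‖ ≤ B * |r - t| :=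
  (convex_Icc 0 T).norm_image_sub_le_of_norm_hasDerivWithin_le hd hb ht hr

lemma hasDerivWithinAt_symm {T t τ r : ℝ} {w w' : ℝ → E} (ht : 0 ≤ t - τ) (ht' : t + τ ≤ T)
    (hr : r ∈ Set.Icc 0 τ) (hd : ∀ t ∈ Set.Icc 0 T, HasDerivWithinAt w (w' t) (Set.Icc 0 T) t) :
    HasDerivWithinAt (fun r => w (t + r)) (w' (t + r)) (Set.Icc 0 τ) r ∧
      HasDerivWithinAt (fun r => w (t - r)) (-w' (t - r)) (Set.Icc 0 τ) r := by
  have h0 := hr.1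
  have h1 := hr.2
  constructor
  · have h2 : HasDerivWithinAt (fun r : ℝ => t + r) 1 (Set.Icc 0 τ) r :=
      (hasDerivWithinAt_id r _).const_add t
    have h3 := (hd (t + r) ⟨by linarith, by linarith⟩).scomp r h2
      (fun x hx => ⟨by linarith [hx.1, hx.2], by linarith [hx.1, hx.2]⟩)
    rw [one_smul] at h3
    exact h3
  · have h2 : HasDerivWithinAt (fun r : ℝ => t - r) (-1) (Set.Icc 0 τ) r :=
      (hasDerivWithinAt_id r _).const_sub t
    have h3 := (hd (t - r) ⟨by linarith, by linarith⟩).scomp r h2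
      (fun x hx => ⟨by linarith [hx.1, hx.2], by linarith [hx.1, hx.2]⟩)
    rw [neg_one_smul] at h3
    exact h3

/-- The two symmetric estimates come from the mean value inequality on $[0,\tau]$ for functions of
the half-width $r$. For the trapezoidal error the derivative in $r$ collapses to
$-r(w''(t+r)-w''(t-r))$, of size $r^2$ since $w'''$ is bounded. -/
lemma exists_hasDifferenceBounds {T : ℝ} (hT : 0 < T) {w : ℝ → E}
    (hw : ContDiffOn ℝ 3 w (Set.Icc 0 T)) :
    ∃ w' B, 0 ≤ B ∧ HasDifferenceBounds T B w w' := by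
  have hu := uniqueDiffOn_Icc hT
  have hder : ∀ {v : ℝ → E} {n : ℕ}, ContDiffOn ℝ (n + 1 : ℕ) v (Set.Icc 0 T) →
      ContDiffOn ℝ n (derivWithin v (Set.Icc 0 T)) (Set.Icc 0 T) ∧
      ∀ t ∈ Set.Icc 0 T, HasDerivWithinAt v (derivWithin v (Set.Icc 0 T) t) (Set.Icc 0 T) t := by
    intro v n hv
    refine ⟨hv.derivWithin hu (by push_cast; rfl), fun t ht => ?_⟩
    exact (hv.differentiableOn (by simp) t ht).hasDerivWithinAt
  have hbdd : ∀ {v : ℝ → E} {n : ℕ}, ContDiffOn ℝ n v (Set.Icc 0 T) →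
      ∃ C, ∀ t ∈ Set.Icc 0 T, ‖v t‖ ≤ C := fun hv =>
    isCompact_Icc.exists_bound_of_continuousOn hv.continuousOn
  obtain ⟨h1, hd0⟩ := hder (n := 2) (by exact_mod_cast hw)
  obtain ⟨h2, hd1⟩ := hder (n := 1) h1
  obtain ⟨h3, hd2⟩ := hder (n := 0) h2
  obtain ⟨B0, hB0⟩ := hbdd (n := 3) (by exact_mod_cast hw)
  obtain ⟨B1, hB1⟩ := hbdd h1
  obtain ⟨B2, hB2⟩ := hbdd h2
  obtain ⟨B3, hB3⟩ := hbdd h3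
  set w1 := derivWithin w (Set.Icc 0 T)
  set w2 := derivWithin w1 (Set.Icc 0 T)
  set w3 := derivWithin w2 (Set.Icc 0 T)
  have h0T : (0 : ℝ) ∈ Set.Icc 0 T := ⟨le_rfl, hT.le⟩
  have p0 := (norm_nonneg _).trans (hB0 0 h0T)
  have p1 := (norm_nonneg _).trans (hB1 0 h0T)
  have p2 := (norm_nonneg _).trans (hB2 0 h0T)
  have p3 := (norm_nonneg _).trans (hB3 0 h0T)
  -- One constant that dominates what each of the six bounds needs.
  refine ⟨w1, B0 + B1 + 2 * B2 + 2 * B3, by positivity, hd0, fun t ht => ?_, fun t ht => ?_,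
    fun t ht r hr => ?_, fun t ht r hr => ?_, fun t τ hτ ht ht' => ?_, fun t τ hτ ht ht' => ?_⟩
  · linarith [hB0 t ht]
  · linarith [hB1 t ht]
  · refine (norm_sub_le_of_deriv_bound hd0 hB1 ht hr).trans ?_
    gcongr
    linarith
  · refine (norm_sub_le_of_deriv_bound hd1 hB2 ht hr).trans ?_
    gcongr
    linarith
  · have hφ : ∀ r ∈ Set.Icc 0 τ, HasDerivWithinAt (fun r => w (t + r) + w (t - r))
        (w1 (t + r) - w1 (t - r)) (Set.Icc 0 τ) r := by
      intro r hr
      obtain ⟨ha, hb⟩ := hasDerivWithinAt_symm ht ht' hr hd0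
      rw [sub_eq_add_neg]
      exact ha.add hb
    have hb : ∀ r ∈ Set.Icc 0 τ, ‖w1 (t + r) - w1 (t - r)‖ ≤ 2 * B2 * τ := by
      intro r hr
      have h0 := hr.1
      have h1 := hr.2
      refine (norm_sub_le_of_deriv_bound hd1 hB2 (t := t - r) (r := t + r)
        ⟨by linarith, by linarith⟩ ⟨by linarith, by linarith⟩).trans ?_
      rw [abs_of_nonneg (by linarith)]
      nlinarith
    have h4 := norm_sub_le_of_deriv_bound hφ hb (t := 0) (r := τ) ⟨le_rfl, hτ⟩ ⟨hτ, le_rfl⟩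
    simp only [add_zero, sub_zero, abs_of_nonneg hτ] at h4
    rw [two_smul]
    refine h4.trans ?_
    nlinarith [sq_nonneg τ]
  · have hφ : ∀ r ∈ Set.Icc 0 τ, HasDerivWithinAt
        (fun r => w (t + r) - w (t - r) - r • (w1 (t + r) + w1 (t - r)))
        (-(r • (w2 (t + r) - w2 (t - r)))) (Set.Icc 0 τ) r := by
      intro r hr
      obtain ⟨ha, hb⟩ := hasDerivWithinAt_symm ht ht' hr hd0
      obtain ⟨ha', hb'⟩ := hasDerivWithinAt_symm ht ht' hr hd1
      have h5 := (ha.sub hb).sub ((hasDerivWithinAt_id r (Set.Icc 0 τ)).smul (ha'.add hb'))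
      refine h5.congr_deriv ?_
      simp only [id, one_smul, Pi.add_apply]
      rw [← sub_eq_add_neg]
      abel
    have hb : ∀ r ∈ Set.Icc 0 τ, ‖-(r • (w2 (t + r) - w2 (t - r)))‖ ≤ 2 * B3 * τ ^ 2 := by
      intro r hr
      have h0 := hr.1
      have h1 := hr.2
      rw [norm_neg, norm_smul, Real.norm_of_nonneg h0]
      have h6 := norm_sub_le_of_deriv_bound hd2 hB3 (t := t - r) (r := t + r)
        ⟨by linarith, by linarith⟩ ⟨by linarith, by linarith⟩
      rw [abs_of_nonneg (by linarith)] at h6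
      have h7 : ‖w2 (t + r) - w2 (t - r)‖ ≤ 2 * B3 * τ := h6.trans (by nlinarith)
      calc r * ‖w2 (t + r) - w2 (t - r)‖ ≤ τ * (2 * B3 * τ) := by gcongr
        _ = _ := by ring
    have h4 := norm_sub_le_of_deriv_bound hφ hb (t := 0) (r := τ) ⟨le_rfl, hτ⟩ ⟨hτ, le_rfl⟩
    simp only [add_zero, sub_zero, sub_self, zero_smul, abs_of_nonneg hτ] at h4
    refine h4.trans ?_
    have : 0 ≤ τ ^ 3 := by positivity
    nlinarith

end Curve

/-! ### The solution as a curve of Fourier series -/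

/-- The solution as a curve of weighted Fourier coefficients: `w` represents `u`, `w'` represents
`u_t`, and `Δu` is represented by bounded elements of `H_p^s`. -/
structure IsSpectralSolution (β γ T s B : ℝ) (u : ℝ → EuclideanSpace ℝ (Fin 3) → ℂ)
    (w w' : ℝ → Coeffs) : Prop where
  nonneg : 0 ≤ B
  diff : HasDifferenceBounds T B w w'
  eq : ∀ t ∈ Set.Icc 0 T, ∀ x, u t x = fourierSeries s (w t) x
  lap : ∀ t ∈ Set.Icc 0 T, ∃ z : Coeffs, ‖z‖ ≤ B ∧
    (∀ k, plainCoeff s z k = -((∑ r, (k r : ℝ) ^ 2 : ℝ) : ℂ) * plainCoeff s (w t) k) ∧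
    (∀ x, Laplacian.laplacian (u t) x = fourierSeries s z x) ∧
    ∀ x, Complex.I * fourierSeries s (w' t) x + fourierSeries s z x +
      (β * Real.exp (-2 * γ * t) : ℝ) * ((‖u t x‖ ^ 2 : ℝ) : ℂ) * u t x = 0

lemma HasDifferenceBounds.mono {E : Type*} [NormedAddCommGroup E] [NormedSpace ℝ E] {T B C : ℝ}
    {w w' : ℝ → E} (h : HasDifferenceBounds T B w w') (hBC : B ≤ C) :
    HasDifferenceBounds T C w w' where
  deriv := h.deriv
  bound t ht := (h.bound t ht).trans hBC
  bound_deriv t ht := (h.bound_deriv t ht).trans hBC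
  lip t ht r hr := (h.lip t ht r hr).trans (by gcongr)
  lip_deriv t ht r hr := (h.lip_deriv t ht r hr).trans (by gcongr)
  second t τ hτ h1 h2 := (h.second t τ hτ h1 h2).trans (by gcongr)
  trapezoid t τ hτ h1 h2 := (h.trapezoid t τ hτ h1 h2).trans (by gcongr)

/-- The equation expresses $\Delta u$ through $u_t$ and the cubic term, both bounded in $H^s_p$ by
the algebra property. This supplies the two extra spatial derivatives on which the aliasing estimate
relies. -/
lemma exists_isSpectralSolution {β γ T s : ℝ} (hγ : 0 < γ) (hT : 0 < T) (hs : 3 / 2 < s)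
    {u : ℝ → EuclideanSpace ℝ (Fin 3) → ℂ} (hu : IsSobolevCurve 3 s T u)
    (hsol : IsSolution β γ T u) : ∃ w w' B, IsSpectralSolution β γ T s B u w w' := by
  obtain ⟨w, hw3, hwk⟩ := hu.contDiffOn
  obtain ⟨w', B, hB, hdiff⟩ := exists_hasDifferenceBounds hT (by exact_mod_cast hw3)
  obtain ⟨K, hK, hmul⟩ := exists_fourierSeries_mul hs
  have heq : ∀ t ∈ Set.Icc 0 T, ∀ x, u t x = fourierSeries s (w t) x := fun t ht x =>
    eq_fourierSeries hs (hu.continuous t ht) (hu.periodic t ht) (hwk t ht) x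
  -- `B` bounds $u_t$; the other term bounds $\beta|u|^2u$ after two uses of the algebra property.
  set C : ℝ := B + |β| * (K * (K * B * B) * B) with hC
  have hBC : B ≤ C := le_add_of_nonneg_right (by positivity)
  refine ⟨w, w', C, hB.trans hBC, hdiff.mono hBC, heq, fun t ht => ?_⟩
  obtain ⟨hcd, hpde⟩ := hsol t ht
  have hwB := hdiff.bound t ht
  obtain ⟨y, hy, hyx⟩ := exists_fourierSeries_conj s (w t)
  obtain ⟨y2, hy2, hy2x⟩ := hmul y (w t)
  obtain ⟨y3, hy3, hy3x⟩ := hmul y2 (w t)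
  set c : ℂ := -((β * Real.exp (-2 * γ * t) : ℝ) : ℂ) with hc
  set z : Coeffs := (-Complex.I) • w' t + c • y3 with hz
  -- Point evaluation is continuous on $H^s_p$, so the pointwise time derivative of the solution is
  -- the value of the derivative of the curve.
  have hderiv : ∀ x v, HasDerivWithinAt (fun r => u r x) v (Set.Icc 0 T) t →
      v = fourierSeries s (w' t) x := by
    intro x v hv
    have h1 : HasDerivWithinAt (fun r => fourierSeries s (w r) x) (fourierSeries s (w' t) x)
        (Set.Icc 0 T) t :=
      (pointEval hs x).hasFDerivAt.comp_hasDerivWithinAt t (hdiff.deriv t ht)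
    have h2 : HasDerivWithinAt (fun r => u r x) (fourierSeries s (w' t) x) (Set.Icc 0 T) t :=
      h1.congr (fun r hr => heq r hr x) (heq t ht x)
    exact (uniqueDiffOn_Icc hT t ht).eq_deriv _ hv h2
  have hcube : ∀ x, fourierSeries s y3 x = ((‖u t x‖ ^ 2 : ℝ) : ℂ) * u t x := by
    intro x
    rw [hy3x, hy2x, hyx, ← heq t ht x, ← Complex.normSq_eq_norm_sq, ← Complex.mul_conj,
      starRingEnd_apply, mul_comm (u t x) (star _)]
  have hzx : ∀ x, fourierSeries s z x = -Complex.I * fourierSeries s (w' t) x +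
      c * (((‖u t x‖ ^ 2 : ℝ) : ℂ) * u t x) := by
    intro x
    rw [hz, fourierSeries_add hs, fourierSeries_smul, fourierSeries_smul, hcube]
  have hlap : ∀ x, Laplacian.laplacian (u t) x = fourierSeries s z x := by
    intro x
    obtain ⟨v, hv, hvx⟩ := hpde x
    rw [hderiv x v hv] at hvx
    rw [hzx, hc]
    linear_combination hvx
  refine ⟨z, ?_, plainCoeff_of_laplacian hs hcd (hu.periodic t ht) (heq t ht) hlap, hlap,
    fun x => ?_⟩
  · have hc1 : ‖c‖ ≤ |β| := by
      rw [hc, norm_neg, Complex.norm_real, Real.norm_eq_abs, abs_mul, Real.abs_exp]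
      refine mul_le_of_le_one_right (abs_nonneg _) (Real.exp_le_one_iff.2 ?_)
      nlinarith [ht.1, mul_nonneg hγ.le ht.1]
    refine (norm_add_le _ _).trans ?_
    rw [norm_smul, norm_smul, norm_neg, Complex.norm_I, one_mul, hC]
    have hy2' : ‖y2‖ ≤ K * B * B := hy2.trans (by gcongr; exact hy.trans hwB)
    have hy3' : ‖y3‖ ≤ K * (K * B * B) * B := hy3.trans (by gcongr)
    have := hdiff.bound_deriv t ht
    gcongr
  · rw [hzx, hc]
    ring

/-! ### Consistency of the scheme -/

section Grid

variable {N : ℕ} [NeZero N]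

/-- First-order perturbation bounds in the discrete Wiener algebra. -/
structure LipBound (τ A : ℝ) (a a' : GridFun N) : Prop where
  nonneg : 0 ≤ A
  bound : wienerNorm a ≤ A
  lip : wienerNorm (a' - a) ≤ A * τ

/-- Bounds on a symmetric pair of perturbations, up to the second difference. -/
structure SymmBound (τ A : ℝ) (a a₁ a₂ : GridFun N) : Prop where
  fst : LipBound τ A a a₁
  snd : LipBound τ A a a₂
  second : wienerNorm (a₁ + a₂ - (2 : ℂ) • a) ≤ A * τ ^ 2

lemma wienerNorm_mul_le {A B : ℝ} {U V : GridFun N} (hU : wienerNorm U ≤ A)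
    (hV : wienerNorm V ≤ B) : wienerNorm (U * V) ≤ A * B :=
  (isWienerModuleNorm_wienerNorm.mul U V).trans
    (mul_le_mul hU hV (wienerNorm_nonneg V) ((wienerNorm_nonneg U).trans hU))

lemma wienerNorm_add_le {A B : ℝ} {U V : GridFun N} (hU : wienerNorm U ≤ A)
    (hV : wienerNorm V ≤ B) : wienerNorm (U + V) ≤ A + B :=
  (isWienerModuleNorm_wienerNorm.add_le U V).trans (add_le_add hU hV)

lemma wienerNorm_sub_le {A B : ℝ} {U V : GridFun N} (hU : wienerNorm U ≤ A)
    (hV : wienerNorm V ≤ B) : wienerNorm (U - V) ≤ A + B :=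
  (isWienerModuleNorm_wienerNorm.sub_le U V).trans (add_le_add hU hV)

lemma wienerNorm_smul_le {A : ℝ} {U : GridFun N} (c : ℂ) (hU : wienerNorm U ≤ A) :
    wienerNorm (c • U) ≤ ‖c‖ * A :=
  (isWienerModuleNorm_wienerNorm.smul_le c U).trans
    (mul_le_mul_of_nonneg_left hU (norm_nonneg c))

lemma LipBound.mul {τ A B : ℝ} (hτ : 0 ≤ τ) (hτ1 : τ ≤ 1) {a a' b b' : GridFun N}
    (ha : LipBound τ A a a') (hb : LipBound τ B b b') :
    LipBound τ (4 * (A * B)) (a * b) (a' * b') := by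
  have hA := ha.nonneg
  have hB := hb.nonneg
  have hAB : 0 ≤ A * B := mul_nonneg hA hB
  refine ⟨by positivity, (wienerNorm_mul_le ha.bound hb.bound).trans (by linarith), ?_⟩
  have h1 : a' * b' - a * b = (a' - a) * (b' - b) + (a * (b' - b) + (a' - a) * b) := by ring
  rw [h1]
  refine (wienerNorm_add_le (wienerNorm_mul_le ha.lip hb.lip)
    (wienerNorm_add_le (wienerNorm_mul_le ha.bound hb.lip)
      (wienerNorm_mul_le ha.lip hb.bound))).trans ?_
  have h2 : A * τ * (B * τ) ≤ A * B * τ := by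
    have : A * B * τ * τ ≤ A * B * τ * 1 := by gcongr
    linarith
  nlinarith [mul_nonneg hAB hτ]

/-- A discrete Leibniz rule: the second difference of a product consists of the second differences
of the factors and of products of two first differences, each $O(\tau^2)$. This handles $e^{-2\gamma
t}|u|^2$ without differentiating it. -/
lemma SymmBound.mul {τ A B : ℝ} (hτ : 0 ≤ τ) (hτ1 : τ ≤ 1) {a a₁ a₂ b b₁ b₂ : GridFun N}
    (ha : SymmBound τ A a a₁ a₂) (hb : SymmBound τ B b b₁ b₂) :
    SymmBound τ (4 * (A * B)) (a * b) (a₁ * b₁) (a₂ * b₂) := by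
  refine ⟨ha.fst.mul hτ hτ1 hb.fst, ha.snd.mul hτ hτ1 hb.snd, ?_⟩
  have h1 : a₁ * b₁ + a₂ * b₂ - (2 : ℂ) • (a * b) =
      (a * (b₁ + b₂ - (2 : ℂ) • b) + (a₁ + a₂ - (2 : ℂ) • a) * b) +
        ((a₁ - a) * (b₁ - b) + (a₂ - a) * (b₂ - b)) := by
    simp only [two_smul]
    ring
  rw [h1]
  refine (wienerNorm_add_le (wienerNorm_add_le (wienerNorm_mul_le ha.fst.bound hb.second)
    (wienerNorm_mul_le ha.second hb.fst.bound)) (wienerNorm_add_le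
    (wienerNorm_mul_le ha.fst.lip hb.fst.lip)
      (wienerNorm_mul_le ha.snd.lip hb.snd.lip))).trans_eq ?_
  ring

lemma LipBound.star {τ A : ℝ} {a a' : GridFun N} (ha : LipBound τ A a a') :
    LipBound τ A (star a) (star a') := by
  refine ⟨ha.nonneg, ?_, ?_⟩
  · rw [isWienerModuleNorm_wienerNorm.star]
    exact ha.bound
  · rw [← star_sub, isWienerModuleNorm_wienerNorm.star]
    exact ha.lip

lemma SymmBound.star {τ A : ℝ} {a a₁ a₂ : GridFun N} (ha : SymmBound τ A a a₁ a₂) :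
    SymmBound τ A (star a) (star a₁) (star a₂) := by
  refine ⟨ha.fst.star, ha.snd.star, ?_⟩
  have : Star.star a₁ + Star.star a₂ - (2 : ℂ) • Star.star a =
      Star.star (a₁ + a₂ - (2 : ℂ) • a) := by
    simp only [star_sub, star_add, star_smul, star_ofNat]
  rw [this, isWienerModuleNorm_wienerNorm.star]
  exact ha.second

lemma wienerNorm_one : wienerNorm (1 : GridFun N) = 1 := by
  rw [← gridChar_zero, wienerNorm_gridChar]

lemma wienerNorm_const_le (c : ℝ) : wienerNorm ((c : ℂ) • (1 : GridFun N)) ≤ ‖c‖ := by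
  have := wienerNorm_smul_le (c : ℂ) (wienerNorm_one (N := N)).le
  rwa [Complex.norm_real, mul_one] at this

end Grid

/-- Restriction to the grid of the function with given weighted Fourier coefficients. -/
def gridEval {s : ℝ} (hs : 3 / 2 < s) (N : ℕ) : Coeffs →ₗ[ℝ] GridFun N :=
  LinearMap.pi fun j => (pointEval hs (gridPoint N j)).toLinearMap

lemma gridEval_eq {s : ℝ} (hs : 3 / 2 < s) (N : ℕ) (w : Coeffs) :
    gridEval hs N w = gridSeries N (plainCoeff s w) := rfl

lemma gridEval_apply {s : ℝ} (hs : 3 / 2 < s) (N : ℕ) (w : Coeffs) (j : Fin 3 → Fin N) :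
    gridEval hs N w j = fourierSeries s w (gridPoint N j) := rfl

section Grid

variable {N : ℕ} [NeZero N] {s : ℝ} (hs : 3 / 2 < s)

lemma wienerNorm_gridEval_le {A : ℝ} {w : Coeffs} (hw : ‖w‖ ≤ A) :
    wienerNorm (gridEval hs N w) ≤ embeddingConst s * A := by
  rw [gridEval_eq]
  refine ((wienerNorm_gridSeries_le (summable_plainCoeff hs w)).trans
    (tsum_norm_plainCoeff_le hs w)).trans ?_
  exact mul_le_mul_of_nonneg_left hw (embeddingConst_nonneg s)

lemma HasDifferenceBounds.lipBound_gridEval {T B : ℝ} (hB : 0 ≤ B) {w w' : ℝ → Coeffs}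
    (h : HasDifferenceBounds T B w w') {t r : ℝ} (ht : t ∈ Set.Icc 0 T) (hr : r ∈ Set.Icc 0 T) :
    LipBound |r - t| (embeddingConst s * B) (gridEval hs N (w t)) (gridEval hs N (w r)) := by
  refine ⟨mul_nonneg (embeddingConst_nonneg s) hB, wienerNorm_gridEval_le hs (h.bound t ht), ?_⟩
  rw [← map_sub, mul_assoc]
  exact wienerNorm_gridEval_le hs (h.lip t ht r hr)

lemma HasDifferenceBounds.symmBound_gridEval {T B : ℝ} (hB : 0 ≤ B) {w w' : ℝ → Coeffs}
    (h : HasDifferenceBounds T B w w') {t τ : ℝ} (hτ : 0 ≤ τ) (ht : 0 ≤ t - τ) (ht' : t + τ ≤ T) :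
    SymmBound τ (embeddingConst s * B) (gridEval hs N (w t)) (gridEval hs N (w (t + τ)))
      (gridEval hs N (w (t - τ))) := by
  have h0 : t ∈ Set.Icc 0 T := ⟨by linarith, by linarith⟩
  refine ⟨?_, ?_, ?_⟩
  · have := h.lipBound_gridEval (N := N) hs hB h0 (r := t + τ) ⟨by linarith, ht'⟩
    rwa [add_sub_cancel_left, abs_of_nonneg hτ] at this
  · have := h.lipBound_gridEval (N := N) hs hB h0 (r := t - τ) ⟨ht, by linarith⟩
    rwa [sub_sub_cancel_left, abs_neg, abs_of_nonneg hτ] at this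
  · have h1 := wienerNorm_gridEval_le (N := N) hs (h.second t τ hτ ht ht')
    rw [map_sub, map_add, map_smul] at h1
    have h2 : (2 : ℂ) • gridEval hs N (w t) = (2 : ℝ) • gridEval hs N (w t) := by
      rw [two_smul, two_smul]
    rw [h2, mul_assoc]
    exact h1

lemma HasDifferenceBounds.lipBound_const {T B : ℝ} (hB : 0 ≤ B) {f f' : ℝ → ℝ}
    (h : HasDifferenceBounds T B f f') {t r : ℝ} (ht : t ∈ Set.Icc 0 T) (hr : r ∈ Set.Icc 0 T) :
    LipBound |r - t| B ((f t : ℂ) • (1 : GridFun N)) ((f r : ℂ) • (1 : GridFun N)) := by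
  refine ⟨hB, (wienerNorm_const_le _).trans (h.bound t ht), ?_⟩
  rw [← sub_smul, ← Complex.ofReal_sub]
  exact (wienerNorm_const_le _).trans (h.lip t ht r hr)

lemma HasDifferenceBounds.symmBound_const {T B : ℝ} (hB : 0 ≤ B) {f f' : ℝ → ℝ}
    (h : HasDifferenceBounds T B f f') {t τ : ℝ} (hτ : 0 ≤ τ) (ht : 0 ≤ t - τ) (ht' : t + τ ≤ T) :
    SymmBound τ B ((f t : ℂ) • (1 : GridFun N)) ((f (t + τ) : ℂ) • (1 : GridFun N))
      ((f (t - τ) : ℂ) • (1 : GridFun N)) := by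
  have h0 : t ∈ Set.Icc 0 T := ⟨by linarith, by linarith⟩
  refine ⟨?_, ?_, ?_⟩
  · have := h.lipBound_const (N := N) hB h0 (r := t + τ) ⟨by linarith, ht'⟩
    rwa [add_sub_cancel_left, abs_of_nonneg hτ] at this
  · have := h.lipBound_const (N := N) hB h0 (r := t - τ) ⟨ht, by linarith⟩
    rwa [sub_sub_cancel_left, abs_neg, abs_of_nonneg hτ] at this
  · have h1 := (wienerNorm_const_le (N := N) _).trans (h.second t τ hτ ht ht')
    have h2 : ((f (t + τ) : ℂ) • (1 : GridFun N)) + (f (t - τ) : ℂ) • (1 : GridFun N) -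
        (2 : ℂ) • (f t : ℂ) • (1 : GridFun N) =
        ((f (t + τ) + f (t - τ) - (2 : ℝ) • f t : ℝ) : ℂ) • (1 : GridFun N) := by
      rw [smul_eq_mul]
      push_cast
      rw [sub_smul, add_smul, mul_smul]
    rw [h2]
    exact h1

end Grid

lemma exists_hasDifferenceBounds_exp {T : ℝ} (hT : 0 < T) (γ : ℝ) :
    ∃ f' B, 0 ≤ B ∧ HasDifferenceBounds T B (fun t => Real.exp (-2 * γ * t)) f' :=
  exists_hasDifferenceBounds hT (by fun_prop)

/-- The grid form of the equation, with the spectral Laplacian replaced by the pseudo-spectral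
one. -/
lemma IsSpectralSolution.exists_grid_eq {β γ T s B : ℝ}
    {u : ℝ → EuclideanSpace ℝ (Fin 3) → ℂ} {w w' : ℝ → Coeffs}
    (h : IsSpectralSolution β γ T s B u w w') (hs : 3 / 2 < s) {N : ℕ} [NeZero N] (hN : Even N)
    {t : ℝ} (ht : t ∈ Set.Icc 0 T) :
    ∃ η : GridFun N, gridNorm N η ≤ spatialConst s * (N : ℝ) ^ (-s) * B ∧
      discreteLaplacian N (gridEval hs N (w t)) = η - Complex.I • gridEval hs N (w' t) -
        (β : ℂ) • (((Real.exp (-2 * γ * t) : ℝ) : ℂ) • (1 : GridFun N) *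
          (star (gridEval hs N (w t)) * gridEval hs N (w t)) * gridEval hs N (w t)) := by
  obtain ⟨z, hz, hzw, _, hpde⟩ := h.lap t ht
  refine ⟨discreteLaplacian N (gridEval hs N (w t)) - gridEval hs N z, ?_, ?_⟩
  · refine (gridNorm_spatialError_le hN hs (w t) z hzw).trans ?_
    refine mul_le_mul_of_nonneg_left hz (mul_nonneg (spatialConst_nonneg s) ?_)
    positivity
  · funext j
    have h1 := hpde (gridPoint N j)
    rw [h.eq t ht] at h1
    simp only [Pi.sub_apply, Pi.smul_apply, Pi.mul_apply, Pi.star_apply, Pi.one_apply,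
      smul_eq_mul, gridEval_apply]
    have h2 : star (fourierSeries s (w t) (gridPoint N j)) * fourierSeries s (w t) (gridPoint N j)
        = ((‖fourierSeries s (w t) (gridPoint N j)‖ ^ 2 : ℝ) : ℂ) := by
      rw [mul_comm, ← starRingEnd_apply, Complex.mul_conj, Complex.normSq_eq_norm_sq]
    rw [h2]
    push_cast at h1 ⊢
    linear_combination h1

lemma star_mul_self_apply {N : ℕ} (U : GridFun N) (j : Fin 3 → Fin N) :
    ((‖U j‖ ^ 2 : ℝ) : ℂ) = (star U * U) j := by
  rw [Pi.mul_apply, Pi.star_apply, mul_comm, ← starRingEnd_apply, Complex.mul_conj,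
    Complex.normSq_eq_norm_sq]

/-- Consistency of the three-level scheme. -/
lemma IsSpectralSolution.consistency_step {β γ T s B : ℝ} (hT : 0 < T)
    {u : ℝ → EuclideanSpace ℝ (Fin 3) → ℂ} {w w' : ℝ → Coeffs}
    (h : IsSpectralSolution β γ T s B u w w') (hs : 3 / 2 < s) :
    ∃ K, 0 ≤ K ∧ ∀ (N : ℕ) [NeZero N], Even N → ∀ t τ : ℝ, 0 < τ → τ ≤ 1 → 0 ≤ t - τ →
      t + τ ≤ T → ∃ ζ η : GridFun N, wienerNorm ζ ≤ K * τ ^ 2 ∧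
        gridNorm N η ≤ K * (N : ℝ) ^ (-s) ∧
        (Complex.I / ((2 * τ : ℝ) : ℂ)) •
            (gridEval hs N (w (t + τ)) - gridEval hs N (w (t - τ))) +
          discreteLaplacian N ((1 / 2 : ℂ) •
            (gridEval hs N (w (t + τ)) + gridEval hs N (w (t - τ)))) +
          ((β * Real.exp (-2 * γ * t) : ℝ) : ℂ) •
            (star (gridEval hs N (w t)) * gridEval hs N (w t) * ((1 / 2 : ℂ) •
            (gridEval hs N (w (t + τ)) + gridEval hs N (w (t - τ))))) = ζ + η := by
  obtain ⟨f', Be, hBe, hexp⟩ := exists_hasDifferenceBounds_exp hT γ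
  set C := embeddingConst s with hC
  have hC0 : 0 ≤ C := embeddingConst_nonneg s
  have hB := h.nonneg
  have hS := spatialConst_nonneg s
  set A := C * B with hA
  have hA0 : 0 ≤ A := mul_nonneg hC0 hB
  set AG := 4 * (Be * (4 * (A * A))) with hAG
  have hAG0 : 0 ≤ AG := by positivity
  refine ⟨A + |β| * (2 * AG * A) + spatialConst s * B, by positivity,
    fun N _ hN t τ hτ hτ1 ht ht' => ?_⟩
  have h1 : t + τ ∈ Set.Icc 0 T := ⟨by linarith, ht'⟩
  have h2 : t - τ ∈ Set.Icc 0 T := ⟨ht, by linarith⟩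
  obtain ⟨η₁, hη₁, he₁⟩ := h.exists_grid_eq hs hN h1
  obtain ⟨η₂, hη₂, he₂⟩ := h.exists_grid_eq hs hN h2
  have hsu := h.diff.symmBound_gridEval (N := N) hs hB hτ.le ht ht'
  have hse := hexp.symmBound_const (N := N) hBe hτ.le ht ht'
  have hG := hse.mul hτ.le hτ1 (hsu.star.mul hτ.le hτ1 hsu)
  have htrap := wienerNorm_gridEval_le (N := N) hs (h.diff.trapezoid t τ hτ.le ht ht')
  simp only [map_sub, map_add, map_smul] at htrap
  set u₀ := gridEval hs N (w t)
  set u₁ := gridEval hs N (w (t + τ))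
  set u₂ := gridEval hs N (w (t - τ))
  set d₁ := gridEval hs N (w' (t + τ))
  set d₂ := gridEval hs N (w' (t - τ))
  set G₀ := ((Real.exp (-2 * γ * t) : ℝ) : ℂ) • (1 : GridFun N) * (star u₀ * u₀) with hG₀
  set G₁ := ((Real.exp (-2 * γ * (t + τ)) : ℝ) : ℂ) • (1 : GridFun N) * (star u₁ * u₁) with hG₁
  set G₂ := ((Real.exp (-2 * γ * (t - τ)) : ℝ) : ℂ) • (1 : GridFun N) * (star u₂ * u₂) with hG₂
  have hτc : (τ : ℂ) ≠ 0 := by exact_mod_cast hτ.ne'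
  -- The equation at $t\pm\tau$ replaces the two Laplacians. What remains in time is the trapezoidal
  -- error and $\tfrac\beta2\bigl(G_0(u_1+u_2)-G_1u_1-G_2u_2\bigr)$. The latter is rewritten as a
  -- product of first differences minus the second difference of $G$ times $u_1$.
  refine ⟨(Complex.I / ((2 * τ : ℝ) : ℂ)) • (u₁ - u₂ - τ • (d₁ + d₂)) +
    (β / 2 : ℂ) • ((G₀ - G₂) * (u₂ - u₁) - (G₁ + G₂ - (2 : ℂ) • G₀) * u₁),
    (1 / 2 : ℂ) • (η₁ + η₂), ?_, ?_, ?_⟩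
  · have hu₁ : wienerNorm u₁ ≤ A + A * 1 := by
      have : u₁ = u₀ + (u₁ - u₀) := by abel
      rw [this]
      exact wienerNorm_add_le hsu.fst.bound (hsu.fst.lip.trans (by gcongr))
    have hu₂₁ : wienerNorm (u₂ - u₁) ≤ A * τ + A * τ := by
      have : u₂ - u₁ = (u₂ - u₀) - (u₁ - u₀) := by abel
      rw [this]
      exact wienerNorm_sub_le hsu.snd.lip hsu.fst.lip
    have hG₂₀ : wienerNorm (G₀ - G₂) ≤ AG * τ := by
      have : G₀ - G₂ = (0 : GridFun N) - (G₂ - G₀) := by abel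
      rw [this]
      have := wienerNorm_sub_le (isWienerModuleNorm_wienerNorm (N := N)).zero.le hG.snd.lip
      rwa [zero_add] at this
    refine (wienerNorm_add_le (wienerNorm_smul_le _ htrap) (wienerNorm_smul_le _
      (wienerNorm_sub_le (wienerNorm_mul_le hG₂₀ hu₂₁) (wienerNorm_mul_le hG.second hu₁)))).trans ?_
    have hn1 : ‖Complex.I / ((2 * τ : ℝ) : ℂ)‖ = 1 / (2 * τ) := by
      rw [norm_div, Complex.norm_I, Complex.norm_real, Real.norm_of_nonneg (by positivity)]
    have hn2 : ‖(β / 2 : ℂ)‖ = |β| / 2 := by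
      rw [norm_div, Complex.norm_real, Real.norm_eq_abs]
      norm_num
    rw [hn1, hn2]
    have h3 : 1 / (2 * τ) * (C * (B * τ ^ 3)) = A * τ ^ 2 / 2 := by
      rw [hA]
      field_simp
    rw [h3]
    have h4 : 0 ≤ spatialConst s * B * τ ^ 2 := by positivity
    have h5 : 0 ≤ A * τ ^ 2 := by positivity
    refine le_of_sub_nonneg ?_
    have : (A + |β| * (2 * AG * A) + spatialConst s * B) * τ ^ 2 -
        (A * τ ^ 2 / 2 + |β| / 2 * (AG * τ * (A * τ + A * τ) + AG * τ ^ 2 * (A + A * 1))) =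
        A * τ ^ 2 / 2 + spatialConst s * B * τ ^ 2 := by ring
    rw [this]
    linarith
  · refine (isWienerModuleNorm_gridNorm.smul_le _ _).trans ?_
    have h3 := (isWienerModuleNorm_gridNorm.add_le η₁ η₂).trans (add_le_add hη₁ hη₂)
    have h4 : ‖(1 / 2 : ℂ)‖ = 1 / 2 := by norm_num
    rw [h4]
    have h5 : 0 ≤ (A + |β| * (2 * AG * A)) * (N : ℝ) ^ (-s) := by positivity
    linarith
  · rw [discreteLaplacian_smul, discreteLaplacian_add, he₁, he₂]
    funext j
    simp only [hG₀, hG₁, hG₂, Pi.add_apply, Pi.sub_apply, Pi.smul_apply, Pi.mul_apply,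
      Pi.one_apply, smul_eq_mul, Complex.real_smul]
    push_cast
    field_simp
    ring

/-- Consistency of the first step. -/
lemma IsSpectralSolution.consistency_first {β γ T s B : ℝ} (hT : 0 < T)
    {u : ℝ → EuclideanSpace ℝ (Fin 3) → ℂ} {w w' : ℝ → Coeffs}
    (h : IsSpectralSolution β γ T s B u w w') (hs : 3 / 2 < s) :
    ∃ K, 0 ≤ K ∧ ∀ (N : ℕ) [NeZero N], Even N → ∀ τ : ℝ, 0 < τ → τ ≤ 1 → τ ≤ T →
      ∃ ζ η : GridFun N, wienerNorm ζ ≤ K * τ ∧ gridNorm N η ≤ K * (N : ℝ) ^ (-s) ∧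
        (Complex.I / (τ : ℂ)) • (gridEval hs N (w τ) - gridEval hs N (w 0)) +
          discreteLaplacian N ((1 / 2 : ℂ) • (gridEval hs N (w τ) + gridEval hs N (w 0))) +
          ((β * Real.exp (-2 * γ * (τ / 2)) : ℝ) : ℂ) •
            (star (gridEval hs N (w 0) + ((τ / 2 : ℝ) : ℂ) • gridEval hs N (w' 0)) *
              (gridEval hs N (w 0) + ((τ / 2 : ℝ) : ℂ) • gridEval hs N (w' 0)) *
              ((1 / 2 : ℂ) • (gridEval hs N (w τ) + gridEval hs N (w 0)))) = ζ + η := by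
  obtain ⟨f', Be, hBe, hexp⟩ := exists_hasDifferenceBounds_exp hT γ
  set C := embeddingConst s with hC
  have hC0 : 0 ≤ C := embeddingConst_nonneg s
  have hB := h.nonneg
  have hS := spatialConst_nonneg s
  set A := C * B with hA
  have hA0 : 0 ≤ A := mul_nonneg hC0 hB
  set AG := 4 * (4 * (Be * (4 * (A * A))) * A) with hAG
  have hAG0 : 0 ≤ AG := by positivity
  refine ⟨2 * A + |β| * (2 * AG) + spatialConst s * B, by positivity,
    fun N _ hN τ hτ hτ1 hτT => ?_⟩
  have h0 : (0 : ℝ) ∈ Set.Icc 0 T := ⟨le_rfl, hT.le⟩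
  have h1 : τ ∈ Set.Icc 0 T := ⟨hτ.le, hτT⟩
  have hh : τ / 2 ∈ Set.Icc 0 T := ⟨by linarith, by linarith⟩
  obtain ⟨η₁, hη₁, he₁⟩ := h.exists_grid_eq hs hN h1
  obtain ⟨η₀, hη₀, he₀⟩ := h.exists_grid_eq hs hN h0
  have hlu := h.diff.lipBound_gridEval (N := N) hs hB h0 h1
  rw [sub_zero, abs_of_pos hτ] at hlu
  have hle := hexp.lipBound_const (N := N) hBe h0 h1
  rw [sub_zero, abs_of_pos hτ] at hle
  have hleh : LipBound τ Be (((Real.exp (-2 * γ * 0) : ℝ) : ℂ) • (1 : GridFun N))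
      (((Real.exp (-2 * γ * (τ / 2)) : ℝ) : ℂ) • (1 : GridFun N)) := by
    have := hexp.lipBound_const (N := N) hBe h0 hh
    rw [sub_zero, abs_of_pos (by linarith)] at this
    exact ⟨this.nonneg, this.bound, this.lip.trans (by gcongr; linarith)⟩
  have hd₀ := wienerNorm_gridEval_le (N := N) hs (h.diff.bound_deriv 0 h0)
  have hd₁ := wienerNorm_gridEval_le (N := N) hs (h.diff.lip_deriv 0 h0 τ h1)
  rw [sub_zero, abs_of_pos hτ, map_sub] at hd₁
  set u₀ := gridEval hs N (w 0)
  set u₁ := gridEval hs N (w τ)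
  set d₀ := gridEval hs N (w' 0)
  set d₁ := gridEval hs N (w' τ)
  set S := u₀ + ((τ / 2 : ℝ) : ℂ) • d₀ with hSdef
  have hlS : LipBound τ A u₀ S := by
    refine ⟨hA0, hlu.bound, ?_⟩
    rw [hSdef, add_sub_cancel_left]
    refine (wienerNorm_smul_le _ hd₀).trans ?_
    rw [Complex.norm_real, Real.norm_of_nonneg (by positivity)]
    nlinarith [mul_nonneg hA0 hτ.le]
  have hl0 : LipBound τ A u₀ u₀ := by
    refine ⟨hA0, hlu.bound, ?_⟩
    rw [sub_self, isWienerModuleNorm_wienerNorm.zero]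
    positivity
  have hle0 : LipBound τ Be (((Real.exp (-2 * γ * 0) : ℝ) : ℂ) • (1 : GridFun N))
      (((Real.exp (-2 * γ * 0) : ℝ) : ℂ) • (1 : GridFun N)) := by
    refine ⟨hBe, hle.bound, ?_⟩
    rw [sub_self, isWienerModuleNorm_wienerNorm.zero]
    positivity
  have hP₀ := ((hleh.mul hτ.le hτ1 (hlS.star.mul hτ.le hτ1 hlS)).mul hτ.le hτ1 hl0).lip
  have hP₁ := ((hleh.mul hτ.le hτ1 (hlS.star.mul hτ.le hτ1 hlS)).mul hτ.le hτ1 hlu).lip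
  have hQ₁ := ((hle.mul hτ.le hτ1 (hlu.star.mul hτ.le hτ1 hlu)).mul hτ.le hτ1 hlu).lip
  set E₀ := ((Real.exp (-2 * γ * 0) : ℝ) : ℂ) • (1 : GridFun N) with hE₀
  set E₁ := ((Real.exp (-2 * γ * τ) : ℝ) : ℂ) • (1 : GridFun N) with hE₁
  set Eh := ((Real.exp (-2 * γ * (τ / 2)) : ℝ) : ℂ) • (1 : GridFun N) with hEh
  set Q₀ := E₀ * (star u₀ * u₀) * u₀ with hQ₀def
  set Q₁ := E₁ * (star u₁ * u₁) * u₁ with hQ₁def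
  set P₀ := Eh * (star S * S) * u₀ with hP₀def
  set P₁ := Eh * (star S * S) * u₁ with hP₁def
  have hτc : (τ : ℂ) ≠ 0 := by exact_mod_cast hτ.ne'
  -- Mean value inequality for $r\mapsto w(r)-r\,w'(0)$, whose derivative is at most $B\tau$ on
  -- $[0,\tau]$.
  have hfirst : wienerNorm (u₁ - u₀ - τ • d₀) ≤ C * (B * τ * τ) := by
    have h3 := norm_sub_le_of_deriv_bound (T := τ) (B := B * τ) (w := fun r => w r - r • w' 0)
      (w' := fun r => w' r - w' 0)
      (fun r hr => by
        have h4 := (h.diff.deriv r ⟨hr.1, hr.2.trans hτT⟩).mono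
          (Set.Icc_subset_Icc_right hτT)
        have h5 := h4.sub ((hasDerivWithinAt_id r (Set.Icc 0 τ)).smul_const (w' 0))
        rw [one_smul] at h5
        exact h5)
      (fun r hr => by
        refine (h.diff.lip_deriv 0 h0 r ⟨hr.1, hr.2.trans hτT⟩).trans ?_
        rw [sub_zero, abs_of_nonneg hr.1]
        exact mul_le_mul_of_nonneg_left hr.2 hB)
      (t := 0) (r := τ) ⟨le_rfl, hτ.le⟩ ⟨hτ.le, le_rfl⟩
    simp only [zero_smul, sub_zero, abs_of_pos hτ] at h3
    have h6 := wienerNorm_gridEval_le (N := N) hs h3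
    simp only [map_sub, map_smul] at h6
    rwa [sub_right_comm] at h6
  -- All terms are compared with their values at time $0$. A residual of order $\tau$ is enough
  -- here, since it enters the error only once, multiplied by $\tau$.
  refine ⟨(Complex.I / (τ : ℂ)) • (u₁ - u₀ - τ • d₀) - (Complex.I / 2) • (d₁ - d₀) +
    (β / 2 : ℂ) • ((P₀ - Q₀) + (P₁ - Q₀) - (Q₁ - Q₀)),
    (1 / 2 : ℂ) • (η₁ + η₀), ?_, ?_, ?_⟩
  · refine (wienerNorm_add_le (wienerNorm_sub_le (wienerNorm_smul_le _ hfirst)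
      (wienerNorm_smul_le _ hd₁)) (wienerNorm_smul_le _
      (wienerNorm_sub_le (wienerNorm_add_le hP₀ hP₁) hQ₁))).trans ?_
    have hn1 : ‖Complex.I / (τ : ℂ)‖ = 1 / τ := by
      rw [norm_div, Complex.norm_I, Complex.norm_real, Real.norm_of_nonneg hτ.le]
    have hn2 : ‖(β / 2 : ℂ)‖ = |β| / 2 := by
      rw [norm_div, Complex.norm_real, Real.norm_eq_abs]
      norm_num
    have hn3 : ‖Complex.I / 2‖ = 1 / 2 := by
      rw [norm_div, Complex.norm_I]
      norm_num
    rw [hn1, hn2, hn3]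
    have h3 : 1 / τ * (C * (B * τ * τ)) = A * τ := by
      rw [hA]
      field_simp
    rw [h3]
    refine le_of_sub_nonneg ?_
    have : (2 * A + |β| * (2 * AG) + spatialConst s * B) * τ -
        (A * τ + 1 / 2 * (C * (B * τ)) + |β| / 2 * (AG * τ + AG * τ + AG * τ)) =
        A * τ / 2 + |β| * AG * τ / 2 + spatialConst s * B * τ := by
      rw [hA]
      ring
    rw [this]
    positivity
  · refine (isWienerModuleNorm_gridNorm.smul_le _ _).trans ?_
    have h3 := (isWienerModuleNorm_gridNorm.add_le η₁ η₀).trans (add_le_add hη₁ hη₀)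
    have h4 : ‖(1 / 2 : ℂ)‖ = 1 / 2 := by norm_num
    rw [h4]
    have h5 : 0 ≤ (2 * A + |β| * (2 * AG)) * (N : ℝ) ^ (-s) := by positivity
    linarith
  · rw [discreteLaplacian_smul, discreteLaplacian_add, he₁, he₀]
    funext j
    simp only [hP₀def, hP₁def, hQ₀def, hQ₁def, hE₀, hE₁, hEh, Pi.add_apply, Pi.sub_apply,
      Pi.smul_apply, Pi.mul_apply, Pi.one_apply, smul_eq_mul, Complex.real_smul]
    push_cast
    field_simp
    ring

/-! ### Stability and convergence -/

section Grid

variable {N : ℕ} [NeZero N]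

/-- Error propagation in one linearly implicit Crank-Nicolson step. -/
lemma IsWienerModuleNorm.error_step {p : GridFun N → ℝ} (hp : IsWienerModuleNorm p) (hN : Even N)
    {σ K b c : ℝ} (hσ : 0 < σ) (hc : |c| ≤ b) {v v₁ v₀ V V₁ V₀ ξ : GridFun N}
    (hv : wienerNorm v ≤ K) (hv₁ : wienerNorm v₁ ≤ K) (hv₀ : wienerNorm v₀ ≤ K)
    (hV : wienerNorm V ≤ K)
    (hexact : (Complex.I / (σ : ℂ)) • (v₁ - v₀) + discreteLaplacian N ((1 / 2 : ℂ) • (v₁ + v₀)) +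
      (c : ℂ) • (Star.star v * v * ((1 / 2 : ℂ) • (v₁ + v₀))) = ξ)
    (hnum : ∀ j, Complex.I * ((V₁ j - V₀ j) / (σ : ℂ)) +
      discreteLaplacian N (fun i => (V₁ i + V₀ i) / 2) j +
      (c : ℂ) * ((‖V j‖ ^ 2 : ℝ) : ℂ) * ((V₁ j + V₀ j) / 2) = 0) :
    p (v₁ - V₁) ≤ p (v₀ - V₀) + σ * (2 * b * K ^ 2 * (p (v₁ - V₁) + p (v₀ - V₀) + p (v - V)) + p ξ) := by
  have hK : 0 ≤ K := (wienerNorm_nonneg v).trans hv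
  set e := v - V with he
  set e₁ := v₁ - V₁ with he₁
  set e₀ := v₀ - V₀ with he₀
  set a := (1 / 2 : ℂ) • (v₁ + v₀) with ha
  have hhalf : ∀ x y : GridFun N, (fun i => (x i + y i) / 2) = (1 / 2 : ℂ) • (x + y) := by
    intro x y
    funext i
    simp only [Pi.smul_apply, Pi.add_apply, smul_eq_mul]
    ring
  -- Splitting of $|v|^2a-|V|^2A$, with $A$ the average of $V_1$ and $V_0$, by $|v|^2-|V|^2=\bar v
  -- e+V\bar e$. Every term is linear in the errors, and the other factors are bounded in the Wiener
  -- algebra.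
  set F : GridFun N := (c : ℂ) • (Star.star V * V * ((1 / 2 : ℂ) • (e₁ + e₀)) +
    (Star.star v * a * e + V * a * Star.star e)) - ξ with hF
  have hstep : ∀ j, Complex.I * ((e₁ j - e₀ j) / (σ : ℂ)) +
      discreteLaplacian N (fun i => (e₁ i + e₀ i) / 2) j + F j = 0 := by
    intro j
    have h1 := congrFun hexact j
    have h2 := hnum j
    rw [hhalf] at h2 ⊢
    have h3 : (1 / 2 : ℂ) • (e₁ + e₀) = a + (-1 : ℂ) • ((1 / 2 : ℂ) • (V₁ + V₀)) := by
      funext i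
      simp only [he₁, he₀, ha, Pi.smul_apply, Pi.add_apply, Pi.sub_apply, smul_eq_mul]
      ring
    rw [star_mul_self_apply] at h2
    rw [hF, h3, discreteLaplacian_add, discreteLaplacian_smul (-1 : ℂ)]
    simp only [he, he₁, he₀, ha, Pi.smul_apply, Pi.add_apply, Pi.sub_apply, Pi.mul_apply,
      Pi.star_apply, smul_eq_mul, star_sub] at h1 h2 ⊢
    linear_combination h1 - h2
  have h4 := hp.le_of_crankNicolson hN hσ e₁ e₀ F hstep
  have hsc : ∀ (x : ℂ) (y : GridFun N) (B : ℝ), p y ≤ B → p (x • y) ≤ ‖x‖ * B := fun x y B hy =>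
    (hp.smul_le x y).trans (mul_le_mul_of_nonneg_left hy (norm_nonneg x))
  have hmul : ∀ (x y : GridFun N) (A B : ℝ), wienerNorm x ≤ A → p y ≤ B → p (x * y) ≤ A * B :=
    fun x y A B hx hy => (hp.mul x y).trans
      (mul_le_mul hx hy (hp.nonneg y) ((wienerNorm_nonneg x).trans hx))
  have hn : ‖(1 / 2 : ℂ)‖ = 1 / 2 := by norm_num
  have haK : wienerNorm a ≤ K := by
    have := wienerNorm_smul_le (1 / 2 : ℂ) (wienerNorm_add_le hv₁ hv₀)
    rw [hn] at this
    linarith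
  have hstarV : wienerNorm (Star.star V) ≤ K := by rwa [isWienerModuleNorm_wienerNorm.star]
  have hstarv : wienerNorm (Star.star v) ≤ K := by rwa [isWienerModuleNorm_wienerNorm.star]
  have h5 : p (Star.star V * V * ((1 / 2 : ℂ) • (e₁ + e₀))) ≤ K * K * (1 / 2 * (p e₁ + p e₀)) := by
    refine hmul _ _ _ _ (wienerNorm_mul_le hstarV hV) ?_
    have := hsc (1 / 2) _ _ (hp.add_le e₁ e₀)
    rwa [hn] at this
  have h6 : p (Star.star v * a * e) ≤ K * K * p e := hmul _ _ _ _ (wienerNorm_mul_le hstarv haK) le_rfl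
  have h7 : p (V * a * Star.star e) ≤ K * K * p e :=
    hmul _ _ _ _ (wienerNorm_mul_le hV haK) (hp.star e).le
  have h8 : p F ≤ 2 * b * K ^ 2 * (p e₁ + p e₀ + p e) + p ξ := by
    refine (hp.sub_le _ _).trans (add_le_add_left ?_ _)
    have h9 := hsc (c : ℂ) _ _ ((hp.add_le _ _).trans (add_le_add h5
      ((hp.add_le _ _).trans (add_le_add h6 h7))))
    rw [Complex.norm_real, Real.norm_eq_abs] at h9
    refine h9.trans ?_
    have h10 := hp.nonneg e₁
    have h11 := hp.nonneg e₀
    have h12 := hp.nonneg e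
    have hb : 0 ≤ b := (abs_nonneg c).trans hc
    calc |c| * (K * K * (1 / 2 * (p e₁ + p e₀)) + (K * K * p e + K * K * p e))
        ≤ b * (K * K * (2 * (p e₁ + p e₀)) + (K * K * p e + K * K * p e)) := by
          gcongr
          norm_num
      _ = _ := by ring
  exact h4.trans (by gcongr)

end Grid

/-- Discrete Gronwall inequality for the three-level recursion. -/
lemma three_level_gronwall {a : ℕ → ℝ} {M : ℕ} {τ L X Y : ℝ} (P : ℕ → Prop) (ha : ∀ n, 0 ≤ a n)
    (h0 : a 0 = 0) (hτ : 0 ≤ τ) (hL : 0 ≤ L) (hX : 0 ≤ X) (hτL : 4 * (τ * L) ≤ 1)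
    (hY : Real.exp (12 * L * (M * τ)) * (a 1 + 4 * (M * τ) * X) ≤ Y)
    (hP : ∀ n ≤ M, a n ≤ Y → P n)
    (hrec : ∀ n, 1 ≤ n → n + 1 ≤ M → P n →
      a (n + 1) ≤ a (n - 1) + 2 * τ * (L * (a (n + 1) + a (n - 1) + a n) + X)) :
    ∀ n ≤ M, a n ≤ Y := by
  set b : ℕ → ℝ := fun n => Real.exp (12 * L * (n * τ)) * (a 1 + 4 * (n * τ) * X) with hb
  have ha1 := ha 1
  have hbmono : ∀ {m n : ℕ}, m ≤ n → b m ≤ b n := by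
    intro m n hmn
    have h1 : (m : ℝ) * τ ≤ n * τ := by
      have : (m : ℝ) ≤ n := by exact_mod_cast hmn
      gcongr
    have h2 : (0 : ℝ) ≤ m * τ := by positivity
    simp only [hb]
    gcongr
  have hbM : ∀ n ≤ M, b n ≤ Y := fun n hn => (hbmono hn).trans hY
  -- The recursion reaches back two levels, so both `a n` and `a (n - 1)` are carried. At `n = 0`
  -- the truncated index gives `a 0` again.
  have main : ∀ n, n ≤ M → a n ≤ b n ∧ a (n - 1) ≤ b n := by
    intro n
    induction n with
    | zero =>
      intro _
      simp [hb, h0, ha1]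
    | succ n ih =>
      intro hn
      obtain ⟨ih1, ih2⟩ := ih (by omega)
      refine ⟨?_, by simpa using ih1.trans (hbmono n.le_succ)⟩
      rcases Nat.eq_zero_or_pos n with rfl | hn1
      · have h1 : (1 : ℝ) ≤ Real.exp (12 * L * ((0 + 1 : ℕ) * τ)) :=
          Real.one_le_exp (by positivity)
        have h2 : a 1 ≤ a 1 + 4 * ((0 + 1 : ℕ) * τ) * X := le_add_of_nonneg_right (by positivity)
        calc a (0 + 1) = 1 * a 1 := by simp
          _ ≤ _ := by
            simp only [hb]
            exact mul_le_mul h1 h2 ha1 (by positivity)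
      · have hPn := hP n (by omega) (ih1.trans (hbM n (by omega)))
        have h3 := hrec n hn1 hn hPn
        have hb0 : 0 ≤ b n := (ha n).trans ih1
        have hx : 0 ≤ τ * L := mul_nonneg hτ hL
        -- The implicit term is absorbed. With $x=\tau L\le1/4$ one has $(1-2x)(1+12x)\ge1+4x$ and
        -- $4(1-2x)\ge2$, which explains the constants 12 and 4.
        have h4 : a (n + 1) ≤ (1 + 12 * (τ * L)) * b n + 4 * τ * X := by
          have h5 : (1 - 2 * (τ * L)) * a (n + 1) ≤ (1 + 4 * (τ * L)) * b n + 2 * τ * X := by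
            nlinarith [mul_nonneg hx hb0]
          have h6 : (1 + 4 * (τ * L)) * b n + 2 * τ * X ≤
              (1 - 2 * (τ * L)) * ((1 + 12 * (τ * L)) * b n + 4 * τ * X) := by
            have h7 : 0 ≤ (τ * L) * b n * (1 - 4 * (τ * L)) :=
              mul_nonneg (mul_nonneg hx hb0) (by linarith)
            have h8 : 0 ≤ τ * X * (1 - 4 * (τ * L)) := mul_nonneg (mul_nonneg hτ hX) (by linarith)
            nlinarith
          exact le_of_mul_le_mul_left (h5.trans h6) (by linarith)
        refine h4.trans ?_
        have h9 : 1 + 12 * (τ * L) ≤ Real.exp (12 * L * τ) := by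
          have := Real.add_one_le_exp (12 * L * τ)
          linarith
        have h10 : Real.exp (12 * L * ((n + 1 : ℕ) * τ)) =
            Real.exp (12 * L * τ) * Real.exp (12 * L * (n * τ)) := by
          rw [← Real.exp_add]
          congr 1
          push_cast
          ring
        have h11 : (1 : ℝ) ≤ Real.exp (12 * L * ((n + 1 : ℕ) * τ)) :=
          Real.one_le_exp (by positivity)
        calc (1 + 12 * (τ * L)) * b n + 4 * τ * X
            ≤ Real.exp (12 * L * τ) * b n +
              Real.exp (12 * L * ((n + 1 : ℕ) * τ)) * (4 * τ * X) := by
              refine add_le_add (mul_le_mul_of_nonneg_right h9 hb0) ?_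
              exact le_mul_of_one_le_left (by positivity) h11
          _ = b (n + 1) := by
              simp only [hb]
              rw [h10]
              push_cast
              ring
  exact fun n hn => (main n hn).1.trans (hbM n hn)

/-- The error equations of the scheme: consistency errors along the exact solution `v`. -/
structure IsConsistent (β γ τ K δ : ℝ) (N M : ℕ) [NeZero N] (p : GridFun N → ℝ)
    (v : ℕ → GridFun N) (S : GridFun N) : Prop where
  bound : ∀ n ≤ M, wienerNorm (v n) ≤ K
  bound_start : wienerNorm S ≤ K
  first : ∃ ξ, p ξ * τ ≤ δ ∧
    (Complex.I / (τ : ℂ)) • (v 1 - v 0) + discreteLaplacian N ((1 / 2 : ℂ) • (v 1 + v 0)) +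
      ((β * Real.exp (-2 * γ * (τ / 2)) : ℝ) : ℂ) •
        (star S * S * ((1 / 2 : ℂ) • (v 1 + v 0))) = ξ
  step : ∀ n : ℕ, 1 ≤ n → n + 1 ≤ M → ∃ ξ, p ξ ≤ δ ∧
    (Complex.I / ((2 * τ : ℝ) : ℂ)) • (v (n + 1) - v (n - 1)) +
      discreteLaplacian N ((1 / 2 : ℂ) • (v (n + 1) + v (n - 1))) +
      ((β * Real.exp (-2 * γ * (n * τ)) : ℝ) : ℂ) •
        (star (v n) * v n * ((1 / 2 : ℂ) • (v (n + 1) + v (n - 1)))) = ξ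

lemma abs_mul_exp_le {β γ t : ℝ} (hγ : 0 < γ) (ht : 0 ≤ t) : |β * Real.exp (-2 * γ * t)| ≤ |β| := by
  rw [abs_mul, Real.abs_exp]
  refine mul_le_of_le_one_right (abs_nonneg _) (Real.exp_le_one_iff.2 ?_)
  nlinarith [mul_nonneg hγ.le ht]

/-- Convergence in a module norm, as long as the numerical solution stays bounded in the discrete
Wiener algebra. -/
lemma IsConsistent.convergence {β γ T K δ Y : ℝ} (hγ : 0 < γ) (hT : 0 < T) {N M : ℕ} [NeZero N]
    (hN : Even N) (hM : 0 < M) {u₀ : EuclideanSpace ℝ (Fin 3) → ℂ} {p : GridFun N → ℝ}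
    (hp : IsWienerModuleNorm p) {v U : ℕ → GridFun N}
    (hv : IsConsistent β γ (T / M) K δ N M p v (startValue β (T / M) N u₀))
    (hU : IsLICFP β γ T u₀ M N U) (h0 : v 0 = U 0)
    (hτK : 4 * (T / M * (2 * |β| * (K + 1) ^ 2)) ≤ 1) (hδ : 0 ≤ δ)
    (hY : Real.exp (12 * (2 * |β| * (K + 1) ^ 2) * T) * ((2 + 4 * T) * δ) ≤ Y)
    (hb : ∀ n ≤ M, p (v n - U n) ≤ Y → wienerNorm (v n - U n) ≤ 1) :
    ∀ n ≤ M, p (v n - U n) ≤ Y := by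
  set τ := T / M with hτdef
  have hM' : (0 : ℝ) < M := by exact_mod_cast hM
  have hτ : 0 < τ := div_pos hT hM'
  have hMτ : M * τ = T := by rw [hτdef]; field_simp
  set L := 2 * |β| * (K + 1) ^ 2 with hLdef
  have hL : 0 ≤ L := by positivity
  have hK1 : ∀ n ≤ M, wienerNorm (v n) ≤ K + 1 := fun n hn => (hv.bound n hn).trans (by linarith)
  have ha0 : p (v 0 - U 0) = 0 := by rw [h0, sub_self, hp.zero]
  have ha1 : p (v 1 - U 1) ≤ 2 * δ := by
    obtain ⟨ξ, hξ, heq⟩ := hv.first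
    have hS : wienerNorm (startValue β τ N u₀) ≤ K + 1 := hv.bound_start.trans (by linarith)
    -- The start value is computed from the exact initial datum, so it serves as both coefficients
    -- and its error vanishes. With $\tau L\le1/4$ the factor 2 is ample.
    have h1 := hp.error_step hN hτ (abs_mul_exp_le (β := β) hγ (by positivity : 0 ≤ τ / 2))
      hS (hK1 1 hM) (hK1 0 (Nat.zero_le M)) hS heq hU.first
    rw [ha0, sub_self, hp.zero, ← hLdef] at h1
    have h2 := hp.nonneg (v 1 - U 1)
    nlinarith
  refine three_level_gronwall (a := fun n => p (v n - U n)) (τ := τ) (L := L) (X := δ)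
    (fun n => wienerNorm (v n - U n) ≤ 1) (fun n => hp.nonneg _) ha0 hτ.le hL hδ hτK ?_ hb ?_
  · rw [hMτ]
    refine le_trans (mul_le_mul_of_nonneg_left ?_ (Real.exp_pos _).le) hY
    linarith
  · intro n hn hnM hPn
    obtain ⟨ξ, hξ, heq⟩ := hv.step n hn hnM
    -- Only here is the a priori bound on the numerical solution used; it costs the `+ 1` in `K +
    -- 1`.
    have hUn : wienerNorm (U n) ≤ K + 1 := by
      have : U n = v n - (v n - U n) := by abel
      rw [this]
      exact wienerNorm_sub_le (hv.bound n (by omega)) hPn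
    have h1 := hp.error_step hN (by positivity : 0 < 2 * τ)
      (abs_mul_exp_le (β := β) hγ (by positivity : 0 ≤ (n : ℝ) * τ))
      (hK1 n (by omega)) (hK1 (n + 1) hnM) (hK1 (n - 1) (by omega)) hUn heq (hU.step n hn hnM)
    refine h1.trans ?_
    gcongr

/-- The exact solution is consistent with the scheme, in the discrete Wiener algebra and in the
discrete `L²` norm. -/
lemma IsSpectralSolution.exists_isConsistent {β γ T s B : ℝ} (hT : 0 < T)
    {u : ℝ → EuclideanSpace ℝ (Fin 3) → ℂ} {w w' : ℝ → Coeffs}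
    (h : IsSpectralSolution β γ T s B u w w') (hs : 3 / 2 < s) :
    ∃ K D, 0 ≤ K ∧ 0 ≤ D ∧ ∀ (M N : ℕ) [NeZero N], 0 < M → Even N → T / M ≤ 1 →
      IsConsistent β γ (T / M) K (D * ((N : ℝ) ^ (-s) + (T / M) ^ 2)) N M (gridNorm N)
        (fun n => gridEval hs N (w (n * (T / M)))) (startValue β (T / M) N (u 0)) ∧
      IsConsistent β γ (T / M) K (D * ((N : ℝ) ^ (3 / 2 - s) + (T / M) ^ 2)) N M wienerNorm
        (fun n => gridEval hs N (w (n * (T / M)))) (startValue β (T / M) N (u 0)) := by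
  obtain ⟨K₁, hK₁, hstep⟩ := h.consistency_step hT hs
  obtain ⟨K₀, hK₀, hfirst⟩ := h.consistency_first hT hs
  have hB := h.nonneg
  have hC := embeddingConst_nonneg s
  set R := Real.sqrt ((2 * Real.pi) ^ 3) with hR
  have hR0 : 0 ≤ R := Real.sqrt_nonneg _
  set Q := K₁ + K₀ with hQ
  have hQ0 : 0 ≤ Q := by positivity
  refine ⟨2 * (embeddingConst s * B), (R + 1) * Q, by positivity, by positivity,
    fun M N _ hM hN hτ1 => ?_⟩
  have hM' : (0 : ℝ) < M := by exact_mod_cast hM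
  set τ := T / M with hτdef
  have hτ : 0 < τ := div_pos hT hM'
  have hMτ : M * τ = T := by rw [hτdef]; field_simp
  have htn : ∀ n : ℕ, n ≤ M → (n : ℝ) * τ ∈ Set.Icc 0 T := by
    intro n hn
    have : (n : ℝ) ≤ M := by exact_mod_cast hn
    exact ⟨by positivity, by rw [← hMτ]; gcongr⟩
  have hτT : τ ≤ T := by
    have := (htn 1 hM).2
    simpa using this
  have h0 : (0 : ℝ) ∈ Set.Icc 0 T := ⟨le_rfl, hT.le⟩
  -- By the equation at $t=0$, $i(\Delta u+\beta|u|^2u)=u_t$, so the start value is the Taylor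
  -- polynomial of degree one at $\tau/2$.
  have hS : startValue β τ N (u 0) =
      gridEval hs N (w 0) + ((τ / 2 : ℝ) : ℂ) • gridEval hs N (w' 0) := by
    funext j
    obtain ⟨z, _, _, hzl, hpde⟩ := h.lap 0 h0
    have h1 := hpde (gridPoint N j)
    simp only [startValue, Pi.add_apply, Pi.smul_apply, smul_eq_mul, gridEval_apply, hzl,
      ← h.eq 0 h0]
    rw [mul_zero, Real.exp_zero, mul_one] at h1
    linear_combination (Complex.I * ((τ / 2 : ℝ) : ℂ)) * h1 -
      ((τ / 2 : ℝ) : ℂ) * fourierSeries s (w' 0) (gridPoint N j) * Complex.I_mul_I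
  have hbound : ∀ n ≤ M, wienerNorm (gridEval hs N (w (n * τ))) ≤ 2 * (embeddingConst s * B) := by
    intro n hn
    refine (wienerNorm_gridEval_le hs (h.diff.bound _ (htn n hn))).trans ?_
    have : 0 ≤ embeddingConst s * B := by positivity
    linarith
  have hboundS : wienerNorm (startValue β τ N (u 0)) ≤ 2 * (embeddingConst s * B) := by
    rw [hS]
    refine (wienerNorm_add_le (wienerNorm_gridEval_le hs (h.diff.bound 0 h0))
      (wienerNorm_smul_le _ (wienerNorm_gridEval_le hs (h.diff.bound_deriv 0 h0)))).trans ?_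
    rw [Complex.norm_real, Real.norm_of_nonneg (by positivity)]
    have : 0 ≤ embeddingConst s * B := by positivity
    nlinarith
  obtain ⟨ζ, η, hζ, hη, heq⟩ := hfirst N hN τ hτ hτ1 hτT
  have hfirst' : (Complex.I / (τ : ℂ)) •
      (gridEval hs N (w ((1 : ℕ) * τ)) - gridEval hs N (w ((0 : ℕ) * τ))) +
      discreteLaplacian N ((1 / 2 : ℂ) •
        (gridEval hs N (w ((1 : ℕ) * τ)) + gridEval hs N (w ((0 : ℕ) * τ)))) +
      ((β * Real.exp (-2 * γ * (τ / 2)) : ℝ) : ℂ) •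
        (star (startValue β τ N (u 0)) * startValue β τ N (u 0) * ((1 / 2 : ℂ) •
          (gridEval hs N (w ((1 : ℕ) * τ)) + gridEval hs N (w ((0 : ℕ) * τ))))) = ζ + η := by
    rw [hS, Nat.cast_one, one_mul, Nat.cast_zero, zero_mul]
    exact heq
  have hstep' : ∀ n : ℕ, 1 ≤ n → n + 1 ≤ M → ∃ ζ η : GridFun N, wienerNorm ζ ≤ K₁ * τ ^ 2 ∧
      gridNorm N η ≤ K₁ * (N : ℝ) ^ (-s) ∧
      (Complex.I / ((2 * τ : ℝ) : ℂ)) •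
        (gridEval hs N (w ((n + 1 : ℕ) * τ)) - gridEval hs N (w ((n - 1 : ℕ) * τ))) +
      discreteLaplacian N ((1 / 2 : ℂ) •
        (gridEval hs N (w ((n + 1 : ℕ) * τ)) + gridEval hs N (w ((n - 1 : ℕ) * τ)))) +
      ((β * Real.exp (-2 * γ * (n * τ)) : ℝ) : ℂ) •
        (star (gridEval hs N (w (n * τ))) * gridEval hs N (w (n * τ)) * ((1 / 2 : ℂ) •
        (gridEval hs N (w ((n + 1 : ℕ) * τ)) + gridEval hs N (w ((n - 1 : ℕ) * τ))))) = ζ + η := by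
    intro n hn hnM
    have h1 : ((n + 1 : ℕ) : ℝ) * τ = n * τ + τ := by push_cast; ring
    have h2 : ((n - 1 : ℕ) : ℝ) * τ = n * τ - τ := by
      rw [Nat.cast_sub hn]; push_cast; ring
    have h3 := (htn (n + 1) hnM).2
    have h4 := (htn (n - 1) (by omega)).1
    rw [h1] at h3 ⊢
    rw [h2] at h4 ⊢
    exact hstep N hN _ τ hτ hτ1 h4 h3
  have hN0 : (0 : ℝ) < N := by exact_mod_cast NeZero.pos N
  have hNs : 0 ≤ (N : ℝ) ^ (-s) := by positivity
  have hNs' : 0 ≤ (N : ℝ) ^ (3 / 2 - s) := by positivity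
  have hgrid : ∀ (ζ η : GridFun N) (a b : ℝ), wienerNorm ζ ≤ a → gridNorm N η ≤ b →
      gridNorm N (ζ + η) ≤ R * a + b := fun ζ η a b hζ hη =>
    (isWienerModuleNorm_gridNorm.add_le ζ η).trans (add_le_add
      ((gridNorm_le_wienerNorm ζ).trans (mul_le_mul_of_nonneg_left hζ hR0)) hη)
  -- Only the aliasing part `η` passes through the inverse inequality and loses $N^{3/2}$. The
  -- temporal part `ζ` is already estimated in the Wiener norm.
  have hwien : ∀ (ζ η : GridFun N) (a b : ℝ), wienerNorm ζ ≤ a → gridNorm N η ≤ b * (N : ℝ) ^ (-s) →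
      wienerNorm (ζ + η) ≤ a + b * (N : ℝ) ^ (3 / 2 - s) := by
    intro ζ η a b hζ hη
    refine wienerNorm_add_le hζ ((wienerNorm_le_gridNorm η).trans ?_)
    rw [sub_eq_add_neg, Real.rpow_add hN0, mul_left_comm b]
    gcongr
  have e1 : 0 ≤ R * K₀ * τ ^ 2 := by positivity
  have e2 : 0 ≤ R * K₁ * τ ^ 2 := by positivity
  have e3 : 0 ≤ K₀ * τ ^ 2 := by positivity
  have e4 : 0 ≤ K₁ * τ ^ 2 := by positivity
  have aux : ∀ X : ℝ, 0 ≤ X → K₁ * X + K₁ * τ ^ 2 ≤ (R + 1) * Q * (X + τ ^ 2) ∧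
      (R * (K₀ * τ) + K₀ * X) * τ ≤ (R + 1) * Q * (X + τ ^ 2) ∧
      (K₀ * τ + K₀ * X) * τ ≤ (R + 1) * Q * (X + τ ^ 2) ∧
      R * (K₁ * τ ^ 2) + K₁ * X ≤ (R + 1) * Q * (X + τ ^ 2) := by
    intro X hX
    have f1 : 0 ≤ R * K₀ * X := by positivity
    have f2 : 0 ≤ R * K₁ * X := by positivity
    have f3 : 0 ≤ K₀ * X := by positivity
    have f4 : 0 ≤ K₁ * X := by positivity
    have f5 : K₀ * X * τ ≤ K₀ * X := mul_le_of_le_one_right f3 hτ1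
    have f6 : (R + 1) * Q * (X + τ ^ 2) = R * K₀ * X + R * K₁ * X + K₀ * X + K₁ * X +
        R * K₀ * τ ^ 2 + R * K₁ * τ ^ 2 + K₀ * τ ^ 2 + K₁ * τ ^ 2 := by
      rw [hQ]; ring
    rw [f6]
    refine ⟨?_, ?_, ?_, ?_⟩ <;> nlinarith
  refine ⟨⟨hbound, hboundS, ⟨ζ + η, ?_, hfirst'⟩, fun n hn hnM => ?_⟩,
    ⟨hbound, hboundS, ⟨ζ + η, ?_, hfirst'⟩, fun n hn hnM => ?_⟩⟩
  · exact (mul_le_mul_of_nonneg_right (hgrid ζ η _ _ hζ hη) hτ.le).trans (aux _ hNs).2.1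
  · obtain ⟨ζ', η', hζ', hη', heq'⟩ := hstep' n hn hnM
    exact ⟨ζ' + η', (hgrid ζ' η' _ _ hζ' hη').trans (aux _ hNs).2.2.2, heq'⟩
  · exact (mul_le_mul_of_nonneg_right (hwien ζ η _ _ hζ hη) hτ.le).trans (aux _ hNs').2.2.1
  · obtain ⟨ζ', η', hζ', hη', heq'⟩ := hstep' n hn hnM
    refine ⟨ζ' + η', (hwien ζ' η' _ _ hζ' hη').trans ?_, heq'⟩
    rw [add_comm]
    exact (aux _ hNs').1

lemma gridNorm_smul {N : ℕ} (c : ℂ) (U : GridFun N) : gridNorm N (c • U) = ‖c‖ * gridNorm N U := by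
  simp only [gridNorm, Pi.smul_apply, smul_eq_mul, norm_mul, mul_pow]
  rw [← Finset.mul_sum, mul_left_comm, Real.sqrt_mul (sq_nonneg _), Real.sqrt_sq (norm_nonneg c)]

/-- A mesh size below which `N^{-a}` is small. -/
lemma exists_meshSize_bound {a ε : ℝ} (ha : 0 < a) (hε : 0 < ε) :
    ∃ h₀ : ℝ, 0 < h₀ ∧ ∀ N : ℕ, 0 < N → meshSize N ≤ h₀ → (N : ℝ) ^ (-a) ≤ ε := by
  refine ⟨ε ^ a⁻¹, by positivity, fun N hN hh => ?_⟩
  have hN' : (0 : ℝ) < N := by exact_mod_cast hN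
  have h1 : (N : ℝ)⁻¹ ≤ ε ^ a⁻¹ := by
    refine le_trans ?_ hh
    rw [meshSize, div_eq_mul_inv]
    refine le_mul_of_one_le_left (by positivity) ?_
    linarith [Real.pi_gt_three]
  rw [Real.rpow_neg hN'.le, ← Real.inv_rpow hN'.le]
  refine (Real.rpow_le_rpow (by positivity) h1 ha.le).trans_eq ?_
  rw [← Real.rpow_mul hε.le, inv_mul_cancel₀ ha.ne', Real.rpow_one]

end LICFP

end

/-! ### The convergence theorem -/

theorem theorem4p1 (β γ T s : ℝ) (hγ : 0 < γ) (hT : 0 < T) (hs : 3 / 2 < s)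
    (u ψ : ℝ → EuclideanSpace ℝ (Fin 3) → ℂ)
    (hu : LICFP.IsSobolevCurve 3 s T u)
    (hsol : LICFP.IsSolution β γ T u)
    (hψ : ∀ t ∈ Set.Icc 0 T, ∀ x, ψ t x = (Real.exp (-γ * t) : ℂ) * u t x) :
    ∃ s₀ : ℝ, 0 < s₀ ∧ ∃ C₀ : ℝ, 0 < C₀ ∧
      ∀ M N : ℕ, 0 < M → 0 < N → Even N →
        T / M ≤ s₀ → LICFP.meshSize N ≤ s₀ →
        ∀ U Ψ : ℕ → LICFP.GridFun N, LICFP.IsLICFP β γ T (u 0) M N U →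
          (∀ n j, Ψ n j = (Real.exp (-γ * (n * (T / M))) : ℂ) * U n j) →
          ∀ n : ℕ, 1 ≤ n → n ≤ M →
            LICFP.gridNorm N
                (fun j => u (n * (T / M)) (LICFP.gridPoint N j) - U n j)
              ≤ C₀ * ((N : ℝ) ^ (-s) + (T / M) ^ 2) ∧
            LICFP.gridNorm N
                (fun j => ψ (n * (T / M)) (LICFP.gridPoint N j) - Ψ n j)
              ≤ C₀ * Real.exp (-γ * (n * (T / M))) * ((N : ℝ) ^ (-s) + (T / M) ^ 2) := by
  obtain ⟨w, w', B, hw⟩ := LICFP.exists_isSpectralSolution hγ hT hs hu hsol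
  obtain ⟨K, D, hK, hD, hcons⟩ := hw.exists_isConsistent hT hs
  set L : ℝ := 2 * |β| * (K + 1) ^ 2 with hLdef
  have hL : 0 ≤ L := by positivity
  -- The Gronwall constant of the error bound; the added 1 makes it positive.
  set C : ℝ := Real.exp (12 * L * T) * ((2 + 4 * T) * D) + 1 with hCdef
  have hC : 0 < C := by positivity
  obtain ⟨h₀, hh₀, hmesh⟩ := LICFP.exists_meshSize_bound (a := s - 3 / 2) (ε := 1 / (2 * C))
    (by linarith) (by positivity)
  -- The four thresholds ensure, in turn, consistency, absorption of the implicit term in Gronwall,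
  -- and a contribution of at most $1/2$ to the Wiener error from time and from space separately.
  refine ⟨min (min 1 (1 / (4 * (L + 1)))) (min (1 / (2 * C)) h₀), by positivity, C, hC,
    fun M N hM hN hNe hτs hhs U Ψ hU hΨ => ?_⟩
  have : NeZero N := ⟨hN.ne'⟩
  have hM' : (0 : ℝ) < M := by exact_mod_cast hM
  set τ := T / M with hτdef
  have hτ : 0 < τ := div_pos hT hM'
  have hMτ : M * τ = T := by rw [hτdef]; field_simp
  have hτ1 : τ ≤ 1 := hτs.trans ((min_le_left _ _).trans (min_le_left _ _))
  have hτL : τ ≤ 1 / (4 * (L + 1)) := hτs.trans ((min_le_left _ _).trans (min_le_right _ _))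
  have hτC : τ ≤ 1 / (2 * C) := hτs.trans ((min_le_right _ _).trans (min_le_left _ _))
  have hNC : (N : ℝ) ^ (3 / 2 - s) ≤ 1 / (2 * C) := by
    have := hmesh N hN (hhs.trans ((min_le_right _ _).trans (min_le_right _ _)))
    rwa [neg_sub] at this
  have hτL' : 4 * (τ * L) ≤ 1 := by
    rw [le_div_iff₀ (by positivity)] at hτL
    nlinarith
  obtain ⟨hc2, hcA⟩ := hcons M N hM hNe hτ1
  have h0T : (0 : ℝ) ∈ Set.Icc 0 T := ⟨le_rfl, hT.le⟩
  have hinit : LICFP.gridEval hs N (w ((0 : ℕ) * (T / M))) = U 0 := by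
    funext j
    rw [Nat.cast_zero, zero_mul, LICFP.gridEval_apply, ← hw.eq 0 h0T, hU.init j]
  have hexpC : ∀ X : ℝ, 0 ≤ X → Real.exp (12 * L * T) * ((2 + 4 * T) * (D * X)) ≤ C * X := by
    intro X hX
    rw [hCdef]
    linarith
  have hX2 : 0 ≤ (N : ℝ) ^ (-s) + τ ^ 2 := by positivity
  have hXA : 0 ≤ (N : ℝ) ^ (3 / 2 - s) + τ ^ 2 := by positivity
  have hsmall : C * ((N : ℝ) ^ (3 / 2 - s) + τ ^ 2) ≤ 1 := by
    have h1 : τ ^ 2 ≤ 1 / (2 * C) := le_trans (by nlinarith) hτC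
    calc C * ((N : ℝ) ^ (3 / 2 - s) + τ ^ 2) ≤ C * (1 / (2 * C) + 1 / (2 * C)) := by gcongr
      _ = 1 := by field_simp; norm_num
  -- With target `1` the bootstrap closes on itself: the bound being propagated is the a priori
  -- bound required.
  have hwiener := hcA.convergence (Y := 1) hγ hT hNe hM LICFP.isWienerModuleNorm_wienerNorm hU hinit
    hτL' (by positivity) ((hexpC _ hXA).trans hsmall) (fun n _ h => h)
  -- The a priori bound is now known at every level, so no smallness of the discrete $L^2$ error is
  -- needed.
  have hfinal := hc2.convergence hγ hT hNe hM LICFP.isWienerModuleNorm_gridNorm hU hinit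
    hτL' (by positivity) (hexpC _ hX2) (fun n hn _ => hwiener n hn)
  intro n _ hnM
  have htn : (n : ℝ) * τ ∈ Set.Icc 0 T := by
    have : (n : ℝ) ≤ M := by exact_mod_cast hnM
    exact ⟨by positivity, by rw [← hMτ]; gcongr⟩
  have hun : (fun j => u (n * τ) (LICFP.gridPoint N j) - U n j) =
      LICFP.gridEval hs N (w (n * τ)) - U n := by
    funext j
    rw [Pi.sub_apply, LICFP.gridEval_apply, hw.eq _ htn]
  have hψn : (fun j => ψ (n * τ) (LICFP.gridPoint N j) - Ψ n j) =
      ((Real.exp (-γ * (n * τ)) : ℝ) : ℂ) •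
        fun j => u (n * τ) (LICFP.gridPoint N j) - U n j := by
    funext j
    rw [Pi.smul_apply, smul_eq_mul, hψ _ htn, hΨ, mul_sub]
  have h1 := hfinal n hnM
  rw [← hun] at h1
  refine ⟨h1, ?_⟩
  rw [hψn, LICFP.gridNorm_smul, Complex.norm_real, Real.norm_of_nonneg (Real.exp_pos _).le,
    mul_comm C, mul_assoc]
  exact mul_le_mul_of_nonneg_left h1 (Real.exp_pos _).le
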